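/- Throughout, alphabets are finite and nonempty, $\log$ is to base $2$, and $|x|^+=\max\{x,0\}$. $\mathcal P(\mathcal A)$ denotes the set of probability distributions on $\mathcal A$. **Rényi quantities.** For $\alpha\in(0,1)\cup(1,\infty)$ and $P,Q\in\mathcal P(\mathcal A)$ let $$F_\alpha(P,Q)=\Big(\sum_{a}P(a)^\alpha Q(a)^{1-\alpha}\Big)^{\frac1{1-\alpha}}$$ (for $\alpha>1$ with $\tfrac00=0$ and $\tfrac c0=\infty$ for $c>0$), and $$F_0(P,Q)=\sum_{a:P(a)>0}Q(a),\qquad F_1(P,Q)=\prod_{a:P(a)>0}\Big(\frac{Q(a)}{P(a)}\Big)^{P(a)},\qquad F_\infty(P,Q)=\min_{a:P(a)>0}\frac{Q(a)}{P(a)}.$$ Put $D_\alpha(P\|Q)=-\log F_\alpha(P,Q)\in[0,\infty]$ for $\alpha\in[0,\infty]$. For a channel (stochastic map) $\mathcal W:\mathcal X\to\mathcal Y$ with transition probabilities $\mathcal W(y|x)$ and $P\in\mathcal P(\mathcal X)$ let $(P\cdot\mathcal W)(x,y)=P(x)\mathcal W(y|x)$. The order-$\alpha$ Rényi capacity is $$I_\alpha(\mathcal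 W)=\max_{P\in\mathcal P(\mathcal X)}\ \min_{Q\in\mathcal P(\mathcal Y)}D_\alpha(P\cdot\mathcal W\,\|\,P\times Q).$$ **Channel simulation.** For $c\ge 0$, a simulation $\mathcal N:\mathcal X\to\mathcal Y$ with at most $c$ bits of communication is a channel of the form $$\mathcal N(y|x)=\sum_{k\in\mathcal K}\sum_{j=1}^{N}P_K(k)\,\mathcal E(j|x,k)\,\mathcal D(y|j,k),$$ where $N\ge1$ is an integer with $\log N\le c$, $P_K$ is a distribution on a finite alphabet $\mathcal K$ of arbitrary size (shared randomness), and $\mathcal E:\mathcal X\times\mathcal K\to\{1,\dots,N\}$, $\mathcal D:\{1,\dots,N\}\times\mathcal K\to\mathcal Y$ are stochastic maps. Let $\mathcal A(\mathcal W,c)$ be the set of all of them, and put $$D_\alpha(\mathcal W,\mathcal N)=\max_{P\in\mathcal P(\mathcal X)}D_\alpha(P\cdot\mathcal W\,\|\,P\cdot\mathcal N),\qquad \mathsf D_\alpha(\mathcal W,c)=\min_{\mathcal N\in\mathcal A(\mathcal W,c)}D_\alpha(\mathcal W,\mathcal N).$$ Let $\mathcal W^{\times n}$ be the $n$-fold product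 channel, $\mathcal W^{\times n}(y^n|x^n)=\prod_{i=1}^n\mathcal W(y_i|x_i)$. The strong converse exponent at rate $r$ is $$E_{\rm sc}^{(\alpha)}(\mathcal W,r)=\inf\Big\{\limsup_{n\to\infty}\tfrac1n\mathsf D_\alpha(\mathcal W^{\times n},c_n)\ \Big|\ (c_n)_{n\ge 1}\subset[0,\infty),\ \limsup_{n\to\infty}\tfrac{c_n}{n}\le r\Big\}.$$ **Theorem.** For every channel $\mathcal W:\mathcal X\to\mathcal Y$ and every real $r\ge0$, $$E_{\rm sc}^{(\alpha)}(\mathcal W,r)=\begin{cases}\displaystyle\max_{\alpha\le\beta\le1}\frac{\alpha(1-\beta)}{\beta(1-\alpha)}\big(I_\beta(\mathcal W)-r\big),&\alpha\in(0,1),\\[2mm] |I_\alpha(\mathcal W)-r|^+,&\alpha\in\{0\}\cup[1,\infty],\end{cases}$$ where the maximum in the first case is attained. -/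

import Mathlib

open scoped ENNReal

noncomputable section

namespace RenyiSim

/-- A discrete channel `W : X → Y`: `W x` is the output distribution `W(· | x)`. -/
abbrev Channel (X Y : Type*) [Fintype Y] := X → stdSimplex ℝ Y

/-- The transition probability `W(y | x)`. -/
def transProb {X Y : Type*} [Fintype Y] (W : Channel X Y) (x : X) (y : Y) : ℝ := (W x).1 y

/-- The joint distribution `P · W` of input and output. -/
def joint {X Y : Type*} [Fintype X] [Fintype Y] (P : stdSimplex ℝ X) (W : Channel X Y) :
    X × Y → ℝ :=
  fun z => P.1 z.1 * transProb W z.1 z.2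

/-- The `n`-fold product channel `W^{×n}`. -/
def prodChannel {X Y : Type*} [Fintype Y] (W : Channel X Y) (n : ℕ) :
    Channel (Fin n → X) (Fin n → Y) :=
  fun x => ⟨fun y => ∏ i, transProb W (x i) (y i), by
    classical
    refine ⟨fun y => Finset.prod_nonneg fun i _ => (W (x i)).2.1 (y i), ?_⟩
    have h := Fintype.prod_sum (fun (i : Fin n) (y : Y) => transProb W (x i) y)
    rw [← h]
    exact Finset.prod_eq_one fun i _ => (W (x i)).2.2⟩

/-- Order-`α` fidelity of nonnegative vectors, `α ∈ [0, ∞]`. The arithmetic is that of `[0, ∞]`,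
where `0 ^ s = ∞` for `s < 0`, `0 * ∞ = 0`, `a * ∞ = ∞` for `a > 0` and `∞ ^ s = 0` for `s < 0`;
this is the usual convention `0 / 0 = 0`, `a / 0 = ∞` in the sum for `α > 1`.
At `α = ∞` the minimum of `Q / P` runs over the support of `P`. -/
def fidelity {A : Type*} [Fintype A] (α : ℝ≥0∞) (P Q : A → ℝ) : ℝ≥0∞ :=
  if α = 0 then
    ∑ a, if 0 < P a then ENNReal.ofReal (Q a) else 0
  else if α = 1 then
    ∏ a, (ENNReal.ofReal (Q a) / ENNReal.ofReal (P a)) ^ P a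
  else if α = ∞ then
    ⨅ a : {a : A // 0 < P a}, ENNReal.ofReal (Q a) / ENNReal.ofReal (P a)
  else
    (∑ a, ENNReal.ofReal (P a) ^ α.toReal * ENNReal.ofReal (Q a) ^ (1 - α.toReal)) ^
      (1 / (1 - α.toReal))

/-- Order-`α` Rényi divergence `D_α(P‖Q) = - log₂ F_α(P, Q)`, with `- log₂ 0 = ∞`. -/
def renyiDiv {A : Type*} [Fintype A] (α : ℝ≥0∞) (P Q : A → ℝ) : EReal :=
  -(ENNReal.log (fidelity α P Q) / ((Real.log 2 : ℝ) : EReal))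

/-- The Rényi mutual information `I_α(X:Y) = min_Q D_α(P_XY ‖ P_X × Q)`,
where `P_X` is the first marginal of `P_XY`. -/
def renyiMutualInfo {X Y : Type*} [Fintype X] [Fintype Y] (α : ℝ≥0∞) (P : X × Y → ℝ) : EReal :=
  ⨅ Q : stdSimplex ℝ Y, renyiDiv α P (fun z => (∑ y, P (z.1, y)) * Q.1 z.2)

/-- The order-`α` Rényi capacity `I_α(W)`. -/
def renyiCapacity {X Y : Type*} [Fintype X] [Fintype Y] (α : ℝ≥0∞) (W : Channel X Y) : EReal :=
  ⨆ P : stdSimplex ℝ X, renyiMutualInfo α (joint P W)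

/-- `N` is a simulation using at most `c` bits of communication: with shared randomness `K` of
some distribution `PK` on a finite alphabet of arbitrary size, the sender applies a stochastic map
`E : X × K → {1, …, M}` with `log₂ M ≤ c`, and the receiver applies a stochastic map
`D : {1, …, M} × K → Y`. -/
def IsSimulation {X Y : Type*} [Fintype Y] (c : ℝ) (N : Channel X Y) : Prop :=
  ∃ M : ℕ, 0 < M ∧ Real.logb 2 M ≤ c ∧
    ∃ (m : ℕ) (PK : stdSimplex ℝ (Fin m)) (E : Channel (X × Fin m) (Fin M))
      (D : Channel (Fin M × Fin m) Y),
      ∀ x y, transProb N x y = ∑ k, ∑ j, PK.1 k * transProb E (x, k) j * transProb D (j, k) y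

/-- `D_α(W, N) = max_P D_α(P · W ‖ P · N)`. -/
def channelDiv {X Y : Type*} [Fintype X] [Fintype Y] (α : ℝ≥0∞) (W N : Channel X Y) : EReal :=
  ⨆ P : stdSimplex ℝ X, renyiDiv α (joint P W) (joint P N)

/-- The optimal performance of simulating `W` with at most `c` bits of communication. -/
def optDiv {X Y : Type*} [Fintype X] [Fintype Y] (α : ℝ≥0∞) (W : Channel X Y) (c : ℝ) : EReal :=
  ⨅ (N : Channel X Y) (_ : IsSimulation c N), channelDiv α W N

/-- The strong converse exponent: the infimum of `limsup (1/n) D_α(W^{×n}, c_n)` over all sequences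
of communication costs with `limsup c_n / n ≤ r`. -/
def strongConverseExponent {X Y : Type*} [Fintype X] [Fintype Y] (α : ℝ≥0∞) (W : Channel X Y)
    (r : ℝ) : EReal :=
  sInf {e : EReal | ∃ c : ℕ → ℝ, (∀ n, 0 ≤ c n) ∧
    Filter.limsup (fun n : ℕ => ((c n / n : ℝ) : EReal)) Filter.atTop ≤ (r : EReal) ∧
    e = Filter.limsup (fun n : ℕ => optDiv α (prodChannel W n) (c n) / (n : EReal)) Filter.atTop}

end RenyiSim

end

/-! Everything is phrased through the fidelity `F_α = 2^(-D_α)`, which is monotone and homogeneous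
of degree one in its second argument.

Converse. A simulation with `c` bits is pointwise at most `2^c Q`, where `Q` is the decoder's output
for a uniform message (`IsSimulation.exists_le`). Hence `P·N ≤ 2^c (P × Q)`, and `c` bits lower the
divergence from product outputs by at most `c` (`le_optDiv_of_fidelity_le`). On i.i.d. inputs the
minimal divergence from product outputs is at least `n` times its one-letter value
(`exists_fidelity_prod_le`), which gives `I_α - r`. For `α < 1` the fact that `N` is itself
normalized gives more: Hölder's inequality compares order `α` of `N` with any order `β` in `[α, 1)`
of the dominating measure, at the price of the power `α(1-β)/(β(1-α))`
(`fidelity_le_rpow_fidelity`).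

Achievability. Subdistributions `ν_x ≤ 2^c Q` can be simulated with `c` bits up to a factor `4` by
rejection sampling from shared samples of `Q` (`exists_isSimulation_ge`), so up to two bits only a
good `ν` is needed (`optDiv_le`). A minimax theorem gives one `Q` whose divergence from every
`W(·|x)` is almost at most `I_α` (`exists_output_fidelity_ge`). For order `0`, `ν` is a rescaled
restriction of `Q^n` to the support; for `1 ≤ α < ∞` it is `W^n` truncated at `2^c Q^n`; for order
`∞` it is a multiple of `W^n`.

For `0 < α < 1` one simulates instead another channel `V` on its typical set, scaled down until it
lies below `2^(nr) Q`. With `a = α/(1-α)` the exponent for input type `P` is `a D(V‖W|P) + |D(V‖Q|P)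
- r|^+`. Writing `|t|^+` as the maximum of `s t` over `s ∈ [0,1]` and exchanging it with the minimum
over `(V, Q)`, the value `s` corresponds to `s = α(1-β)/(β(1-α))`, and the best `V` is the tilted
distribution proportional to `W^β Q^(1-β)` (`exists_strategy`). Compactness of the simplex of types
reduces to finitely many strategies, whose output laws are averaged at constant cost.

The maximum over `β` is attained because Sibson's closed form is jointly continuous in order and
input, up to and including `β = 1` (`exists_max_exponent`). -/

namespace RenyiSim

/-! ### Fidelities: monotonicity, homogeneity and Hölder bounds. -/

section Basic

variable {A : Type*} [Fintype A]

lemma fidelity_zero (P Q : A → ℝ) :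
    fidelity 0 P Q = ∑ a, if 0 < P a then ENNReal.ofReal (Q a) else 0 := by
  simp [fidelity]

lemma fidelity_one (P Q : A → ℝ) :
    fidelity 1 P Q = ∏ a, (ENNReal.ofReal (Q a) / ENNReal.ofReal (P a)) ^ P a := by
  simp [fidelity]

lemma fidelity_top (P Q : A → ℝ) :
    fidelity ∞ P Q = ⨅ a : {a : A // 0 < P a}, ENNReal.ofReal (Q a) / ENNReal.ofReal (P a) := by
  simp [fidelity]

lemma fidelity_ofReal {α : ℝ} (h0 : 0 < α) (h1 : α ≠ 1) (P Q : A → ℝ) :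
    fidelity (ENNReal.ofReal α) P Q =
      (∑ a, ENNReal.ofReal (P a) ^ α * ENNReal.ofReal (Q a) ^ (1 - α)) ^ (1 / (1 - α)) := by
  simp [fidelity, h0.not_ge, h1, ENNReal.toReal_ofReal h0.le]

lemma order_cases (α : ℝ≥0∞) :
    α = 0 ∨ α = 1 ∨ α = ∞ ∨ ∃ a : ℝ, 0 < a ∧ a ≠ 1 ∧ α = ENNReal.ofReal a := by
  by_cases h0 : α = 0
  · exact Or.inl h0
  by_cases h1 : α = 1
  · exact Or.inr (Or.inl h1)
  by_cases ht : α = ∞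
  · exact Or.inr (Or.inr (Or.inl ht))
  refine Or.inr (Or.inr (Or.inr ⟨α.toReal, ENNReal.toReal_pos h0 ht, ?_, ?_⟩))
  · intro h
    apply h1
    rw [← ENNReal.ofReal_toReal ht, h, ENNReal.ofReal_one]
  · rw [ENNReal.ofReal_toReal ht]

lemma log_two_pos_ereal : (0 : EReal) < ((Real.log 2 : ℝ) : EReal) := by
  exact_mod_cast Real.log_pos one_lt_two

lemma log_ofReal_two_rpow (t : ℝ) :
    ENNReal.log (ENNReal.ofReal (2 ^ t)) = ((Real.log 2 * t : ℝ) : EReal) := by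
  rw [ENNReal.log_ofReal_of_pos (by positivity), Real.log_rpow two_pos, mul_comm]

/-- With its mirror image below, this moves every divergence bound to fidelities, so that logarithms
in `EReal` need not be manipulated again. -/
lemma renyiDiv_le_iff (α : ℝ≥0∞) (P Q : A → ℝ) (t : ℝ) :
    renyiDiv α P Q ≤ (t : EReal) ↔ ENNReal.ofReal (2 ^ (-t)) ≤ fidelity α P Q := by
  rw [renyiDiv, EReal.neg_le, EReal.le_div_iff_mul_le log_two_pos_ereal (EReal.coe_ne_top _),
    ← ENNReal.log_le_log_iff, log_ofReal_two_rpow, mul_comm]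
  norm_cast

lemma le_renyiDiv_iff (α : ℝ≥0∞) (P Q : A → ℝ) (t : ℝ) :
    (t : EReal) ≤ renyiDiv α P Q ↔ fidelity α P Q ≤ ENNReal.ofReal (2 ^ (-t)) := by
  rw [renyiDiv, EReal.le_neg, EReal.div_le_iff_le_mul log_two_pos_ereal (EReal.coe_ne_top _),
    ← ENNReal.log_le_log_iff, log_ofReal_two_rpow]
  norm_cast

lemma rpow_antitone_of_nonpos {z : ℝ} (hz : z ≤ 0) : Antitone fun x : ℝ≥0∞ => x ^ z := by
  intro x y hxy
  have h := ENNReal.rpow_le_rpow hxy (neg_nonneg.2 hz)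
  rw [ENNReal.rpow_neg, ENNReal.rpow_neg] at h
  exact ENNReal.inv_le_inv.1 h

lemma fidelity_mono (α : ℝ≥0∞) {P Q Q' : A → ℝ} (hP : ∀ a, 0 ≤ P a) (h : ∀ a, Q a ≤ Q' a) :
    fidelity α P Q ≤ fidelity α P Q' := by
  rcases order_cases α with rfl | rfl | rfl | ⟨a, ha0, ha1, rfl⟩
  · simp only [fidelity_zero]
    gcongr with a
    split_ifs
    · exact ENNReal.ofReal_le_ofReal (h a)
    · exact le_rfl
  · simp only [fidelity_one]
    gcongr with a
    · exact hP a
    · exact h a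
  · simp only [fidelity_top]
    gcongr with a
    exact h a
  · simp only [fidelity_ofReal ha0 ha1]
    rcases lt_or_gt_of_ne ha1 with h1 | h1
    · have : 0 ≤ 1 - a := by linarith
      gcongr with i
      exact h i
    · apply rpow_antitone_of_nonpos (by rw [one_div, inv_nonpos]; linarith)
      refine Finset.sum_le_sum fun i _ => ?_
      exact mul_le_mul_right (rpow_antitone_of_nonpos (by linarith)
        (ENNReal.ofReal_le_ofReal (h i))) _

lemma prod_ofReal_rpow_sum {c : ℝ} (hc : 0 < c) (P : A → ℝ) :
    ∏ a, ENNReal.ofReal c ^ P a = ENNReal.ofReal (c ^ ∑ a, P a) := by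
  simp_rw [ENNReal.ofReal_rpow_of_pos hc]
  rw [← ENNReal.ofReal_prod_of_nonneg (fun i _ => by positivity), Real.rpow_sum_of_pos hc]

/-- The outer power `1/(1-α)` undoes the inner power `1-α`; at order `1` the same role is played by
`∑ P = 1`. This is what turns a factor `2^c` into an additive `c` for all orders at once. -/
lemma fidelity_const_mul (α : ℝ≥0∞) {P Q : A → ℝ} (hP : ∀ a, 0 ≤ P a) (hP1 : ∑ a, P a = 1)
    {c : ℝ} (hc : 0 < c) :
    fidelity α P (fun a => c * Q a) = ENNReal.ofReal c * fidelity α P Q := by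
  have hc0 : ENNReal.ofReal c ≠ 0 := by simpa using hc
  rcases order_cases α with rfl | rfl | rfl | ⟨a, ha0, ha1, rfl⟩
  · simp only [fidelity_zero, Finset.mul_sum]
    refine Finset.sum_congr rfl fun a _ => ?_
    split_ifs <;> simp [ENNReal.ofReal_mul hc.le]
  · simp only [fidelity_one, ENNReal.ofReal_mul hc.le, mul_div_assoc]
    rw [Finset.prod_congr rfl fun a _ => ENNReal.mul_rpow_of_nonneg _ _ (hP a),
      Finset.prod_mul_distrib, prod_ofReal_rpow_sum hc, hP1, Real.rpow_one]
  · simp only [fidelity_top, ENNReal.ofReal_mul hc.le, mul_div_assoc]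
    rw [ENNReal.mul_iInf_of_ne hc0 ENNReal.ofReal_ne_top]
  · simp only [fidelity_ofReal ha0 ha1, ENNReal.ofReal_mul hc.le]
    have h1a : 1 - a ≠ 0 := sub_ne_zero.2 ha1.symm
    have key : ∀ (x : ℝ≥0∞) (z : ℝ), (ENNReal.ofReal c * x) ^ z =
        ENNReal.ofReal c ^ z * x ^ z := by
      intro x z
      rw [ENNReal.mul_rpow_eq_ite, if_neg]
      simp [hc0]
    simp_rw [key, mul_left_comm _ (ENNReal.ofReal c ^ (1 - a))]
    rw [← Finset.mul_sum, ENNReal.ofReal_rpow_of_pos hc]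
    have hc' : ENNReal.ofReal (c ^ (1 - a)) ≠ 0 := by simpa using Real.rpow_pos_of_pos hc _
    rw [ENNReal.mul_rpow_eq_ite, if_neg (by simp [hc']),
      ENNReal.ofReal_rpow_of_pos (by positivity), ← Real.rpow_mul hc.le, mul_one_div_cancel h1a,
      Real.rpow_one]

/-- Hölder with conjugate exponents `1/α` and `1/(1-α)`; the factor containing `Q` is at most one.
-/
lemma sum_mul_rpow_le {α : ℝ} (h0 : 0 < α) (h1 : α ≤ 1) (f Q : A → ℝ≥0∞) (hQ : ∑ a, Q a ≤ 1) :
    ∑ a, f a * Q a ^ (1 - α) ≤ (∑ a, f a ^ (1 / α)) ^ α := by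
  rcases h1.eq_or_lt with rfl | h1
  · simp
  have hpq : (1 / α).HolderConjugate (1 / (1 - α)) := by
    rw [Real.holderConjugate_iff]
    refine ⟨by rw [lt_div_iff₀ h0]; linarith, by simp⟩
  have h := ENNReal.inner_le_Lp_mul_Lq Finset.univ f (fun a => Q a ^ (1 - α)) hpq
  refine h.trans ?_
  have h2 : ∀ a, (Q a ^ (1 - α)) ^ (1 / (1 - α)) = Q a := fun a => by
    rw [← ENNReal.rpow_mul, mul_one_div_cancel (by linarith), ENNReal.rpow_one]
  simp only [h2, one_div_one_div]
  calc _ ≤ (∑ a, f a ^ (1 / α)) ^ α * 1 := by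
        gcongr
        exact ENNReal.rpow_le_one hQ (by linarith)
    _ = _ := mul_one _

/-- Reverse Hölder, deduced from the usual one with exponents `α` and `α/(α-1)` applied to `f^(1/α)
= (f Q^(1-α))^(1/α) · Q^((α-1)/α)`. -/
lemma sum_rpow_le_of_one_lt {α : ℝ} (h1 : 1 < α) (f Q : A → ℝ≥0∞) (hQ : ∑ a, Q a ≤ 1) :
    (∑ a, f a ^ (1 / α)) ^ α ≤ ∑ a, f a * Q a ^ (1 - α) := by
  have h0 : 0 < α := by linarith
  -- Once this sum is finite, `f` vanishes wherever `Q` does, which the factorization needs.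
  by_cases hT : ∑ a, f a * Q a ^ (1 - α) = ∞
  · rw [hT]; exact le_top
  have hQt : ∀ a, Q a ≠ ∞ := fun a =>
    ne_top_of_le_ne_top ENNReal.one_ne_top
      ((Finset.single_le_sum (fun _ _ => zero_le) (Finset.mem_univ a)).trans hQ)
  have hpq : α.HolderConjugate (α / (α - 1)) := by
    rw [Real.holderConjugate_iff]
    refine ⟨h1, ?_⟩
    field_simp
    ring
  have h := ENNReal.inner_le_Lp_mul_Lq Finset.univ (fun a => (f a * Q a ^ (1 - α)) ^ (1 / α))
    (fun a => Q a ^ ((α - 1) / α)) hpq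
  have e1 : ∀ a, (f a * Q a ^ (1 - α)) ^ (1 / α) * Q a ^ ((α - 1) / α) = f a ^ (1 / α) := by
    intro a
    by_cases hq : Q a = 0
    · have hf : f a = 0 := by
        by_contra hf
        apply hT
        rw [ENNReal.sum_eq_top]
        refine ⟨a, Finset.mem_univ _, ?_⟩
        rw [hq, ENNReal.zero_rpow_of_neg (by linarith), ENNReal.mul_top hf]
      simp [hf, h0]
    · rw [ENNReal.mul_rpow_of_nonneg _ _ (by positivity), ← ENNReal.rpow_mul, mul_assoc,
        ← ENNReal.rpow_add _ _ hq (hQt a)]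
      have : (1 - α) * (1 / α) + (α - 1) / α = 0 := by ring
      rw [this, ENNReal.rpow_zero, mul_one]
  have e2 : ∀ a, ((f a * Q a ^ (1 - α)) ^ (1 / α)) ^ α = f a * Q a ^ (1 - α) := fun a => by
    rw [← ENNReal.rpow_mul, one_div_mul_cancel h0.ne', ENNReal.rpow_one]
  have e3 : ∀ a, (Q a ^ ((α - 1) / α)) ^ (α / (α - 1)) = Q a := fun a => by
    have : (α - 1) / α * (α / (α - 1)) = 1 := by
      have : α - 1 ≠ 0 := by linarith
      field_simp
    rw [← ENNReal.rpow_mul, this, ENNReal.rpow_one]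
  simp only [e1, e2, e3] at h
  have h' : ∑ a, f a ^ (1 / α) ≤ (∑ a, f a * Q a ^ (1 - α)) ^ (1 / α) := by
    refine h.trans ?_
    calc _ ≤ (∑ a, f a * Q a ^ (1 - α)) ^ (1 / α) * 1 := by
          gcongr
          exact ENNReal.rpow_le_one hQ (by
            rw [one_div_div]; exact div_nonneg (by linarith) h0.le)
      _ = _ := mul_one _
  calc _ ≤ ((∑ a, f a * Q a ^ (1 - α)) ^ (1 / α)) ^ α := by gcongr
    _ = _ := by rw [← ENNReal.rpow_mul, one_div_mul_cancel h0.ne', ENNReal.rpow_one]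

/-- Hölder's inequality in the form that bounds fidelities of every order `α ≠ 0, 1, ∞`. -/
lemma sum_mul_rpow_rpow_le {α : ℝ} (h0 : 0 < α) (h1 : α ≠ 1) (f Q : A → ℝ≥0∞)
    (hQ : ∑ a, Q a ≤ 1) :
    (∑ a, f a * Q a ^ (1 - α)) ^ (1 / (1 - α)) ≤ (∑ a, f a ^ (1 / α)) ^ (α / (1 - α)) := by
  rw [div_eq_mul_one_div α, ENNReal.rpow_mul]
  rcases lt_or_gt_of_ne h1 with h1 | h1
  · have : 0 ≤ 1 - α := by linarith
    gcongr
    exact sum_mul_rpow_le h0 h1.le f Q hQ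
  · exact rpow_antitone_of_nonpos (by rw [one_div, inv_nonpos]; linarith)
      (sum_rpow_le_of_one_lt h1 f Q hQ)

lemma sum_ofReal_eq_one {P : A → ℝ} (hP : ∀ a, 0 ≤ P a) (hP1 : ∑ a, P a = 1) :
    ∑ a, ENNReal.ofReal (P a) = 1 := by
  rw [← ENNReal.ofReal_sum_of_nonneg fun a _ => hP a, hP1, ENNReal.ofReal_one]

lemma fidelity_one_eq_ofReal {P Q : A → ℝ} (hP : ∀ a, 0 ≤ P a)
    (hQ : ∀ a, 0 ≤ Q a) :
    fidelity 1 P Q = ENNReal.ofReal (∏ a, (Q a / P a) ^ P a) := by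
  rw [fidelity_one, ENNReal.ofReal_prod_of_nonneg
    (fun a _ => Real.rpow_nonneg (div_nonneg (hQ a) (hP a)) _)]
  refine Finset.prod_congr rfl fun a _ => ?_
  rcases (hP a).eq_or_lt with h | h
  · simp [← h]
  · rw [← ENNReal.ofReal_div_of_pos h, ENNReal.ofReal_rpow_of_nonneg (div_nonneg (hQ a) (hP a)) (hP a)]

lemma fidelity_le_one (α : ℝ≥0∞) {P Q : A → ℝ} (hP : ∀ a, 0 ≤ P a) (hP1 : ∑ a, P a = 1)
    (hQ : ∀ a, 0 ≤ Q a) (hQ1 : ∑ a, Q a = 1) : fidelity α P Q ≤ 1 := by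
  rcases order_cases α with rfl | rfl | rfl | ⟨a, ha0, ha1, rfl⟩
  · rw [fidelity_zero, ← sum_ofReal_eq_one hQ hQ1]
    gcongr with a
    split_ifs
    · exact le_rfl
    · exact zero_le
  · rw [fidelity_one_eq_ofReal hP hQ, ← ENNReal.ofReal_one]
    apply ENNReal.ofReal_le_ofReal
    have h := Real.geom_mean_le_arith_mean_weighted Finset.univ P (fun a => Q a / P a)
      (fun a _ => hP a) hP1 (fun a _ => div_nonneg (hQ a) (hP a))
    refine h.trans ?_
    rw [← hQ1]
    refine Finset.sum_le_sum fun a _ => ?_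
    rcases (hP a).eq_or_lt with h | h
    · simp [← h, hQ a]
    · rw [mul_div_cancel₀ _ h.ne']
  · rw [fidelity_top]
    by_contra! h
    have hlt : ∀ a, 0 < P a → P a < Q a := by
      intro a ha
      have h' := h.trans_le (iInf_le _ (⟨a, ha⟩ : {a : A // 0 < P a}))
      rw [← ENNReal.ofReal_div_of_pos ha, ENNReal.one_lt_ofReal, lt_div_iff₀ ha] at h'
      simpa using h'
    have hle : ∀ a, P a ≤ Q a := fun a => by
      rcases (hP a).eq_or_lt with h | h
      · rw [← h]; exact hQ a
      · exact (hlt a h).le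
    obtain ⟨a, -, ha⟩ : ∃ a ∈ Finset.univ, 0 < P a := by
      by_contra! h0
      have := Finset.sum_nonpos h0
      linarith
    have := Finset.sum_lt_sum (fun a _ => hle a) ⟨a, Finset.mem_univ a, hlt a ha⟩
    linarith
  · rw [fidelity_ofReal ha0 ha1]
    refine (sum_mul_rpow_rpow_le ha0 ha1 (fun i => ENNReal.ofReal (P i) ^ a)
      (fun i => ENNReal.ofReal (Q i)) (sum_ofReal_eq_one hQ hQ1).le).trans ?_
    simp_rw [← ENNReal.rpow_mul, mul_one_div_cancel ha0.ne', ENNReal.rpow_one]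
    rw [sum_ofReal_eq_one hP hP1, ENNReal.one_rpow]

/-- Comparison of fidelities of two orders below `1` under a domination constraint. -/
lemma fidelity_le_rpow_fidelity {α β : ℝ} (h0 : 0 < α) (hαβ : α ≤ β) (hβ : β < 1)
    {P N R : A → ℝ} (hN : ∀ a, 0 ≤ N a) (hN1 : ∑ a, N a = 1) (h : ∀ a, N a ≤ R a) :
    fidelity (ENNReal.ofReal α) P N ≤
      fidelity (ENNReal.ofReal β) P R ^ (α * (1 - β) / (β * (1 - α))) := by
  have hβ0 : 0 < β := h0.trans_le hαβ
  have hα1 : 0 < 1 - α := by linarith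
  have hβ1 : 0 < 1 - β := by linarith
  have hab : 0 < α / β := div_pos h0 hβ0
  have hab1 : α / β ≤ 1 := by rw [div_le_one hβ0]; exact hαβ
  rw [fidelity_ofReal h0 (by linarith), fidelity_ofReal hβ0 hβ.ne, ← ENNReal.rpow_mul]
  have e : 1 / (1 - β) * (α * (1 - β) / (β * (1 - α))) = α / β * (1 / (1 - α)) := by
    field_simp
  rw [e, ENNReal.rpow_mul]
  gcongr
  set p := fun a => ENNReal.ofReal (P a)
  set n := fun a => ENNReal.ofReal (N a)
  set ρ := fun a => ENNReal.ofReal (R a)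
  calc ∑ a, p a ^ α * n a ^ (1 - α)
      ≤ ∑ a, (p a ^ β * ρ a ^ (1 - β)) ^ (α / β) * n a ^ (1 - α / β) := by
        refine Finset.sum_le_sum fun a _ => ?_
        rw [ENNReal.mul_rpow_of_nonneg _ _ hab.le, ← ENNReal.rpow_mul, mul_div_cancel₀ _ hβ0.ne',
          ← ENNReal.rpow_mul, mul_assoc]
        refine mul_le_mul_right ?_ _
        -- Only the first part of the exponent is spent on `N ≤ R`; the rest stays on `N` so that
        -- Hölder can use `∑ N = 1`.
        have e2 : 1 - α = (1 - β) * (α / β) + (1 - α / β) := by field_simp; ring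
        rw [e2, ENNReal.rpow_add_of_nonneg _ _ (by positivity) (by linarith)]
        gcongr
        exact ENNReal.ofReal_le_ofReal (h a)
    _ ≤ (∑ a, ((p a ^ β * ρ a ^ (1 - β)) ^ (α / β)) ^ (1 / (α / β))) ^ (α / β) :=
        sum_mul_rpow_le hab hab1 _ n (sum_ofReal_eq_one hN hN1).le
    _ = _ := by
        simp_rw [← ENNReal.rpow_mul (p _ ^ β * _), mul_one_div_cancel hab.ne', ENNReal.rpow_one]
        rfl

end Basic

end RenyiSim

namespace RenyiSim

/-! ### Expectations over independent letters. -/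

section ProductSums

/-- The expectation of a sum of functions of independent letters. -/
lemma sum_prod_mul_sum {Z : Type*} [Fintype Z] {n : ℕ} (p f : Fin n → Z → ℝ)
    (hp : ∀ i, ∑ z, p i z = 1) :
    ∑ z : Fin n → Z, (∏ i, p i (z i)) * ∑ i, f i (z i) = ∑ i, ∑ z, p i z * f i z := by
  classical
  simp_rw [Finset.mul_sum]
  rw [Finset.sum_comm]
  refine Finset.sum_congr rfl fun i _ => ?_
  have h : ∀ z : Fin n → Z, (∏ j, p j (z j)) * f i (z i) =
      ∏ j, (p j (z j) * if j = i then f i (z j) else 1) := fun z => by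
    rw [Finset.prod_mul_distrib, Finset.prod_ite_eq' Finset.univ i (fun j => f i (z j))]
    simp
  simp_rw [h]
  rw [← Fintype.prod_sum (fun j z => p j z * if j = i then f i z else 1),
    Finset.prod_eq_single i]
  · simp
  · intro j _ hj
    simp [hj, hp]
  · simp

lemma sum_prod_eq_one {Z : Type*} [Fintype Z] {n : ℕ} (p : Fin n → Z → ℝ)
    (hp : ∀ i, ∑ z, p i z = 1) : ∑ z : Fin n → Z, ∏ i, p i (z i) = 1 := by
  classical
  rw [← Fintype.prod_sum p]
  exact Finset.prod_eq_one fun i _ => hp i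

end ProductSums

variable {X Y : Type*}

/-- The product of an input distribution and an output distribution. -/
def indep (P : X → ℝ) (Q : Y → ℝ) : X × Y → ℝ := fun z => P z.1 * Q z.2

lemma indep_nonneg {P : X → ℝ} {Q : Y → ℝ} (hP : ∀ x, 0 ≤ P x) (hQ : ∀ y, 0 ≤ Q y)
    (z : X × Y) : 0 ≤ indep P Q z := mul_nonneg (hP _) (hQ _)

variable [Fintype Y]

lemma transProb_nonneg (W : Channel X Y) (x : X) (y : Y) : 0 ≤ transProb W x y := (W x).2.1 y

lemma sum_transProb (W : Channel X Y) (x : X) : ∑ y, transProb W x y = 1 := (W x).2.2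

lemma transProb_le_one (W : Channel X Y) (x : X) (y : Y) : transProb W x y ≤ 1 := by
  rw [← sum_transProb W x]
  exact Finset.single_le_sum (fun y _ => transProb_nonneg W x y) (Finset.mem_univ y)

lemma transProb_prodChannel (W : Channel X Y) {n : ℕ} (x : Fin n → X) (y : Fin n → Y) :
    transProb (prodChannel W n) x y = ∏ i, transProb W (x i) (y i) := rfl

variable [Fintype X]

/-- The `n`-fold product distribution. -/
noncomputable def prodDist (P : stdSimplex ℝ X) (n : ℕ) : stdSimplex ℝ (Fin n → X) :=
  ⟨fun x => ∏ i, P.1 (x i), fun _ => Finset.prod_nonneg fun _ _ => P.2.1 _,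
    sum_prod_eq_one (fun _ => P.1) fun _ => P.2.2⟩

lemma joint_nonneg (P : stdSimplex ℝ X) (W : Channel X Y) (z : X × Y) : 0 ≤ joint P W z :=
  mul_nonneg (P.2.1 _) (transProb_nonneg _ _ _)

lemma sum_joint_right (P : stdSimplex ℝ X) (W : Channel X Y) (x : X) :
    ∑ y, joint P W (x, y) = P.1 x := by
  simp only [joint]
  rw [← Finset.mul_sum, sum_transProb, mul_one]

lemma sum_joint (P : stdSimplex ℝ X) (W : Channel X Y) : ∑ z, joint P W z = 1 := by
  rw [Fintype.sum_prod_type]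
  simp_rw [sum_joint_right]
  exact P.2.2

lemma renyiMutualInfo_joint (α : ℝ≥0∞) (P : stdSimplex ℝ X) (W : Channel X Y) :
    renyiMutualInfo α (joint P W) =
      ⨅ Q : stdSimplex ℝ Y, renyiDiv α (joint P W) (indep P.1 Q.1) := by
  simp only [renyiMutualInfo, sum_joint_right]
  rfl

/-! ### Sibson's closed form for the optimal output distribution. -/

section ClosedForm

/-- Since `P^α P^(1-α) = P`, the input enters linearly and `Q` factors out of the sum over `x`. -/
lemma fidelity_joint_indep {α : ℝ} (h0 : 0 < α) (h1 : α ≠ 1) (P : stdSimplex ℝ X)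
    (W : Channel X Y) (Q : Y → ℝ) :
    fidelity (ENNReal.ofReal α) (joint P W) (indep P.1 Q) =
      (∑ y, ENNReal.ofReal (∑ x, P.1 x * transProb W x y ^ α) *
        ENNReal.ofReal (Q y) ^ (1 - α)) ^ (1 / (1 - α)) := by
  rw [fidelity_ofReal h0 h1, Fintype.sum_prod_type, Finset.sum_comm]
  congr 1
  refine Finset.sum_congr rfl fun y _ => ?_
  rw [ENNReal.ofReal_sum_of_nonneg
    (fun x _ => mul_nonneg (P.2.1 x) (Real.rpow_nonneg (transProb_nonneg W x y) _)),
    Finset.sum_mul]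
  refine Finset.sum_congr rfl fun x _ => ?_
  simp only [joint, indep]
  rw [ENNReal.ofReal_mul (P.2.1 x), ENNReal.ofReal_mul (P.2.1 x), ENNReal.ofReal_mul (P.2.1 x),
    ← ENNReal.ofReal_rpow_of_nonneg (transProb_nonneg W x y) h0.le]
  rcases (P.2.1 x).eq_or_lt with h | h
  · simp [← h, h0]
  · rw [ENNReal.mul_rpow_of_ne_top ENNReal.ofReal_ne_top ENNReal.ofReal_ne_top,
      ENNReal.mul_rpow_of_ne_top ENNReal.ofReal_ne_top ENNReal.ofReal_ne_top]
    have e : ENNReal.ofReal (P.1 x) ^ α * ENNReal.ofReal (P.1 x) ^ (1 - α) =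
        ENNReal.ofReal (P.1 x) := by
      rw [← ENNReal.rpow_add _ _ (by simpa using h) ENNReal.ofReal_ne_top]
      simp
    rw [mul_mul_mul_comm, e, mul_assoc]

/-- Sibson's sum `∑_y (∑_x P(x) W(y|x)^α)^(1/α)`. -/
noncomputable def sibsonSum (α : ℝ) (P : X → ℝ) (W : Channel X Y) : ℝ :=
  ∑ y, (∑ x, P x * transProb W x y ^ α) ^ (1 / α)

lemma sibson_inner_nonneg (α : ℝ) (P : stdSimplex ℝ X) (W : Channel X Y) (y : Y) :
    0 ≤ ∑ x, P.1 x * transProb W x y ^ α :=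
  Finset.sum_nonneg fun x _ => mul_nonneg (P.2.1 x) (Real.rpow_nonneg (transProb_nonneg W x y) _)

lemma sibsonSum_pos (α : ℝ) (P : stdSimplex ℝ X) (W : Channel X Y) : 0 < sibsonSum α P.1 W := by
  have h : (0 : ℝ) < ∑ z, joint P W z := by rw [sum_joint]; exact one_pos
  obtain ⟨⟨x, y⟩, -, hz⟩ := Finset.exists_lt_of_sum_lt
    (show ∑ z : X × Y, (0 : ℝ) < ∑ z, joint P W z by simpa using h)
  have hx : 0 < P.1 x := lt_of_le_of_ne (P.2.1 x) fun h => by simp [joint, ← h] at hz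
  have hy : 0 < transProb W x y := lt_of_le_of_ne (transProb_nonneg W x y)
    fun h => by simp [joint, ← h] at hz
  refine Finset.sum_pos' (fun y _ => Real.rpow_nonneg (sibson_inner_nonneg α P W y) _)
    ⟨y, Finset.mem_univ y, Real.rpow_pos_of_pos ?_ _⟩
  exact Finset.sum_pos' (fun x _ => mul_nonneg (P.2.1 x)
    (Real.rpow_nonneg (transProb_nonneg W x y) _))
    ⟨x, Finset.mem_univ x, mul_pos hx (Real.rpow_pos_of_pos hy _)⟩

lemma fidelity_joint_indep_le {α : ℝ} (h0 : 0 < α) (h1 : α ≠ 1) (P : stdSimplex ℝ X)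
    (W : Channel X Y) (Q : stdSimplex ℝ Y) :
    fidelity (ENNReal.ofReal α) (joint P W) (indep P.1 Q.1) ≤
      ENNReal.ofReal (sibsonSum α P.1 W ^ (α / (1 - α))) := by
  rw [fidelity_joint_indep h0 h1]
  refine (sum_mul_rpow_rpow_le h0 h1 _ _ (sum_ofReal_eq_one Q.2.1 Q.2.2).le).trans_eq ?_
  rw [← ENNReal.ofReal_rpow_of_pos (sibsonSum_pos α P W), sibsonSum,
    ENNReal.ofReal_sum_of_nonneg fun y _ => Real.rpow_nonneg (sibson_inner_nonneg α P W y) _]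
  congr 1
  refine Finset.sum_congr rfl fun y _ => ?_
  rw [ENNReal.ofReal_rpow_of_nonneg (sibson_inner_nonneg α P W y) (by positivity)]

/-- The equality case of Hölder: `Q` proportional to the `1/α`-th power of the inner sum. -/
lemma exists_fidelity_joint_indep_eq {α : ℝ} (h0 : 0 < α) (h1 : α ≠ 1) (P : stdSimplex ℝ X)
    (W : Channel X Y) : ∃ Q : stdSimplex ℝ Y,
    fidelity (ENNReal.ofReal α) (joint P W) (indep P.1 Q.1) =
      ENNReal.ofReal (sibsonSum α P.1 W ^ (α / (1 - α))) := by
  have hS := sibsonSum_pos α P W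
  set a : Y → ℝ := fun y => ∑ x, P.1 x * transProb W x y ^ α with ha
  have ha0 : ∀ y, 0 ≤ a y := sibson_inner_nonneg α P W
  refine ⟨⟨fun y => a y ^ (1 / α) / sibsonSum α P.1 W,
    fun y => div_nonneg (Real.rpow_nonneg (ha0 y) _) hS.le, ?_⟩, ?_⟩
  · rw [← Finset.sum_div]
    exact div_self hS.ne'
  rw [fidelity_joint_indep h0 h1]
  have key : ∀ y, ENNReal.ofReal (a y) * ENNReal.ofReal (a y ^ (1 / α) / sibsonSum α P.1 W) ^ (1 - α)
      = ENNReal.ofReal (a y ^ (1 / α) * sibsonSum α P.1 W ^ (α - 1)) := by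
    intro y
    rcases (ha0 y).eq_or_lt with h | h
    · simp [← h, h0.ne']
    · rw [ENNReal.ofReal_rpow_of_pos (div_pos (Real.rpow_pos_of_pos h _) hS),
        ← ENNReal.ofReal_mul (ha0 y)]
      congr 1
      rw [Real.div_rpow (Real.rpow_nonneg (ha0 y) _) hS.le, ← Real.rpow_mul (ha0 y),
        div_eq_mul_inv, ← Real.rpow_neg hS.le, ← mul_assoc]
      nth_rewrite 1 [← Real.rpow_one (a y)]
      rw [← Real.rpow_add h]
      congr 2
      · field_simp
        ring
      · ring
  rw [Finset.sum_congr rfl fun y _ => key y, ← ENNReal.ofReal_sum_of_nonneg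
    (fun y _ => mul_nonneg (Real.rpow_nonneg (ha0 y) _) (Real.rpow_nonneg hS.le _)),
    ← Finset.sum_mul]
  have e : (∑ y, a y ^ (1 / α)) = sibsonSum α P.1 W := rfl
  rw [e]
  nth_rewrite 1 [← Real.rpow_one (sibsonSum α P.1 W)]
  rw [← Real.rpow_add hS, add_sub_cancel, ENNReal.ofReal_rpow_of_pos (Real.rpow_pos_of_pos hS _),
    ← Real.rpow_mul hS.le, mul_one_div]

lemma sibsonSum_prod {α : ℝ} (P : stdSimplex ℝ X) (W : Channel X Y) (n : ℕ) :
    sibsonSum α (prodDist P n).1 (prodChannel W n) = sibsonSum α P.1 W ^ n := by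
  classical
  simp only [sibsonSum]
  rw [Fintype.sum_pow]
  refine Finset.sum_congr rfl fun y _ => ?_
  rw [Real.finsetProd_rpow _ _ fun i _ => sibson_inner_nonneg α P W (y i)]
  congr 1
  rw [Fintype.prod_sum (fun i x => P.1 x * transProb W x (y i) ^ α)]
  refine Finset.sum_congr rfl fun x _ => ?_
  rw [Finset.prod_mul_distrib, Real.finsetProd_rpow _ _ fun i _ => transProb_nonneg W _ _]
  rfl

end ClosedForm

lemma fidelity_one_eq_exp {A : Type*} [Fintype A] {P Q : A → ℝ} (hP : ∀ a, 0 ≤ P a)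
    (hQ : ∀ a, 0 ≤ Q a) (hPQ : ∀ a, 0 < P a → 0 < Q a) :
    fidelity 1 P Q = ENNReal.ofReal (Real.exp (∑ a, P a * Real.log (Q a / P a))) := by
  rw [fidelity_one_eq_ofReal hP hQ, Real.exp_sum]
  congr 1
  refine Finset.prod_congr rfl fun a _ => ?_
  rcases (hP a).eq_or_lt with h | h
  · simp [← h]
  · rw [Real.rpow_def_of_pos (div_pos (hPQ a h) h), mul_comm]

lemma fidelity_one_eq_zero {A : Type*} [Fintype A] {P Q : A → ℝ} {a : A}
    (hP : 0 < P a) (hQ : Q a = 0) : fidelity 1 P Q = 0 := by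
  rw [fidelity_one]
  refine Finset.prod_eq_zero (Finset.mem_univ a) ?_
  simp [hQ, hP]

/-! ### Multiplicativity of the optimal fidelity at orders `0` and `∞`. -/

section Additivity

lemma fidelity_zero_joint_indep (P : stdSimplex ℝ X) (W : Channel X Y) (Q : stdSimplex ℝ Y) :
    fidelity 0 (joint P W) (indep P.1 Q.1) =
      ENNReal.ofReal (∑ y, (∑ x, if 0 < transProb W x y then P.1 x else 0) * Q.1 y) := by
  classical
  have hpos : ∀ x y, 0 ≤ (if 0 < transProb W x y then P.1 x else 0) := fun x y => by
    split_ifs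
    exacts [P.2.1 x, le_rfl]
  rw [fidelity_zero, Fintype.sum_prod_type, Finset.sum_comm, ENNReal.ofReal_sum_of_nonneg
    fun y _ => mul_nonneg (Finset.sum_nonneg fun x _ => hpos x y) (Q.2.1 y)]
  refine Finset.sum_congr rfl fun y _ => ?_
  rw [Finset.sum_mul, ENNReal.ofReal_sum_of_nonneg
    fun x _ => mul_nonneg (hpos x y) (Q.2.1 y)]
  refine Finset.sum_congr rfl fun x _ => ?_
  rcases (P.2.1 x).eq_or_lt with h | h
  · simp [joint, ← h]
  · by_cases hw : 0 < transProb W x y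
    · rw [if_pos (show 0 < joint P W (x, y) from mul_pos h hw), if_pos hw]
      rfl
    · rw [if_neg hw, if_neg (fun h' : 0 < joint P W (x, y) => hw (pos_of_mul_pos_right (show 0 < P.1 x * transProb W x y from h') h.le))]
      simp

lemma sum_ite_prodDist (P : stdSimplex ℝ X) (W : Channel X Y) {n : ℕ} (y : Fin n → Y) :
    (∑ x, if 0 < transProb (prodChannel W n) x y then (prodDist P n).1 x else 0) =
      ∏ i, ∑ x, if 0 < transProb W x (y i) then P.1 x else 0 := by
  classical
  rw [Fintype.prod_sum (fun i x => if 0 < transProb W x (y i) then P.1 x else 0)]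
  refine Finset.sum_congr rfl fun x _ => ?_
  rw [transProb_prodChannel]
  split_ifs with h
  · change ∏ i, P.1 (x i) = _
    refine Finset.prod_congr rfl fun i _ => (if_pos ?_).symm
    refine lt_of_le_of_ne (transProb_nonneg W _ _) fun h0 => h.ne' ?_
    exact Finset.prod_eq_zero (Finset.mem_univ i) h0.symm
  · obtain ⟨i, hi⟩ : ∃ i, ¬ 0 < transProb W (x i) (y i) := by
      by_contra! h'
      exact h (Finset.prod_pos fun i _ => h' i)
    exact (Finset.prod_eq_zero (Finset.mem_univ i) (if_neg hi)).symm

lemma nonempty_of_stdSimplex {A : Type*} [Fintype A] (P : stdSimplex ℝ A) : Nonempty A := by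
  by_contra h
  rw [not_nonempty_iff] at h
  have := P.2.2
  simp at this

/-- At order `0` the fidelity is linear in `Q`, so a point mass at the output of largest weight `b`
is optimal, and the weights of sequences are products of letter weights. -/
lemma exists_fidelity_prod_le_zero (P : stdSimplex ℝ X) (W : Channel X Y) :
    ∃ Q : stdSimplex ℝ Y, ∀ (n : ℕ) (Q' : stdSimplex ℝ (Fin n → Y)),
      fidelity 0 (joint (prodDist P n) (prodChannel W n)) (indep (prodDist P n).1 Q'.1) ≤
        fidelity 0 (joint P W) (indep P.1 Q.1) ^ n := by
  classical
  obtain ⟨x₀⟩ := nonempty_of_stdSimplex P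
  have hY : Nonempty Y := nonempty_of_stdSimplex (W x₀)
  set b : Y → ℝ := fun y => ∑ x, if 0 < transProb W x y then P.1 x else 0 with hb
  have hb0 : ∀ y, 0 ≤ b y := fun y => Finset.sum_nonneg fun x _ => by
    split_ifs
    exacts [P.2.1 x, le_rfl]
  obtain ⟨y₀, hy₀⟩ := Finite.exists_max b
  refine ⟨⟨Pi.single y₀ 1, single_mem_stdSimplex ℝ y₀⟩, fun n Q' => ?_⟩
  rw [fidelity_zero_joint_indep, fidelity_zero_joint_indep]
  simp_rw [sum_ite_prodDist]
  have e : (∑ y, b y * (Pi.single y₀ 1 : Y → ℝ) y) = b y₀ := by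
    simp [Pi.single_apply]
  rw [e, ← ENNReal.ofReal_pow (hb0 y₀)]
  apply ENNReal.ofReal_le_ofReal
  calc ∑ y, (∏ i, b (y i)) * Q'.1 y ≤ ∑ y, b y₀ ^ n * Q'.1 y := by
        refine Finset.sum_le_sum fun y _ => mul_le_mul_of_nonneg_right ?_ (Q'.2.1 y)
        calc ∏ i, b (y i) ≤ ∏ _i : Fin n, b y₀ :=
              Finset.prod_le_prod (fun i _ => hb0 _) fun i _ => hy₀ _
          _ = b y₀ ^ n := by simp
    _ = b y₀ ^ n := by rw [← Finset.mul_sum, Q'.2.2, mul_one]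

/-- A selector of inputs in the support bounds the fidelity of order `∞`. -/
lemma fidelity_top_joint_indep_le (P : stdSimplex ℝ X) (W : Channel X Y) (Q : stdSimplex ℝ Y)
    {ξ : Y → X} (hξ : ∀ y, 0 < P.1 (ξ y)) (hS : 0 < ∑ y, transProb W (ξ y) y) :
    fidelity ∞ (joint P W) (indep P.1 Q.1) ≤
      ENNReal.ofReal (1 / ∑ y, transProb W (ξ y) y) := by
  set S := ∑ y, transProb W (ξ y) y with hSdef
  -- A larger fidelity would force `Q(y) > W(y|ξ y)/S` wherever the right side is positive; summing
  -- over `y` gives `1 < 1`.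
  by_contra! hlt
  have hlt' : ∀ y, 0 < transProb W (ξ y) y → 1 / S * transProb W (ξ y) y < Q.1 y := by
    intro y hpos
    rw [fidelity_top] at hlt
    have hz : 0 < joint P W (ξ y, y) := mul_pos (hξ y) hpos
    have h2 := hlt.trans_le (iInf_le _ ⟨_, hz⟩)
    rw [← ENNReal.ofReal_div_of_pos hz, ENNReal.ofReal_lt_ofReal_iff', lt_div_iff₀ hz] at h2
    have h3 := h2.1
    simp only [joint, indep] at h3
    rw [mul_left_comm] at h3
    exact lt_of_mul_lt_mul_left h3 (hξ y).le
  have hle : ∀ y, 1 / S * transProb W (ξ y) y ≤ Q.1 y := by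
    intro y
    rcases (transProb_nonneg W (ξ y) y).eq_or_lt with h | h
    · rw [← h, mul_zero]
      exact Q.2.1 y
    · exact (hlt' y h).le
  obtain ⟨y₁, -, hy₁⟩ := Finset.exists_lt_of_sum_lt
    (show ∑ y : Y, (0 : ℝ) < ∑ y, transProb W (ξ y) y by simpa using hS)
  have := Finset.sum_lt_sum (fun y (_ : y ∈ Finset.univ) => hle y)
    ⟨y₁, Finset.mem_univ _, hlt' _ hy₁⟩
  rw [← Finset.mul_sum, ← hSdef, one_div_mul_cancel hS.ne', Q.2.2] at this
  exact lt_irrefl _ this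

/-- The optimal value is `1/S`, with `S` the sum over `y` of the largest `W(y|x)` on the support of
`P`; taking the maximizers letterwise gives `S^n` for sequences. -/
lemma exists_fidelity_prod_le_top (P : stdSimplex ℝ X) (W : Channel X Y) :
    ∃ Q : stdSimplex ℝ Y, ∀ (n : ℕ) (Q' : stdSimplex ℝ (Fin n → Y)),
      fidelity ∞ (joint (prodDist P n) (prodChannel W n)) (indep (prodDist P n).1 Q'.1) ≤
        fidelity ∞ (joint P W) (indep P.1 Q.1) ^ n := by
  classical
  have hsupp : ∃ x, 0 < P.1 x := by
    by_contra! h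
    have h1 := Finset.sum_nonpos fun x (_ : x ∈ Finset.univ) => h x
    have h2 := P.2.2
    linarith
  have hmax : ∀ y, ∃ x, 0 < P.1 x ∧ ∀ x', 0 < P.1 x' → transProb W x' y ≤ transProb W x y := by
    intro y
    obtain ⟨x, hx, hx'⟩ := Finset.exists_max_image (Finset.univ.filter fun x => 0 < P.1 x)
      (fun x => transProb W x y) (by obtain ⟨x, hx⟩ := hsupp; exact ⟨x, by simpa using hx⟩)
    exact ⟨x, by simpa using hx, fun x' h => hx' x' (by simpa using h)⟩
  choose ξ hξ hξmax using hmax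
  set m : Y → ℝ := fun y => transProb W (ξ y) y with hm
  have hm0 : ∀ y, 0 ≤ m y := fun y => transProb_nonneg _ _ _
  set S : ℝ := ∑ y, m y with hSdef
  have hS : 0 < S := by
    obtain ⟨x, hx⟩ := hsupp
    calc (0 : ℝ) < ∑ y, transProb W x y := by rw [sum_transProb]; exact one_pos
      _ ≤ S := Finset.sum_le_sum fun y _ => hξmax y x hx
  refine ⟨⟨fun y => m y / S, fun y => div_nonneg (hm0 y) hS.le, ?_⟩, fun n Q' => ?_⟩
  · rw [← Finset.sum_div, div_self hS.ne']
  have h1 : ENNReal.ofReal (1 / S) ≤ fidelity ∞ (joint P W) (indep P.1 fun y => m y / S) := by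
    rw [fidelity_top]
    refine le_iInf fun ⟨⟨x, y⟩, hz⟩ => ?_
    simp only [joint] at hz
    have hx : 0 < P.1 x := lt_of_le_of_ne (P.2.1 x) fun h => by simp [← h] at hz
    rw [← ENNReal.ofReal_div_of_pos (by exact hz)]
    apply ENNReal.ofReal_le_ofReal
    simp only [joint, indep]
    rw [le_div_iff₀ hz, div_mul_eq_mul_div, one_mul, mul_div_assoc' (P.1 x)]
    gcongr
    exact hξmax y x hx
  refine le_trans ?_ (pow_le_pow_left' h1 n)
  have hsum : ∑ y : Fin n → Y, transProb (prodChannel W n) (fun i => ξ (y i)) y = S ^ n :=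
    (Fintype.sum_pow m n).symm
  rw [← ENNReal.ofReal_pow (by positivity), one_div_pow, ← hsum]
  refine fidelity_top_joint_indep_le _ _ Q' (ξ := fun y i => ξ (y i)) (fun y => ?_) ?_
  · change (0 : ℝ) < ∏ i, P.1 (ξ (y i))
    exact Finset.prod_pos fun i _ => hξ (y i)
  · rw [hsum]
    positivity

end Additivity

end RenyiSim

namespace RenyiSim

/-! ### Domination of simulations, and additivity for the remaining orders. -/

variable {X Y : Type*} [Fintype Y]

/-- Every simulation with cost `c` is dominated by `2 ^ c` times an output distribution. -/
lemma IsSimulation.exists_le {c : ℝ} {N : Channel X Y} (h : IsSimulation c N) :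
    ∃ Q : stdSimplex ℝ Y, ∀ x y, transProb N x y ≤ 2 ^ c * Q.1 y := by
  obtain ⟨M, hM, hMc, m, PK, E, D, hN⟩ := h
  have hM' : (0 : ℝ) < M := by exact_mod_cast hM
  have hMc' : (M : ℝ) ≤ 2 ^ c := (Real.logb_le_iff_le_rpow one_lt_two hM').1 hMc
  have hq : ∀ y, 0 ≤ ∑ k, ∑ j, PK.1 k * transProb D (j, k) y := fun y =>
    Finset.sum_nonneg fun k _ => Finset.sum_nonneg fun j _ =>
      mul_nonneg (PK.2.1 k) (transProb_nonneg _ _ _)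
  -- The decoder's output for a uniformly random message; bounding the encoder by `1` loses exactly
  -- the factor `M ≤ 2^c`.
  refine ⟨⟨fun y => (∑ k, ∑ j, PK.1 k * transProb D (j, k) y) / M,
    fun y => div_nonneg (hq y) hM'.le, ?_⟩, fun x y => ?_⟩
  · rw [← Finset.sum_div, div_eq_one_iff_eq hM'.ne', Finset.sum_comm]
    have : ∀ k, ∑ y, ∑ j, PK.1 k * transProb D (j, k) y = PK.1 k * M := fun k => by
      rw [Finset.sum_comm]
      simp_rw [← Finset.mul_sum, sum_transProb]
      simp
    simp_rw [this]
    rw [← Finset.sum_mul, PK.2.2, one_mul]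
  · calc transProb N x y ≤ ∑ k, ∑ j, PK.1 k * transProb D (j, k) y := by
          rw [hN]
          gcongr with k _ j _
          · exact transProb_nonneg _ _ _
          · exact mul_le_of_le_one_right (PK.2.1 k) (transProb_le_one _ _ _)
      _ = M * ((∑ k, ∑ j, PK.1 k * transProb D (j, k) y) / M) := by field_simp
      _ ≤ _ := by
          gcongr
          exact div_nonneg (hq y) hM'.le

variable [Fintype X]

section Additivity

lemma joint_prodDist (P : stdSimplex ℝ X) (W : Channel X Y) {n : ℕ} (x : Fin n → X)
    (y : Fin n → Y) :
    joint (prodDist P n) (prodChannel W n) (x, y) = ∏ i, joint P W (x i, y i) := by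
  simp only [joint]
  rw [Finset.prod_mul_distrib]
  rfl

lemma sum_joint_prodDist_mul_sum (P : stdSimplex ℝ X) (W : Channel X Y) (f : X × Y → ℝ) (n : ℕ) :
    ∑ z, joint (prodDist P n) (prodChannel W n) z * ∑ i, f (z.1 i, z.2 i) =
      n * ∑ z, joint P W z * f z := by
  rw [← (Equiv.arrowProdEquivProdArrow (Fin n) (fun _ => X) fun _ => Y).sum_comp]
  have h := sum_prod_mul_sum (n := n) (fun _ => joint P W) (fun _ => f) fun _ => sum_joint P W
  rw [Finset.sum_const, Finset.card_univ, Fintype.card_fin, nsmul_eq_mul] at h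
  rw [← h]
  refine Finset.sum_congr rfl fun z _ => ?_
  congr 1
  exact joint_prodDist P W _ _

/-- The output distribution of a channel. -/
noncomputable def outDist (P : stdSimplex ℝ X) (W : Channel X Y) : stdSimplex ℝ Y :=
  ⟨fun y => ∑ x, joint P W (x, y), fun _ => Finset.sum_nonneg fun _ _ => joint_nonneg _ _ _, by
    rw [Finset.sum_comm]
    simp_rw [sum_joint_right]
    exact P.2.2⟩

lemma outDist_prodDist (P : stdSimplex ℝ X) (W : Channel X Y) {n : ℕ} (y : Fin n → Y) :
    (outDist (prodDist P n) (prodChannel W n)).1 y = ∏ i, (outDist P W).1 (y i) := by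
  classical
  simp only [outDist]
  rw [Fintype.prod_sum (fun i x => joint P W (x, y i))]
  exact Finset.sum_congr rfl fun x _ => joint_prodDist P W x y

lemma joint_pos_iff (P : stdSimplex ℝ X) (W : Channel X Y) (x : X) (y : Y) :
    0 < joint P W (x, y) ↔ 0 < P.1 x ∧ 0 < transProb W x y := by
  constructor
  · intro h
    have h' : 0 < P.1 x * transProb W x y := h
    exact ⟨pos_of_mul_pos_left h' (transProb_nonneg W x y), pos_of_mul_pos_right h' (P.2.1 x)⟩
  · exact fun h => mul_pos h.1 h.2

lemma outDist_pos {P : stdSimplex ℝ X} {W : Channel X Y} {x : X} {y : Y}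
    (h : 0 < joint P W (x, y)) : 0 < (outDist P W).1 y :=
  h.trans_le (Finset.single_le_sum (f := fun x => joint P W (x, y))
    (fun _ _ => joint_nonneg _ _ _) (Finset.mem_univ x))

/-- At order `1` the optimal `Q` is the output distribution `q`, because `D(PW‖P × Q') - D(PW‖P × q)
= D(q‖Q') ≥ 0`, and `q` of a product is the product of the `q`'s. -/
lemma exists_fidelity_prod_le_one (P : stdSimplex ℝ X) (W : Channel X Y) :
    ∃ Q : stdSimplex ℝ Y, ∀ (n : ℕ) (Q' : stdSimplex ℝ (Fin n → Y)),
      fidelity 1 (joint (prodDist P n) (prodChannel W n)) (indep (prodDist P n).1 Q'.1) ≤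
        fidelity 1 (joint P W) (indep P.1 Q.1) ^ n := by
  refine ⟨outDist P W, fun n Q' => ?_⟩
  set p := joint P W with hp
  set pn := joint (prodDist P n) (prodChannel W n) with hpn
  set q := (outDist P W).1 with hq
  set qn := (outDist (prodDist P n) (prodChannel W n)).1 with hqn
  by_cases hz : ∃ z, 0 < pn z ∧ Q'.1 z.2 = 0
  · obtain ⟨z, hz, hz'⟩ := hz
    rw [fidelity_one_eq_zero hz (by simp [indep, hz'])]
    exact zero_le
  push Not at hz
  have hsupp : ∀ z, 0 < pn z → 0 < indep (prodDist P n).1 Q'.1 z := fun z h =>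
    mul_pos ((joint_pos_iff _ _ _ _).1 h).1 (lt_of_le_of_ne (Q'.2.1 _) (hz z h).symm)
  have hsupp1 : ∀ z, 0 < p z → 0 < indep P.1 q z := fun z h =>
    mul_pos ((joint_pos_iff _ _ _ _).1 h).1 (outDist_pos h)
  rw [fidelity_one_eq_exp (joint_nonneg _ _) (indep_nonneg (prodDist P n).2.1 Q'.2.1) hsupp,
    fidelity_one_eq_exp (joint_nonneg _ _) (indep_nonneg P.2.1 (outDist P W).2.1) hsupp1,
    ← ENNReal.ofReal_pow (Real.exp_nonneg _), ← Real.exp_nat_mul,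
    ← sum_joint_prodDist_mul_sum P W (fun z => Real.log (indep P.1 q z / p z)) n]
  apply ENNReal.ofReal_le_ofReal
  rw [Real.exp_le_exp, ← sub_nonpos, ← Finset.sum_sub_distrib]
  -- The left side is `pn` times `log (Q'/qn)`; `log t ≤ t - 1` then leaves terms whose sum is at
  -- most `0`.
  have hterm : ∀ z, pn z * Real.log (indep (prodDist P n).1 Q'.1 z / pn z) -
      pn z * ∑ i, Real.log (indep P.1 q (z.1 i, z.2 i) / p (z.1 i, z.2 i)) ≤
      pn z * (Q'.1 z.2 / qn z.2) - pn z := by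
    rintro ⟨x, y⟩
    rcases (joint_nonneg (prodDist P n) (prodChannel W n) (x, y)).eq_or_lt with h | h
    · rw [← hpn] at h
      simp [← h]
    have hi : ∀ i, 0 < p (x i, y i) := by
      intro i
      refine lt_of_le_of_ne (joint_nonneg _ _ _) fun h0 => h.ne' ?_
      rw [joint_prodDist]
      exact Finset.prod_eq_zero (Finset.mem_univ i) h0.symm
    have hQ' : 0 < Q'.1 y := lt_of_le_of_ne (Q'.2.1 _) (hz (x, y) h).symm
    have hqpos : 0 < qn y := outDist_pos h
    have e1 : ∑ i, Real.log (indep P.1 q (x i, y i) / p (x i, y i)) =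
        Real.log ((prodDist P n).1 x * qn y / pn (x, y)) := by
      rw [← Real.log_prod fun i _ => (div_pos (hsupp1 _ (hi i)) (hi i)).ne', Finset.prod_div_distrib,
        hpn, joint_prodDist]
      simp only [indep]
      rw [Finset.prod_mul_distrib, hqn, outDist_prodDist]
      rfl
    have hPx := ((joint_pos_iff _ _ _ _).1 h).1
    rw [e1, ← mul_sub, ← Real.log_div (div_pos (hsupp _ h) h).ne'
      (div_pos (mul_pos hPx hqpos) h).ne']
    have e2 : indep (prodDist P n).1 Q'.1 (x, y) / pn (x, y) /
        ((prodDist P n).1 x * qn y / pn (x, y)) = Q'.1 y / qn y := by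
      have h1 : pn (x, y) ≠ 0 := h.ne'
      simp only [indep]
      field_simp
    rw [e2]
    have := Real.log_le_sub_one_of_pos (div_pos hQ' hqpos)
    calc pn (x, y) * Real.log (Q'.1 y / qn y) ≤ pn (x, y) * (Q'.1 y / qn y - 1) := by
          gcongr
      _ = _ := by ring
  calc _ ≤ ∑ z, (pn z * (Q'.1 z.2 / qn z.2) - pn z) := Finset.sum_le_sum fun z _ => hterm z
    _ = (∑ z, pn z * (Q'.1 z.2 / qn z.2)) - 1 := by
        rw [Finset.sum_sub_distrib, hpn, sum_joint]
    _ ≤ 0 := by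
        rw [sub_nonpos, ← Q'.2.2, Fintype.sum_prod_type, Finset.sum_comm]
        refine Finset.sum_le_sum fun y _ => ?_
        change ∑ x, pn (x, y) * (Q'.1 y / qn y) ≤ _
        rw [← Finset.sum_mul]
        change qn y * (Q'.1 y / qn y) ≤ _
        by_cases h0 : qn y = 0
        · simp [h0, Q'.2.1 y]
        · rw [mul_div_cancel₀ _ h0]

/-- For every order some output distribution bounds the fidelities of all product inputs. -/
lemma exists_fidelity_prod_le (α : ℝ≥0∞) (P : stdSimplex ℝ X) (W : Channel X Y) :
    ∃ Q : stdSimplex ℝ Y, ∀ (n : ℕ) (Q' : stdSimplex ℝ (Fin n → Y)),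
      fidelity α (joint (prodDist P n) (prodChannel W n)) (indep (prodDist P n).1 Q'.1) ≤
        fidelity α (joint P W) (indep P.1 Q.1) ^ n := by
  rcases order_cases α with rfl | rfl | rfl | ⟨a, ha0, ha1, rfl⟩
  · exact exists_fidelity_prod_le_zero P W
  · exact exists_fidelity_prod_le_one P W
  · exact exists_fidelity_prod_le_top P W
  · obtain ⟨Q, hQ⟩ := exists_fidelity_joint_indep_eq ha0 ha1 P W
    refine ⟨Q, fun n Q' => (fidelity_joint_indep_le ha0 ha1 _ _ Q').trans_eq ?_⟩
    rw [hQ, sibsonSum_prod, ← ENNReal.ofReal_pow (Real.rpow_nonneg (sibsonSum_pos a P W).le _),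
      ← Real.rpow_natCast, ← Real.rpow_natCast, ← Real.rpow_mul (sibsonSum_pos a P W).le,
      ← Real.rpow_mul (sibsonSum_pos a P W).le, mul_comm]

/-- Super-additivity of the Rényi capacity in one-sided form. -/
lemma exists_input_fidelity_le {α : ℝ≥0∞} {W : Channel X Y} {t : ℝ}
    (ht : (t : EReal) < renyiCapacity α W) :
    ∃ P : stdSimplex ℝ X, ∀ (n : ℕ) (Q : stdSimplex ℝ (Fin n → Y)),
      fidelity α (joint (prodDist P n) (prodChannel W n)) (indep (prodDist P n).1 Q.1) ≤
        ENNReal.ofReal (2 ^ (-(n * t))) := by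
  obtain ⟨P, hP⟩ := lt_iSup_iff.1 ht
  obtain ⟨Q, hQ⟩ := exists_fidelity_prod_le α P W
  refine ⟨P, fun n Q' => (hQ n Q').trans ?_⟩
  rw [renyiMutualInfo_joint] at hP
  have h := (le_renyiDiv_iff α _ _ t).1 (hP.le.trans (iInf_le _ Q))
  refine (pow_le_pow_left' h n).trans_eq ?_
  rw [← ENNReal.ofReal_pow (by positivity), ← Real.rpow_natCast, ← Real.rpow_mul two_pos.le]
  congr 2
  ring

end Additivity

/-! ### The converse bounds. -/

section Converse

lemma optDiv_nonneg [Nonempty X] (α : ℝ≥0∞) (W : Channel X Y) (c : ℝ) : 0 ≤ optDiv α W c := by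
  classical
  refine le_iInf₂ fun N _ => ?_
  let P : stdSimplex ℝ X := ⟨Pi.single (Classical.arbitrary X) 1, single_mem_stdSimplex ℝ _⟩
  refine le_iSup_of_le P ?_
  have h := (le_renyiDiv_iff α (joint P W) (joint P N) 0).2 (by
    simpa using fidelity_le_one α (joint_nonneg P W) (sum_joint P W) (joint_nonneg P N)
      (sum_joint P N))
  simpa using h

/-- A fidelity bound for all product outputs is a lower bound on the optimal divergence. -/
lemma le_optDiv_of_fidelity_le {α : ℝ≥0∞} {W : Channel X Y} {P : stdSimplex ℝ X} {t : ℝ}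
    (h : ∀ Q : stdSimplex ℝ Y, fidelity α (joint P W) (indep P.1 Q.1) ≤ ENNReal.ofReal (2 ^ (-t)))
    (c : ℝ) : ((t - c : ℝ) : EReal) ≤ optDiv α W c := by
  refine le_iInf₂ fun N hN => le_iSup_of_le P ?_
  obtain ⟨Q, hQ⟩ := hN.exists_le
  rw [le_renyiDiv_iff]
  calc fidelity α (joint P W) (joint P N)
      ≤ fidelity α (joint P W) (fun z => 2 ^ c * indep P.1 Q.1 z) := by
        refine fidelity_mono α (joint_nonneg P W) fun z => ?_
        simp only [joint, indep]
        rw [mul_left_comm]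
        exact mul_le_mul_of_nonneg_left (hQ _ _) (P.2.1 _)
    _ = ENNReal.ofReal (2 ^ c) * fidelity α (joint P W) (indep P.1 Q.1) :=
        fidelity_const_mul α (joint_nonneg P W) (sum_joint P W) (by positivity)
    _ ≤ ENNReal.ofReal (2 ^ c) * ENNReal.ofReal (2 ^ (-t)) := by gcongr; exact h Q
    _ = ENNReal.ofReal (2 ^ (-(t - c))) := by
        rw [← ENNReal.ofReal_mul (by positivity), ← Real.rpow_add two_pos]
        congr 2
        ring

/-- Here `fidelity_le_rpow_fidelity` replaces plain monotonicity; the change of order from `α` to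
`β` is the source of the prefactor in the theorem. -/
lemma mul_le_optDiv_of_fidelity_le {α β : ℝ} (h0 : 0 < α) (hαβ : α ≤ β) (hβ : β < 1)
    {W : Channel X Y} {P : stdSimplex ℝ X} {t : ℝ}
    (h : ∀ Q : stdSimplex ℝ Y, fidelity (ENNReal.ofReal β) (joint P W) (indep P.1 Q.1) ≤
      ENNReal.ofReal (2 ^ (-t))) (c : ℝ) :
    ((α * (1 - β) / (β * (1 - α)) * (t - c) : ℝ) : EReal) ≤ optDiv (ENNReal.ofReal α) W c := by
  refine le_iInf₂ fun N hN => le_iSup_of_le P ?_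
  obtain ⟨Q, hQ⟩ := hN.exists_le
  have hs : 0 ≤ α * (1 - β) / (β * (1 - α)) :=
    div_nonneg (mul_nonneg h0.le (by linarith)) (mul_nonneg (by linarith) (by linarith))
  rw [le_renyiDiv_iff]
  calc fidelity (ENNReal.ofReal α) (joint P W) (joint P N)
      ≤ fidelity (ENNReal.ofReal β) (joint P W) (fun z => 2 ^ c * indep P.1 Q.1 z) ^
          (α * (1 - β) / (β * (1 - α))) := by
        refine fidelity_le_rpow_fidelity h0 hαβ hβ (joint_nonneg P N) (sum_joint P N) fun z => ?_
        simp only [joint, indep]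
        rw [mul_left_comm]
        exact mul_le_mul_of_nonneg_left (hQ _ _) (P.2.1 _)
    _ = (ENNReal.ofReal (2 ^ c) * fidelity (ENNReal.ofReal β) (joint P W) (indep P.1 Q.1)) ^
          (α * (1 - β) / (β * (1 - α))) := by
        rw [fidelity_const_mul _ (joint_nonneg P W) (sum_joint P W) (by positivity)]
    _ ≤ (ENNReal.ofReal (2 ^ c) * ENNReal.ofReal (2 ^ (-t))) ^
          (α * (1 - β) / (β * (1 - α))) := by gcongr; exact h Q
    _ = ENNReal.ofReal (2 ^ (-(α * (1 - β) / (β * (1 - α)) * (t - c)))) := by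
        rw [← ENNReal.ofReal_mul (by positivity), ← Real.rpow_add two_pos,
          ENNReal.ofReal_rpow_of_pos (by positivity), ← Real.rpow_mul two_pos.le]
        congr 2
        ring

/-- Passage from blocks to rates. The slope `s` is `1` at the order itself, the Hölder prefactor
below order `1`, and `0` for nonnegativity. -/
lemma le_strongConverseExponent {α : ℝ≥0∞} {W : Channel X Y} {r s t : ℝ} (hs : 0 ≤ s)
    (h : ∀ (n : ℕ) (c : ℝ), ((s * (n * t - c) : ℝ) : EReal) ≤ optDiv α (prodChannel W n) c) :
    ((s * (t - r) : ℝ) : EReal) ≤ strongConverseExponent α W r := by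
  refine le_sInf ?_
  rintro e ⟨c, hc0, hc, rfl⟩
  refine le_of_forall_lt fun z hz => ?_
  obtain ⟨u, hzu, hu⟩ := EReal.lt_iff_exists_real_btwn.1 hz
  have hu' : u < s * (t - r) := by exact_mod_cast hu
  obtain ⟨ε, hε, hεu⟩ : ∃ ε > 0, u ≤ s * (t - r - ε) := by
    -- Dividing by `s + 1` rather than `s` covers `s = 0`.
    refine ⟨(s * (t - r) - u) / (s + 1), by apply div_pos <;> linarith, ?_⟩
    have : s * ((s * (t - r) - u) / (s + 1)) ≤ s * (t - r) - u := by
      rw [mul_div_assoc', div_le_iff₀ (by linarith)]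
      nlinarith
    linarith
  refine hzu.trans_le (Filter.le_limsup_of_frequently_le (Filter.Eventually.frequently ?_))
  have h1 : ∀ᶠ n : ℕ in Filter.atTop, ((c n / n : ℝ) : EReal) < ((r + ε : ℝ) : EReal) :=
    Filter.eventually_lt_of_limsup_lt (hc.trans_lt (by exact_mod_cast (by linarith)))
  filter_upwards [h1, Filter.eventually_gt_atTop 0] with n hn hn0
  have hn0' : (0 : ℝ) < n := by exact_mod_cast hn0
  have hn' : c n / n < r + ε := by exact_mod_cast hn
  rw [EReal.le_div_iff_mul_le (by exact_mod_cast hn0) (EReal.natCast_ne_top n)]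
  refine le_trans ?_ (h n (c n))
  have : ((u : EReal) * (n : EReal)) = ((u * n : ℝ) : EReal) := by push_cast; rfl
  rw [this, EReal.coe_le_coe_iff]
  calc u * n ≤ s * (t - r - ε) * n := by gcongr
    _ ≤ s * (t - c n / n) * n :=
        mul_le_mul_of_nonneg_right (mul_le_mul_of_nonneg_left (by linarith) hs) hn0'.le
    _ = s * (n * t - c n) := by field_simp

/-- The converse bound at the order itself. -/
lemma renyiCapacity_sub_le {α : ℝ≥0∞} {W : Channel X Y} {r t : ℝ}
    (ht : (t : EReal) < renyiCapacity α W) :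
    ((t - r : ℝ) : EReal) ≤ strongConverseExponent α W r := by
  obtain ⟨P, hP⟩ := exists_input_fidelity_le ht
  have h := le_strongConverseExponent (α := α) (W := W) (r := r) (t := t) zero_le_one fun n c => by
    rw [one_mul]
    exact le_optDiv_of_fidelity_le (hP n) c
  simpa using h

lemma mul_renyiCapacity_sub_le {α β : ℝ} (h0 : 0 < α) (hαβ : α ≤ β) (hβ : β < 1)
    {W : Channel X Y} {r t : ℝ} (ht : (t : EReal) < renyiCapacity (ENNReal.ofReal β) W) :
    ((α * (1 - β) / (β * (1 - α)) * (t - r) : ℝ) : EReal) ≤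
      strongConverseExponent (ENNReal.ofReal α) W r := by
  obtain ⟨P, hP⟩ := exists_input_fidelity_le ht
  exact le_strongConverseExponent
    (div_nonneg (mul_nonneg h0.le (by linarith)) (mul_nonneg (by linarith) (by linarith)))
    fun n c => mul_le_optDiv_of_fidelity_le h0 hαβ hβ (hP n) c

lemma strongConverseExponent_nonneg [Nonempty X] (α : ℝ≥0∞) (W : Channel X Y) (r : ℝ) :
    0 ≤ strongConverseExponent α W r := by
  have h := le_strongConverseExponent (α := α) (W := W) (r := r) (t := 0) le_rfl fun n c => by
    simpa using optDiv_nonneg α (prodChannel W n) c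
  simpa using h

end Converse

end RenyiSim

namespace RenyiSim

/-! ### Rejection sampling from shared randomness. -/

section Rounding

variable {X Y : Type*}

/-- Acceptance at index `j` when sampling sequentially with acceptance probabilities `a`. -/
def acceptFirst {M : ℕ} (a : Y → ℝ) (k : Fin M → Y) (j : Fin M) : ℝ :=
  a (k j) * ∏ i with i < j, (1 - a (k i))

lemma acceptFirst_nonneg {M : ℕ} {a : Y → ℝ} (h0 : ∀ y, 0 ≤ a y) (h1 : ∀ y, a y ≤ 1)
    (k : Fin M → Y) (j : Fin M) : 0 ≤ acceptFirst a k j :=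
  mul_nonneg (h0 _) (Finset.prod_nonneg fun i _ => by linarith [h1 (k i)])

lemma sum_acceptFirst {M : ℕ} (a : Y → ℝ) (k : Fin M → Y) :
    ∑ j, acceptFirst a k j = 1 - ∏ i, (1 - a (k i)) := by
  rw [Finset.prod_one_sub_ordered]
  simp [acceptFirst]

variable [Fintype Y]

/-- Bernoulli's inequality: the terms are at least `1 - j/M`, which average above one half. This is
one of the two factors `2` lost in rejection sampling; the other comes from rounding `2^c` down. -/
lemma sum_one_sub_pow_ge {μ : ℝ} {M : ℕ} (hM : 0 < M) (h1 : μ ≤ 1 / M) :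
    (M : ℝ) / 2 ≤ ∑ j : Fin M, (1 - μ) ^ (j : ℕ) := by
  have hM' : (0 : ℝ) < M := by exact_mod_cast hM
  have hM1 : (1 : ℝ) / M ≤ 1 := by
    rw [div_le_one hM']
    exact_mod_cast hM
  calc (M : ℝ) / 2 ≤ ∑ j ∈ Finset.range M, (1 + (j : ℝ) * (-(1 / M))) := by
        rw [Finset.sum_add_distrib, ← Finset.sum_mul]
        simp only [Finset.sum_const, Finset.card_range, nsmul_eq_mul, mul_one]
        have h2 : ((∑ j ∈ Finset.range M, j : ℕ) : ℝ) * 2 = M * (M - 1) := by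
          have h3 := Finset.sum_range_id_mul_two M
          have h4 : ((M - 1 : ℕ) : ℝ) = M - 1 := by
            rw [Nat.cast_sub hM, Nat.cast_one]
          rw [← h4]
          exact_mod_cast h3
        push_cast at h2
        have h5 : (∑ j ∈ Finset.range M, (j : ℝ)) * (-(1 / M)) = -(M - 1) / 2 := by
          have h6 : ∑ j ∈ Finset.range M, (j : ℝ) = M * (M - 1) / 2 := by linarith
          rw [h6]
          field_simp
        rw [h5]
        linarith
    _ ≤ ∑ j ∈ Finset.range M, (1 - μ) ^ j := by
        refine Finset.sum_le_sum fun j _ => ?_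
        calc 1 + (j : ℝ) * (-(1 / M)) ≤ (1 + -(1 / M)) ^ j :=
              one_add_mul_le_pow (by linarith) j
          _ ≤ (1 - μ) ^ j := by
              apply pow_le_pow_left₀ <;> linarith
    _ = ∑ j : Fin M, (1 - μ) ^ (j : ℕ) := (Fin.sum_univ_eq_sum_range (fun j => (1 - μ) ^ j) M).symm

/-- Independence: each sample before `j` contributes its rejection probability, sample `j`
contributes `Q y * a y`, and the later ones sum to one. -/
lemma sum_prod_mul_acceptFirst [DecidableEq Y] {M : ℕ} (Q : stdSimplex ℝ Y) (a : Y → ℝ)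
    (j : Fin M) (y : Y) :
    ∑ k : Fin M → Y, (∏ i, Q.1 (k i)) * (acceptFirst a k j * if k j = y then 1 else 0) =
      Q.1 y * a y * (1 - ∑ y, Q.1 y * a y) ^ (j : ℕ) := by
  have h : ∀ k : Fin M → Y,
      (∏ i, Q.1 (k i)) * (acceptFirst a k j * if k j = y then 1 else 0) =
      ∏ i, (Q.1 (k i) * ((if i < j then 1 - a (k i) else 1) *
        (if i = j then a (k i) * (if k i = y then 1 else 0) else 1))) := fun k => by
    rw [Finset.prod_mul_distrib, Finset.prod_mul_distrib, Finset.prod_ite_eq' Finset.univ j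
      (fun i => a (k i) * (if k i = y then 1 else 0)), acceptFirst, Finset.prod_ite]
    simp only [Finset.mem_univ, if_true, Finset.prod_const_one, mul_one]
    ring
  simp_rw [h]
  rw [← Fintype.prod_sum (fun (i : Fin M) z => Q.1 z * ((if i < j then 1 - a z else 1) *
        (if i = j then a z * (if z = y then 1 else 0) else 1)))]
  have h2 : ∀ i : Fin M, ∑ z, Q.1 z * ((if i < j then 1 - a z else 1) *
        (if i = j then a z * (if z = y then 1 else 0) else 1)) =
      (if i < j then 1 - ∑ y, Q.1 y * a y else 1) * (if i = j then Q.1 y * a y else 1) := by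
    intro i
    by_cases hij : i = j
    · subst hij
      simp
    · by_cases hlt : i < j
      · simp only [hlt, hij, if_true, if_false, mul_one]
        simp_rw [mul_sub, mul_one]
        rw [Finset.sum_sub_distrib, Q.2.2]
      · simp [hlt, hij, Q.2.2]
  simp_rw [h2]
  rw [Finset.prod_mul_distrib, Finset.prod_ite_eq' Finset.univ j, Finset.prod_ite]
  simp only [Finset.mem_univ, if_true, Finset.prod_const_one, mul_one, Finset.prod_const]
  rw [mul_comm]
  congr 2
  have : (Finset.univ.filter fun i => i < j) = Finset.Iio j := by ext; simp
  rw [this, Fin.card_Iio]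

/-- Rejection sampling: a family of subdistributions below `2 ^ c * Q` is achieved by a simulation
of cost `c`, up to a factor `4`. -/
lemma exists_isSimulation_ge {c : ℝ} (hc : 0 ≤ c) (Q : stdSimplex ℝ Y) (ν : X → Y → ℝ)
    (h0 : ∀ x y, 0 ≤ ν x y) (hQ : ∀ x y, ν x y ≤ 2 ^ c * Q.1 y) (h1 : ∀ x, ∑ y, ν x y ≤ 1) :
    ∃ N : Channel X Y, IsSimulation c N ∧ ∀ x y, ν x y / 4 ≤ transProb N x y := by
  classical
  have h2c : (0 : ℝ) < 2 ^ c := by positivity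
  have h2c1 : (1 : ℝ) ≤ 2 ^ c := Real.one_le_rpow one_le_two hc
  set M : ℕ := ⌊(2 : ℝ) ^ c⌋₊ with hM
  have hMpos : 0 < M := Nat.floor_pos.2 h2c1
  have hM' : (0 : ℝ) < M := by exact_mod_cast hMpos
  have hM1 : (1 : ℝ) ≤ M := by exact_mod_cast hMpos
  have hMle : (M : ℝ) ≤ 2 ^ c := Nat.floor_le h2c.le
  have hMge : (2 : ℝ) ^ c ≤ 2 * M := by
    have := Nat.lt_floor_add_one ((2 : ℝ) ^ c)
    rw [← hM] at this
    linarith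
  -- The acceptance probability. Where `Q` vanishes so does `ν`, and division by zero gives the
  -- right value `0`.
  set a : X → Y → ℝ := fun x y => ν x y / (2 ^ c * Q.1 y) with ha
  have ha0 : ∀ x y, 0 ≤ a x y := fun x y =>
    div_nonneg (h0 x y) (mul_nonneg h2c.le (Q.2.1 y))
  have ha1 : ∀ x y, a x y ≤ 1 := fun x y =>
    div_le_one_of_le₀ (hQ x y) (mul_nonneg h2c.le (Q.2.1 y))
  have hQa : ∀ x y, Q.1 y * a x y = ν x y / 2 ^ c := by
    intro x y
    rcases (Q.2.1 y).eq_or_lt with h | h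
    · have : ν x y = 0 := le_antisymm (by simpa [← h] using hQ x y) (h0 x y)
      simp [← h, this]
    · rw [ha]
      field_simp
  let e := Fintype.equivFin (Fin M → Y)
  -- The encoder sends this index when all samples are rejected; that event only adds mass and is
  -- discarded in the lower bound.
  let j₀ : Fin M := ⟨0, hMpos⟩
  let PK : stdSimplex ℝ (Fin (Fintype.card (Fin M → Y))) :=
    ⟨fun k => ∏ i, Q.1 (e.symm k i), fun k => Finset.prod_nonneg fun i _ => Q.2.1 _, by
      rw [e.symm.sum_comp (fun k => ∏ i, Q.1 (k i))]
      exact sum_prod_eq_one (fun _ => Q.1) fun _ => Q.2.2⟩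
  let E : Channel (X × Fin (Fintype.card (Fin M → Y))) (Fin M) := fun z =>
    ⟨fun j => acceptFirst (a z.1) (e.symm z.2) j +
        if j = j₀ then ∏ i, (1 - a z.1 (e.symm z.2 i)) else 0, fun j => by
      refine add_nonneg (acceptFirst_nonneg (ha0 _) (ha1 _) _ _) ?_
      split_ifs
      · exact Finset.prod_nonneg fun i _ => by linarith [ha1 z.1 (e.symm z.2 i)]
      · exact le_rfl, by
      rw [Finset.sum_add_distrib, sum_acceptFirst, Finset.sum_ite_eq' Finset.univ j₀]
      simp⟩
  let D : Channel (Fin M × Fin (Fintype.card (Fin M → Y))) Y := fun z =>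
    ⟨Pi.single (e.symm z.2 z.1) 1, single_mem_stdSimplex ℝ _⟩
  have hD : ∀ j k y, transProb D (j, k) y = if e.symm k j = y then 1 else 0 := by
    intro j k y
    simp only [transProb, D, Pi.single_apply]
    exact if_congr eq_comm rfl rfl
  let N : Channel X Y := fun x =>
    ⟨fun y => ∑ k, ∑ j, PK.1 k * transProb E (x, k) j * transProb D (j, k) y, fun y =>
      Finset.sum_nonneg fun k _ => Finset.sum_nonneg fun j _ =>
        mul_nonneg (mul_nonneg (PK.2.1 k) (transProb_nonneg _ _ _)) (transProb_nonneg _ _ _), by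
      rw [Finset.sum_comm, ← PK.2.2]
      refine Finset.sum_congr rfl fun k _ => ?_
      rw [Finset.sum_comm]
      simp_rw [← Finset.mul_sum, sum_transProb, mul_one]
      rw [← Finset.mul_sum, sum_transProb, mul_one]⟩
  refine ⟨N, ⟨M, hMpos, (Real.logb_le_iff_le_rpow one_lt_two hM').2 hMle, _, PK, E, D,
    fun x y => rfl⟩, fun x y => ?_⟩
  have hμ : ∑ y, Q.1 y * a x y ≤ 1 / 2 ^ c := by
    simp_rw [hQa]
    rw [← Finset.sum_div]
    gcongr
    exact h1 x
  have hμM : ∑ y, Q.1 y * a x y ≤ 1 / M := hμ.trans (one_div_le_one_div_of_le hM' hMle)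
  calc ν x y / 4 ≤ ν x y / 2 ^ c * (M / 2) := by
        rw [div_mul_div_comm, div_le_div_iff₀ (by norm_num) (by positivity)]
        nlinarith [h0 x y]
    _ ≤ ν x y / 2 ^ c * ∑ j : Fin M, (1 - ∑ y, Q.1 y * a x y) ^ (j : ℕ) := by
        gcongr
        · exact div_nonneg (h0 x y) h2c.le
        · exact sum_one_sub_pow_ge hMpos hμM
    _ = ∑ j : Fin M, ∑ k : Fin M → Y, (∏ i, Q.1 (k i)) *
          (acceptFirst (a x) k j * if k j = y then 1 else 0) := by
        simp_rw [sum_prod_mul_acceptFirst, hQa]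
        rw [Finset.mul_sum]
    _ = ∑ k : Fin M → Y, ∑ j : Fin M, (∏ i, Q.1 (k i)) *
          (acceptFirst (a x) k j * if k j = y then 1 else 0) := Finset.sum_comm
    _ = ∑ k, ∑ j : Fin M, (∏ i, Q.1 (e.symm k i)) *
          (acceptFirst (a x) (e.symm k) j * if e.symm k j = y then 1 else 0) :=
        (e.symm.sum_comp (fun k => ∑ j : Fin M, (∏ i, Q.1 (k i)) *
          (acceptFirst (a x) k j * if k j = y then 1 else 0))).symm
    _ ≤ ∑ k, ∑ j, PK.1 k * transProb E (x, k) j * transProb D (j, k) y := by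
        refine Finset.sum_le_sum fun k _ => Finset.sum_le_sum fun j _ => ?_
        rw [hD, ← mul_assoc]
        refine mul_le_mul_of_nonneg_right (mul_le_mul_of_nonneg_left ?_ (PK.2.1 k)) ?_
        · change _ ≤ acceptFirst (a x) (e.symm k) j + _
          refine le_add_of_nonneg_right ?_
          split_ifs
          · exact Finset.prod_nonneg fun i _ => by linarith [ha1 x (e.symm k i)]
          · exact le_rfl
        · split_ifs <;> norm_num

end Rounding

/-! ### One-shot achievability and passage to rates. -/

section OneShot

variable {X Y : Type*} [Fintype Y] [Fintype X]

/-- The fidelity of joint distributions is at least the worst fidelity of the conditionals. -/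
lemma le_fidelity_joint (α : ℝ≥0∞) {κ : ℝ} (hκ : 0 < κ) (W N : Channel X Y)
    (h : ∀ x, ENNReal.ofReal κ ≤ fidelity α (transProb W x) (transProb N x))
    (P : stdSimplex ℝ X) : ENNReal.ofReal κ ≤ fidelity α (joint P W) (joint P N) := by
  have hP1 := sum_ofReal_eq_one P.2.1 P.2.2
  rcases order_cases α with rfl | rfl | rfl | ⟨a, ha0, ha1, rfl⟩
  · simp only [fidelity_zero] at h ⊢
    calc ENNReal.ofReal κ = ∑ x, ENNReal.ofReal (P.1 x) * ENNReal.ofReal κ := by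
          rw [← Finset.sum_mul, hP1, one_mul]
      _ ≤ ∑ x, ENNReal.ofReal (P.1 x) *
            ∑ y, if 0 < transProb W x y then ENNReal.ofReal (transProb N x y) else 0 := by
          gcongr with x
          exact h x
      _ = _ := by
          rw [Fintype.sum_prod_type]
          refine Finset.sum_congr rfl fun x _ => ?_
          rw [Finset.mul_sum]
          refine Finset.sum_congr rfl fun y _ => ?_
          rcases (P.2.1 x).eq_or_lt with hx | hx
          · simp [joint, ← hx]
          · simp only [joint_pos_iff, hx, true_and]
            split_ifs
            · rw [joint, ENNReal.ofReal_mul (P.2.1 x)]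
            · simp
  · simp only [fidelity_one] at h ⊢
    calc ENNReal.ofReal κ = ∏ x, ENNReal.ofReal κ ^ P.1 x := by
          rw [prod_ofReal_rpow_sum hκ, P.2.2, Real.rpow_one]
      _ ≤ ∏ x, (∏ y, (ENNReal.ofReal (transProb N x y) / ENNReal.ofReal (transProb W x y)) ^
            transProb W x y) ^ P.1 x := by
          gcongr with x
          · exact P.2.1 x
          · exact h x
      _ = _ := by
          rw [Fintype.prod_prod_type]
          refine Finset.prod_congr rfl fun x _ => ?_
          rw [← ENNReal.prod_rpow_of_nonneg (P.2.1 x)]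
          refine Finset.prod_congr rfl fun y _ => ?_
          rcases (P.2.1 x).eq_or_lt with hx | hx
          · simp [joint, ← hx]
          · simp only [joint]
            rw [← ENNReal.rpow_mul, ENNReal.ofReal_mul hx.le, ENNReal.ofReal_mul hx.le,
              ENNReal.mul_div_mul_left _ _ (by simpa using hx) ENNReal.ofReal_ne_top,
              mul_comm (transProb W x y)]
  · simp only [fidelity_top] at h ⊢
    refine le_iInf fun ⟨⟨x, y⟩, hz⟩ => ?_
    obtain ⟨hx, hy⟩ := (joint_pos_iff _ _ _ _).1 hz
    refine (h x).trans ((iInf_le _ ⟨y, hy⟩).trans_eq ?_)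
    simp only [joint]
    rw [ENNReal.ofReal_mul hx.le, ENNReal.ofReal_mul hx.le,
      ENNReal.mul_div_mul_left _ _ (by simpa using hx) ENNReal.ofReal_ne_top]
  · simp only [fidelity_ofReal ha0 ha1] at h ⊢
    set S : X → ℝ≥0∞ := fun x => ∑ y, ENNReal.ofReal (transProb W x y) ^ a *
      ENNReal.ofReal (transProb N x y) ^ (1 - a) with hS
    have e : ∑ z, ENNReal.ofReal (joint P W z) ^ a * ENNReal.ofReal (joint P N z) ^ (1 - a) =
        ∑ x, ENNReal.ofReal (P.1 x) * S x := by
      rw [Fintype.sum_prod_type]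
      refine Finset.sum_congr rfl fun x _ => ?_
      rw [hS, Finset.mul_sum]
      refine Finset.sum_congr rfl fun y _ => ?_
      simp only [joint]
      rcases (P.2.1 x).eq_or_lt with hx | hx
      · simp [← hx, ha0]
      · rw [ENNReal.ofReal_mul hx.le, ENNReal.ofReal_mul hx.le,
          ENNReal.mul_rpow_of_ne_top ENNReal.ofReal_ne_top ENNReal.ofReal_ne_top,
          ENNReal.mul_rpow_of_ne_top ENNReal.ofReal_ne_top ENNReal.ofReal_ne_top,
          mul_mul_mul_comm, ← ENNReal.rpow_add _ _ (by simpa using hx) ENNReal.ofReal_ne_top]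
        simp
    have h1a : (1 - a) ≠ 0 := sub_ne_zero.2 ha1.symm
    have hk : ENNReal.ofReal κ = (∑ x, ENNReal.ofReal (P.1 x) *
        ENNReal.ofReal κ ^ (1 - a)) ^ (1 / (1 - a)) := by
      rw [← Finset.sum_mul, hP1, one_mul, ← ENNReal.rpow_mul, mul_one_div_cancel h1a,
        ENNReal.rpow_one]
    have hinv : ∀ x, S x = (S x ^ (1 / (1 - a))) ^ (1 - a) := fun x => by
      rw [← ENNReal.rpow_mul, one_div_mul_cancel h1a, ENNReal.rpow_one]
    rw [e, hk]
    rcases lt_or_gt_of_ne ha1 with h1 | h1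
    · have h1' : 0 ≤ 1 - a := by linarith
      gcongr with x
      rw [hinv x]
      gcongr
      exact h x
    · apply rpow_antitone_of_nonpos (by rw [one_div, inv_nonpos]; linarith)
      refine Finset.sum_le_sum fun x _ => mul_le_mul_right ?_ _
      rw [hinv x]
      exact rpow_antitone_of_nonpos (by linarith) (h x)

/-- One-shot achievability. -/
lemma optDiv_le {α : ℝ≥0∞} {W : Channel X Y} {c t : ℝ} (hc : 0 ≤ c) (Q : stdSimplex ℝ Y)
    (ν : X → Y → ℝ) (h0 : ∀ x y, 0 ≤ ν x y) (hQ : ∀ x y, ν x y ≤ 2 ^ c * Q.1 y)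
    (h1 : ∀ x, ∑ y, ν x y ≤ 1)
    (h : ∀ x, ENNReal.ofReal (2 ^ (-t)) ≤ fidelity α (transProb W x) (ν x)) :
    optDiv α W c ≤ ((t + 2 : ℝ) : EReal) := by
  obtain ⟨N, hN, hνN⟩ := exists_isSimulation_ge hc Q ν h0 hQ h1
  refine (iInf₂_le N hN).trans (iSup_le fun P => ?_)
  rw [renyiDiv_le_iff]
  refine le_fidelity_joint α (by positivity) W N (fun x => ?_) P
  calc ENNReal.ofReal (2 ^ (-(t + 2))) = ENNReal.ofReal (1 / 4) * ENNReal.ofReal (2 ^ (-t)) := by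
        rw [← ENNReal.ofReal_mul (by norm_num), neg_add, Real.rpow_add two_pos]
        congr 1
        rw [mul_comm]
        norm_num
    _ ≤ ENNReal.ofReal (1 / 4) * fidelity α (transProb W x) (ν x) := by
        gcongr
        exact h x
    _ = fidelity α (transProb W x) (fun y => 1 / 4 * ν x y) :=
        (fidelity_const_mul α (transProb_nonneg W x) (sum_transProb W x) (by norm_num)).symm
    _ ≤ _ := fidelity_mono α (transProb_nonneg W x) fun y => by
        rw [one_div, inv_mul_eq_div]
        exact hνN x y

lemma strongConverseExponent_le {α : ℝ≥0∞} {W : Channel X Y} {r T : ℝ} (hr : 0 ≤ r)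
    (h : ∀ ε > 0, ∀ᶠ n : ℕ in Filter.atTop,
      optDiv α (prodChannel W n) (n * r) ≤ ((n * (T + ε) : ℝ) : EReal)) :
    strongConverseExponent α W r ≤ (T : EReal) := by
  have hmem : strongConverseExponent α W r ≤ Filter.limsup
      (fun n : ℕ => optDiv α (prodChannel W n) (n * r) / (n : EReal)) Filter.atTop := by
    refine sInf_le ⟨fun n => n * r, fun n => by positivity, ?_, rfl⟩
    refine Filter.limsup_le_of_le (h := ?_)
    filter_upwards [Filter.eventually_gt_atTop 0] with n hn
    have hn' : (n : ℝ) ≠ 0 := by exact_mod_cast hn.ne'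
    rw [mul_div_cancel_left₀ _ hn']
  refine hmem.trans (le_of_forall_gt fun z hz => ?_)
  obtain ⟨u, hu, huz⟩ := EReal.lt_iff_exists_real_btwn.1 hz
  have hu' : T < u := by exact_mod_cast hu
  refine lt_of_le_of_lt (Filter.limsup_le_of_le (h := ?_)) huz
  filter_upwards [h (u - T) (by linarith), Filter.eventually_gt_atTop 0] with n hn hn0
  rw [EReal.div_le_iff_le_mul (by exact_mod_cast hn0) (EReal.natCast_ne_top n)]
  refine hn.trans_eq ?_
  rw [add_sub_cancel]
  push_cast
  rfl

end OneShot

end RenyiSim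

namespace RenyiSim

/-! ### Minimax, and output distributions bounded away from zero. -/

section Minimax

/-- Von Neumann's minimax theorem for finitely many convex functions. -/
lemma exists_minimax {E ι : Type*} [TopologicalSpace E] [AddCommGroup E] [Module ℝ E]
    [IsTopologicalAddGroup E] [ContinuousSMul ℝ E] [Fintype ι] [Nonempty ι] {C : Set E}
    (hne : C.Nonempty) (hC : Convex ℝ C) (hcomp : IsCompact C) (g : ι → E → ℝ)
    (hg : ∀ i, ConvexOn ℝ C (g i)) (hgc : ∀ i, ContinuousOn (g i) C) :
    ∃ a ∈ C, ∃ P : stdSimplex ℝ ι, ∀ i, ∀ a' ∈ C, g i a ≤ ∑ j, P.1 j * g j a' := by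
  classical
  obtain ⟨a, ha, P, hP, h⟩ := Sion.exists_isSaddlePointOn' (X := C) (Y := stdSimplex ℝ ι)
    (f := fun a P => ∑ j, P j * g j a) hne hcomp
    (fun P hP => ContinuousOn.lowerSemicontinuousOn
      (continuousOn_finsetSum _ fun j _ => continuousOn_const.mul (hgc j)))
    (fun P hP => ConvexOn.quasiconvexOn (by
      refine ⟨hC, fun x hx y hy s t hs ht hst => ?_⟩
      simp only [smul_eq_mul]
      rw [Finset.mul_sum, Finset.mul_sum, ← Finset.sum_add_distrib]
      refine Finset.sum_le_sum fun j _ => ?_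
      have := mul_le_mul_of_nonneg_left ((hg j).2 hx hy hs ht hst) (hP.1 j)
      simp only [smul_eq_mul] at this
      linarith))
    (convex_stdSimplex ℝ ι) (isCompact_stdSimplex ℝ ι)
    (fun x hx => ContinuousOn.upperSemicontinuousOn (Continuous.continuousOn (by fun_prop)))
    (fun x hx => ConcaveOn.quasiconcaveOn (by
      refine ⟨convex_stdSimplex ℝ ι, fun P _ P' _ s t _ _ _ => le_of_eq ?_⟩
      simp only [smul_eq_mul, Pi.add_apply, Pi.smul_apply]
      rw [Finset.mul_sum, Finset.mul_sum, ← Finset.sum_add_distrib]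
      exact Finset.sum_congr rfl fun j _ => by ring))
    hC ⟨_, single_mem_stdSimplex ℝ (Classical.arbitrary ι)⟩
  refine ⟨a, ha, ⟨P, hP⟩, fun i a' ha' => ?_⟩
  -- On the left side of the saddle inequality the weights are free; the vertex `i` isolates `g i
  -- a`.
  have := h a' ha' _ (single_mem_stdSimplex ℝ i)
  simpa [Pi.single_apply] using this

variable {X Y : Type*} [Fintype Y]

/-- Output distributions bounded below by `δ / |Y|`. -/
def lowerSimplex (Y : Type*) [Fintype Y] (δ : ℝ) : Set (Y → ℝ) :=
  {Q | Q ∈ stdSimplex ℝ Y ∧ ∀ y, δ / Fintype.card Y ≤ Q y}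

lemma convex_lowerSimplex (δ : ℝ) : Convex ℝ (lowerSimplex Y δ) := by
  intro Q hQ Q' hQ' s t hs ht hst
  refine ⟨convex_stdSimplex ℝ Y hQ.1 hQ'.1 hs ht hst, fun y => ?_⟩
  simp only [Pi.add_apply, Pi.smul_apply, smul_eq_mul]
  calc δ / Fintype.card Y = s * (δ / Fintype.card Y) + t * (δ / Fintype.card Y) := by
        rw [← add_mul, hst, one_mul]
    _ ≤ _ := add_le_add (mul_le_mul_of_nonneg_left (hQ.2 y) hs)
        (mul_le_mul_of_nonneg_left (hQ'.2 y) ht)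

lemma isCompact_lowerSimplex (δ : ℝ) : IsCompact (lowerSimplex Y δ) := by
  refine (isCompact_stdSimplex ℝ Y).inter_right (t := {Q | ∀ y, δ / Fintype.card Y ≤ Q y}) ?_
  rw [show {Q : Y → ℝ | ∀ y, δ / Fintype.card Y ≤ Q y} = ⋂ y, {Q | δ / Fintype.card Y ≤ Q y} by
    ext; simp]
  exact isClosed_iInter fun y => isClosed_le continuous_const (continuous_apply y)

lemma mix_mem_lowerSimplex [Nonempty Y] {δ : ℝ} (h0 : 0 ≤ δ) (h1 : δ ≤ 1) {Q : Y → ℝ}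
    (hQ : Q ∈ stdSimplex ℝ Y) :
    (fun y => (1 - δ) * Q y + δ / Fintype.card Y) ∈ lowerSimplex Y δ := by
  have hc : (0 : ℝ) < Fintype.card Y := by exact_mod_cast Fintype.card_pos
  refine ⟨⟨fun y => add_nonneg (mul_nonneg (by linarith) (hQ.1 y)) (by positivity), ?_⟩,
    fun y => le_add_of_nonneg_left (mul_nonneg (by linarith) (hQ.1 y))⟩
  rw [Finset.sum_add_distrib, ← Finset.mul_sum, hQ.2]
  simp only [Finset.sum_const, Finset.card_univ, nsmul_eq_mul]
  field_simp
  ring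

lemma lowerSimplex_pos [Nonempty Y] {δ : ℝ} (h0 : 0 < δ) {Q : Y → ℝ} (hQ : Q ∈ lowerSimplex Y δ)
    (y : Y) : 0 < Q y := by
  have hc : (0 : ℝ) < Fintype.card Y := by exact_mod_cast Fintype.card_pos
  exact (div_pos h0 hc).trans_le (hQ.2 y)

lemma lowerSimplex_nonempty [Nonempty Y] {δ : ℝ} (h0 : 0 ≤ δ) (h1 : δ ≤ 1) :
    (lowerSimplex Y δ).Nonempty := by
  classical
  exact ⟨_, mix_mem_lowerSimplex h0 h1 (single_mem_stdSimplex ℝ (Classical.arbitrary Y))⟩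

variable [Fintype X]

/-- The common shape of all finite orders: `φ` will be `-q`, `-log q`, `-q^(1-α)` or `q^(1-α)`. The
lower bound on `Q` keeps these continuous although some blow up at `0`. -/
lemma exists_saddle_separable [Nonempty X] [Nonempty Y] {δ : ℝ} (h0 : 0 < δ) (h1 : δ ≤ 1)
    {φ : ℝ → ℝ} (hφ : ConvexOn ℝ (Set.Ioi 0) φ) (hφc : ContinuousOn φ (Set.Ioi 0))
    (w : X → Y → ℝ) (hw : ∀ x y, 0 ≤ w x y) (b : X → ℝ) :
    ∃ Q ∈ lowerSimplex Y δ, ∃ P : stdSimplex ℝ X, ∀ x, ∀ Q' ∈ lowerSimplex Y δ,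
      b x + ∑ y, w x y * φ (Q y) ≤ ∑ x, P.1 x * (b x + ∑ y, w x y * φ (Q' y)) := by
  refine exists_minimax (lowerSimplex_nonempty h0.le h1) (convex_lowerSimplex δ)
    (isCompact_lowerSimplex δ) (fun x Q => b x + ∑ y, w x y * φ (Q y)) (fun x => ?_) fun x => ?_
  · refine ⟨convex_lowerSimplex δ, fun Q hQ Q' hQ' s t hs ht hst => ?_⟩
    simp only [smul_eq_mul, Pi.add_apply, Pi.smul_apply]
    calc b x + ∑ y, w x y * φ (s * Q y + t * Q' y)
        ≤ b x + ∑ y, w x y * (s * φ (Q y) + t * φ (Q' y)) := by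
          gcongr with y
          · exact hw x y
          · exact hφ.2 (lowerSimplex_pos h0 hQ y) (lowerSimplex_pos h0 hQ' y) hs ht hst
      _ = (s + t) * b x + ∑ y, (s * (w x y * φ (Q y)) + t * (w x y * φ (Q' y))) := by
          rw [hst, one_mul]
          congr 1
          exact Finset.sum_congr rfl fun y _ => by ring
      _ = _ := by
          rw [Finset.sum_add_distrib, ← Finset.mul_sum, ← Finset.mul_sum]
          ring
  · refine continuousOn_const.add (continuousOn_finsetSum _ fun y _ => continuousOn_const.mul ?_)
    exact hφc.comp (continuous_apply y).continuousOn fun Q hQ => lowerSimplex_pos h0 hQ y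

lemma convexOn_rpow_of_nonpos {p : ℝ} (hp : p ≤ 0) :
    ConvexOn ℝ (Set.Ioi 0) fun x : ℝ => x ^ p := by
  have h : ConvexOn ℝ (Set.Ioi (0 : ℝ)) fun x => Real.exp (p * Real.log x) := by
    refine ⟨convex_Ioi 0, fun x hx y hy s t hs ht hst => ?_⟩
    refine le_trans (Real.exp_le_exp.2 ?_) (convexOn_exp.2 (Set.mem_univ _) (Set.mem_univ _) hs ht
      hst)
    have := mul_le_mul_of_nonpos_left (strictConcaveOn_log_Ioi.concaveOn.2 hx hy hs ht hst) hp
    simp only [smul_eq_mul] at this ⊢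
    linarith
  exact h.congr fun x hx => by rw [Real.rpow_def_of_pos hx, mul_comm]

end Minimax

/-! ### Outputs that almost achieve the capacity; finiteness of the capacity. -/

section Capacity

variable {X Y : Type*} [Fintype Y]

lemma fidelity_ofReal_eq {A : Type*} [Fintype A] {α : ℝ} (h0 : 0 < α) (h1 : α ≠ 1)
    {P Q : A → ℝ} (hP : ∀ a, 0 ≤ P a) (hQ0 : ∀ a, 0 ≤ Q a) (hQ : ∀ a, 0 < P a → 0 < Q a) :
    fidelity (ENNReal.ofReal α) P Q =
      ENNReal.ofReal (∑ a, P a ^ α * Q a ^ (1 - α)) ^ (1 / (1 - α)) := by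
  rw [fidelity_ofReal h0 h1, ENNReal.ofReal_sum_of_nonneg fun a _ =>
    mul_nonneg (Real.rpow_nonneg (hP a) _) (Real.rpow_nonneg (hQ0 a) _)]
  congr 1
  refine Finset.sum_congr rfl fun a _ => ?_
  rcases (hP a).eq_or_lt with h | h
  · simp [← h, h0, h0.ne']
  rw [ENNReal.ofReal_mul (Real.rpow_nonneg (hP a) _), ENNReal.ofReal_rpow_of_nonneg (hP a) h0.le,
    ENNReal.ofReal_rpow_of_pos (hQ a h)]

variable [Fintype X]

lemma fidelity_joint_indep_eq_of_pos {α : ℝ} (h0 : 0 < α) (h1 : α ≠ 1) (P : stdSimplex ℝ X)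
    (W : Channel X Y) {Q : Y → ℝ} (hQ : ∀ y, 0 < Q y) :
    fidelity (ENNReal.ofReal α) (joint P W) (indep P.1 Q) =
      ENNReal.ofReal (∑ x, P.1 x * ∑ y, transProb W x y ^ α * Q y ^ (1 - α)) ^ (1 / (1 - α)) := by
  rw [fidelity_joint_indep h0 h1]
  congr 1
  have e : ∑ x, P.1 x * ∑ y, transProb W x y ^ α * Q y ^ (1 - α) =
      ∑ y, (∑ x, P.1 x * transProb W x y ^ α) * Q y ^ (1 - α) := by
    simp_rw [Finset.mul_sum, Finset.sum_mul]
    rw [Finset.sum_comm]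
    exact Finset.sum_congr rfl fun y _ => Finset.sum_congr rfl fun x _ => by ring
  rw [e, ENNReal.ofReal_sum_of_nonneg fun y _ => mul_nonneg (sibson_inner_nonneg α P W y)
    (Real.rpow_nonneg (hQ y).le _)]
  refine Finset.sum_congr rfl fun y _ => ?_
  rw [ENNReal.ofReal_mul (sibson_inner_nonneg α P W y), ENNReal.ofReal_rpow_of_pos (hQ y)]

lemma sum_mul_log_div {A : Type*} [Fintype A] {P Q : A → ℝ} (hQ : ∀ a, 0 < Q a) :
    ∑ a, P a * Real.log (Q a / P a) =
      -(∑ a, P a * Real.log (P a) + ∑ a, P a * -Real.log (Q a)) := by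
  rw [← Finset.sum_add_distrib, ← Finset.sum_neg_distrib]
  refine Finset.sum_congr rfl fun a _ => ?_
  by_cases h : P a = 0
  · simp [h]
  · rw [Real.log_div (hQ a).ne' h]
    ring

lemma fidelity_one_joint_indep (P : stdSimplex ℝ X) (W : Channel X Y) {Q : Y → ℝ}
    (hQ : ∀ y, 0 < Q y) :
    fidelity 1 (joint P W) (indep P.1 Q) = ENNReal.ofReal (Real.exp (-∑ x, P.1 x *
      (∑ y, transProb W x y * Real.log (transProb W x y) +
        ∑ y, transProb W x y * -Real.log (Q y)))) := by
  rw [fidelity_one_eq_exp (joint_nonneg P W) (indep_nonneg P.2.1 fun y => (hQ y).le)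
    fun z hz => mul_pos ((joint_pos_iff _ _ _ _).1 hz).1 (hQ _)]
  congr 2
  rw [Fintype.sum_prod_type, ← Finset.sum_neg_distrib]
  refine Finset.sum_congr rfl fun x _ => ?_
  rw [← mul_neg, ← sum_mul_log_div hQ, Finset.mul_sum]
  refine Finset.sum_congr rfl fun y _ => ?_
  rcases (P.2.1 x).eq_or_lt with hx | hx
  · simp [joint, ← hx]
  · simp only [joint, indep]
    rw [mul_div_mul_left _ _ hx.ne', mul_assoc]

/-- A saddle point of the fidelity, with the output distribution bounded below. -/
lemma exists_fidelity_saddle [Nonempty X] [Nonempty Y] {α : ℝ≥0∞} (hα : α ≠ ∞) (W : Channel X Y)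
    {δ : ℝ} (h0 : 0 < δ) (h1 : δ ≤ 1) :
    ∃ Q ∈ lowerSimplex Y δ, ∃ P : stdSimplex ℝ X, ∀ x, ∀ Q' ∈ lowerSimplex Y δ,
      fidelity α (joint P W) (indep P.1 Q') ≤ fidelity α (transProb W x) Q := by
  rcases order_cases α with rfl | rfl | rfl | ⟨a, ha0, ha1, rfl⟩
  · obtain ⟨Q, hQ, P, h⟩ := exists_saddle_separable h0 h1 (φ := fun q => -q)
      (LinearMap.convexOn (-LinearMap.id) (convex_Ioi 0)) (by fun_prop)
      (fun (x : X) (y : Y) => if 0 < transProb W x y then 1 else 0)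
      (fun x y => by split_ifs <;> norm_num) 0
    refine ⟨Q, hQ, P, fun x Q' hQ' => ?_⟩
    have h' := h x Q' hQ'
    rw [fidelity_zero_joint_indep P W ⟨Q', hQ'.1⟩, fidelity_zero]
    have e : (∑ y, if 0 < transProb W x y then ENNReal.ofReal (Q y) else 0) =
        ENNReal.ofReal (∑ y, if 0 < transProb W x y then Q y else 0) := by
      rw [ENNReal.ofReal_sum_of_nonneg fun y _ => by
        split_ifs
        exacts [hQ.1.1 y, le_rfl]]
      refine Finset.sum_congr rfl fun y _ => ?_
      split_ifs <;> simp
    rw [e]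
    apply ENNReal.ofReal_le_ofReal
    simp only [Pi.zero_apply, zero_add, mul_neg, ite_mul, one_mul, zero_mul,
      Finset.sum_neg_distrib, neg_le_neg_iff] at h'
    refine le_trans (le_of_eq ?_) h'
    simp_rw [Finset.sum_mul, Finset.mul_sum]
    rw [Finset.sum_comm]
    refine Finset.sum_congr rfl fun x _ => Finset.sum_congr rfl fun y _ => ?_
    split_ifs <;> simp
  · obtain ⟨Q, hQ, P, h⟩ := exists_saddle_separable h0 h1 (φ := fun q => -Real.log q)
      strictConcaveOn_log_Ioi.concaveOn.neg
      (Real.continuousOn_log.mono fun x hx => ne_of_gt hx).neg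
      (transProb W) (transProb_nonneg W)
      (fun x => ∑ y, transProb W x y * Real.log (transProb W x y))
    refine ⟨Q, hQ, P, fun x Q' hQ' => ?_⟩
    rw [fidelity_one_joint_indep P W (lowerSimplex_pos h0 hQ'), fidelity_one_eq_exp
      (transProb_nonneg W x) hQ.1.1 (fun y _ => lowerSimplex_pos h0 hQ y),
      sum_mul_log_div (lowerSimplex_pos h0 hQ)]
    apply ENNReal.ofReal_le_ofReal
    rw [Real.exp_le_exp, neg_le_neg_iff]
    exact h x Q' hQ'
  · exact absurd rfl hα
  rcases lt_or_gt_of_ne ha1 with h1' | h1'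
  · obtain ⟨Q, hQ, P, h⟩ := exists_saddle_separable h0 h1 (φ := fun q => -q ^ (1 - a))
      ((Real.concaveOn_rpow (by linarith) (by linarith)).subset Set.Ioi_subset_Ici_self
        (convex_Ioi 0)).neg
      (continuousOn_id.rpow_const fun x hx => Or.inl (ne_of_gt hx)).neg
      (fun x y => transProb W x y ^ a) (fun x y => Real.rpow_nonneg (transProb_nonneg W x y) _) 0
    refine ⟨Q, hQ, P, fun x Q' hQ' => ?_⟩
    have h' := h x Q' hQ'
    rw [fidelity_joint_indep_eq_of_pos ha0 ha1 P W (lowerSimplex_pos h0 hQ'),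
      fidelity_ofReal_eq ha0 ha1 (transProb_nonneg W x) hQ.1.1
        fun y _ => lowerSimplex_pos h0 hQ y]
    have : 0 ≤ 1 - a := by linarith
    gcongr
    simpa using h'
  · obtain ⟨Q, hQ, P, h⟩ := exists_saddle_separable h0 h1 (φ := fun q => q ^ (1 - a))
      (convexOn_rpow_of_nonpos (by linarith))
      (continuousOn_id.rpow_const fun x hx => Or.inl (ne_of_gt hx))
      (fun x y => transProb W x y ^ a) (fun x y => Real.rpow_nonneg (transProb_nonneg W x y) _) 0
    refine ⟨Q, hQ, P, fun x Q' hQ' => ?_⟩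
    have h' := h x Q' hQ'
    rw [fidelity_joint_indep_eq_of_pos ha0 ha1 P W (lowerSimplex_pos h0 hQ'),
      fidelity_ofReal_eq ha0 ha1 (transProb_nonneg W x) hQ.1.1
        fun y _ => lowerSimplex_pos h0 hQ y]
    apply rpow_antitone_of_nonpos (by rw [one_div, inv_nonpos]; linarith)
    apply ENNReal.ofReal_le_ofReal
    simpa using h'

/-- Order `∞` is explicit and needs no minimax: `Q` is proportional to `max_x W(y|x)`, mixed with
the uniform distribution, and the uniform `P` has full support, so every maximizer is admissible in
`fidelity_top_joint_indep_le`. -/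
lemma exists_fidelity_ge_top [Nonempty X] [Nonempty Y] (W : Channel X Y)
    {δ : ℝ} (h0 : 0 < δ) (h1 : δ < 1) :
    ∃ Q ∈ lowerSimplex Y δ, ∃ P : stdSimplex ℝ X, ∀ x, ∀ Q' : stdSimplex ℝ Y,
      ENNReal.ofReal (1 - δ) * fidelity ∞ (joint P W) (indep P.1 Q'.1) ≤
        fidelity ∞ (transProb W x) Q := by
  choose ξ hξ using fun y => Finite.exists_max fun x => transProb W x y
  set S : ℝ := ∑ y, transProb W (ξ y) y with hSdef
  have hS : 0 < S := by
    calc (0 : ℝ) < ∑ y, transProb W (Classical.arbitrary X) y := by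
          rw [sum_transProb]; exact one_pos
      _ ≤ S := Finset.sum_le_sum fun y _ => hξ y _
  have hc : (0 : ℝ) < Fintype.card X := by exact_mod_cast Fintype.card_pos
  let P : stdSimplex ℝ X := ⟨fun _ => 1 / Fintype.card X, fun _ => by positivity, by
    simp⟩
  refine ⟨_, mix_mem_lowerSimplex h0.le h1.le (Q := fun y => transProb W (ξ y) y / S)
    ⟨fun y => div_nonneg (transProb_nonneg _ _ _) hS.le, by
      rw [← Finset.sum_div, div_self hS.ne']⟩, P, fun x Q' => ?_⟩
  have hP : ∀ y, 0 < P.1 (ξ y) := fun y => by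
    change (0 : ℝ) < 1 / Fintype.card X
    positivity
  refine (mul_le_mul_right (fidelity_top_joint_indep_le P W Q' hP hS) _).trans ?_
  rw [← ENNReal.ofReal_mul (by linarith), fidelity_top]
  refine le_iInf fun ⟨y, hy⟩ => ?_
  rw [← ENNReal.ofReal_div_of_pos hy]
  apply ENNReal.ofReal_le_ofReal
  rw [le_div_iff₀ hy]
  have hcY : (0 : ℝ) ≤ δ / Fintype.card Y := by positivity
  calc (1 - δ) * (1 / S) * transProb W x y ≤ (1 - δ) * (1 / S) * transProb W (ξ y) y := by
        have : 0 ≤ 1 - δ := by linarith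
        gcongr
        exact hξ y x
    _ = (1 - δ) * (transProb W (ξ y) y / S) := by ring
    _ ≤ _ := le_add_of_nonneg_right hcY

/-- The saddle point only competes against `Q'` bounded below. Mixing an arbitrary `Q'` with the
uniform distribution makes it admissible and keeps at least `(1-δ) Q'`. -/
lemma exists_fidelity_ge [Nonempty X] [Nonempty Y] (α : ℝ≥0∞) (W : Channel X Y)
    {δ : ℝ} (h0 : 0 < δ) (h1 : δ < 1) :
    ∃ Q ∈ lowerSimplex Y δ, ∃ P : stdSimplex ℝ X, ∀ x, ∀ Q' : stdSimplex ℝ Y,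
      ENNReal.ofReal (1 - δ) * fidelity α (joint P W) (indep P.1 Q'.1) ≤
        fidelity α (transProb W x) Q := by
  by_cases hα : α = ∞
  · rw [hα]
    exact exists_fidelity_ge_top W h0 h1
  obtain ⟨Q, hQ, P, h⟩ := exists_fidelity_saddle hα W h0 h1.le
  refine ⟨Q, hQ, P, fun x Q' => le_trans ?_ (h x _ (mix_mem_lowerSimplex h0.le h1.le Q'.2))⟩
  rw [← fidelity_const_mul α (joint_nonneg P W) (sum_joint P W) (by linarith)]
  refine fidelity_mono α (joint_nonneg P W) fun z => ?_
  simp only [indep]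
  rw [mul_left_comm]
  refine mul_le_mul_of_nonneg_left (le_add_of_nonneg_right ?_) (P.2.1 _)
  positivity

/-- An almost capacity-achieving output distribution. -/
lemma exists_output_fidelity_ge [Nonempty X] [Nonempty Y] {α : ℝ≥0∞} {W : Channel X Y}
    {I δ η : ℝ} (hI : renyiCapacity α W ≤ (I : EReal)) (h0 : 0 < δ) (h1 : δ < 1)
    (hη : (2 : ℝ) ^ (-η) < 1 - δ) :
    ∃ Q ∈ lowerSimplex Y δ, ∀ x, ENNReal.ofReal (2 ^ (-(I + η))) ≤ fidelity α (transProb W x) Q := by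
  obtain ⟨Q, hQ, P, h⟩ := exists_fidelity_ge α W h0 h1
  refine ⟨Q, hQ, fun x => ?_⟩
  -- The strict inequality in `hη` leaves room for an `ε`, used because the infimum over `Q'` is
  -- only approached.
  obtain ⟨ε, hε, hεη⟩ : ∃ ε : ℝ, 0 < ε ∧ (2 : ℝ) ^ (-η) ≤ (1 - δ) * 2 ^ (-ε) := by
    refine ⟨Real.logb 2 ((1 - δ) / 2 ^ (-η)), Real.logb_pos one_lt_two ?_, ?_⟩
    · rwa [one_lt_div (by positivity)]
    · have h1' : 0 < 1 - δ := by linarith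
      rw [Real.rpow_neg two_pos.le (Real.logb _ _), Real.rpow_logb two_pos (by norm_num)
        (div_pos h1' (by positivity)), inv_div, mul_div_cancel₀ _ h1'.ne']
  have hlt : renyiMutualInfo α (joint P W) < ((I + ε : ℝ) : EReal) :=
    ((le_iSup (fun P : stdSimplex ℝ X => renyiMutualInfo α (joint P W)) P).trans hI).trans_lt
      (by exact_mod_cast (by linarith))
  rw [renyiMutualInfo_joint] at hlt
  obtain ⟨Q', hQ'⟩ := iInf_lt_iff.1 hlt
  have h2 := (renyiDiv_le_iff _ _ _ _).1 hQ'.le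
  calc ENNReal.ofReal (2 ^ (-(I + η))) ≤ ENNReal.ofReal ((1 - δ) * 2 ^ (-(I + ε))) := by
        apply ENNReal.ofReal_le_ofReal
        rw [neg_add, neg_add, Real.rpow_add two_pos, Real.rpow_add two_pos, mul_left_comm]
        gcongr
    _ = ENNReal.ofReal (1 - δ) * ENNReal.ofReal (2 ^ (-(I + ε))) :=
        ENNReal.ofReal_mul (by linarith)
    _ ≤ _ := (mul_le_mul_right h2 _).trans (h x Q')

lemma fidelity_self {A : Type*} [Fintype A] (α : ℝ≥0∞) {P : A → ℝ} (hP : ∀ a, 0 ≤ P a)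
    (hP1 : ∑ a, P a = 1) : 1 ≤ fidelity α P P := by
  have hs := sum_ofReal_eq_one hP hP1
  rcases order_cases α with rfl | rfl | rfl | ⟨a, ha0, ha1, rfl⟩
  · rw [fidelity_zero, ← hs]
    refine Finset.sum_le_sum fun a _ => ?_
    rcases (hP a).eq_or_lt with h | h
    · simp [← h]
    · simp [h]
  · rw [fidelity_one]
    refine le_of_eq (Finset.prod_eq_one fun a _ => ?_).symm
    rcases (hP a).eq_or_lt with h | h
    · simp [← h]
    · rw [ENNReal.div_self (by simpa using h) ENNReal.ofReal_ne_top, ENNReal.one_rpow]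
  · rw [fidelity_top]
    refine le_iInf fun ⟨a, h⟩ => ?_
    rw [ENNReal.div_self (by simpa using h) ENNReal.ofReal_ne_top]
  · rw [fidelity_ofReal ha0 ha1]
    have : ∀ i, ENNReal.ofReal (P i) ^ a * ENNReal.ofReal (P i) ^ (1 - a) =
        ENNReal.ofReal (P i) := fun i => by
      rcases (hP i).eq_or_lt with h | h
      · simp [← h, ha0]
      · rw [← ENNReal.rpow_add _ _ (by simpa using h) ENNReal.ofReal_ne_top]
        simp
    simp_rw [this]
    rw [hs, ENNReal.one_rpow]

/-- The Rényi capacity is finite. -/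
lemma exists_renyiCapacity_eq [Nonempty X] [Nonempty Y] (α : ℝ≥0∞) (W : Channel X Y) :
    ∃ I : ℝ, renyiCapacity α W = (I : EReal) := by
  classical
  have hc : (0 : ℝ) < Fintype.card Y := by exact_mod_cast Fintype.card_pos
  let U : stdSimplex ℝ Y := ⟨fun _ => 1 / Fintype.card Y, fun _ => by positivity, by simp⟩
  have hle : renyiCapacity α W ≤ ((Real.logb 2 (Fintype.card Y) : ℝ) : EReal) := by
    refine iSup_le fun P => ?_
    rw [renyiMutualInfo_joint]
    refine (iInf_le _ U).trans ?_
    rw [renyiDiv_le_iff, Real.rpow_neg two_pos.le, Real.rpow_logb two_pos (by norm_num) hc]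
    -- Transition probabilities are at most one, so `P × U` dominates `P·W / |Y|` pointwise.
    calc ENNReal.ofReal (Fintype.card Y : ℝ)⁻¹
        ≤ ENNReal.ofReal (Fintype.card Y : ℝ)⁻¹ * fidelity α (joint P W) (joint P W) :=
          le_mul_of_one_le_right zero_le (fidelity_self α (joint_nonneg P W) (sum_joint P W))
      _ = fidelity α (joint P W) (fun z => (Fintype.card Y : ℝ)⁻¹ * joint P W z) :=
          (fidelity_const_mul α (joint_nonneg P W) (sum_joint P W) (by positivity)).symm
      _ ≤ _ := fidelity_mono α (joint_nonneg P W) fun z => by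
          change _ ≤ P.1 z.1 * (1 / Fintype.card Y)
          rw [one_div, mul_comm]
          gcongr
          exact mul_le_of_le_one_right (P.2.1 _) (transProb_le_one _ _ _)
  have hge : (0 : EReal) ≤ renyiCapacity α W := by
    let P : stdSimplex ℝ X := ⟨Pi.single (Classical.arbitrary X) 1, single_mem_stdSimplex ℝ _⟩
    refine le_iSup_of_le P ?_
    rw [renyiMutualInfo_joint]
    refine le_iInf fun Q => ?_
    have h1 : ∑ z, indep P.1 Q.1 z = 1 := by
      rw [Fintype.sum_prod_type]
      simp only [indep]
      simp_rw [← Finset.mul_sum, Q.2.2, mul_one]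
      exact P.2.2
    have h := (le_renyiDiv_iff α (joint P W) (indep P.1 Q.1) 0).2 (by
      simpa using fidelity_le_one α (joint_nonneg P W) (sum_joint P W)
        (indep_nonneg P.2.1 Q.2.1) h1)
    simpa using h
  exact ⟨_, (EReal.coe_toReal (hle.trans_lt (EReal.coe_lt_top _)).ne
    (lt_of_lt_of_le (EReal.bot_lt_zero) hge).ne').symm⟩

end Capacity

end RenyiSim

namespace RenyiSim

/-! ### Variances of sums of independent letters. -/

section Variance

/-- The variance of a sum of centred functions of independent letters. -/
lemma sum_prod_mul_sum_sq {Z : Type*} [Fintype Z] {n : ℕ} (p f : Fin n → Z → ℝ)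
    (hp : ∀ i, ∑ z, p i z = 1) (hf : ∀ i, ∑ z, p i z * f i z = 0) :
    ∑ z : Fin n → Z, (∏ i, p i (z i)) * (∑ i, f i (z i)) ^ 2 =
      ∑ i, ∑ z, p i z * f i z ^ 2 := by
  classical
  have h0 : ∑ z : Fin n → Z, (∏ i, p i (z i)) * ∑ i, f i (z i) = 0 := by
    rw [sum_prod_mul_sum p f hp]
    simp [hf]
  have key : ∀ i, ∑ z : Fin n → Z, (∏ j, p j (z j)) * (f i (z i) * ∑ j, f j (z j)) =
      ∑ z, p i z * f i z ^ 2 := by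
    intro i
    -- Reweighting letter `i` by `1 + f i` keeps total mass one because `f i` is centred; the
    -- expectation formula for these weights yields the mixed moments, and off-diagonal terms
    -- vanish.
    have h1 := sum_prod_mul_sum (fun j z => p j z * (1 + if j = i then f j z else 0)) f
      fun j => by
        by_cases h : j = i
        · simp [h, mul_add, Finset.sum_add_distrib, hp, hf]
        · simp [h, hp]
    have h2 : ∀ z : Fin n → Z, (∏ j, p j (z j) * (1 + if j = i then f j (z j) else 0)) =
        (∏ j, p j (z j)) * (1 + f i (z i)) := fun z => by
      rw [Finset.prod_mul_distrib]
      congr 1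
      rw [Finset.prod_eq_single i] <;> simp +contextual
    simp_rw [h2] at h1
    have h3 : ∑ j, ∑ z, p j z * (1 + if j = i then f j z else 0) * f j z =
        ∑ z, p i z * f i z ^ 2 := by
      rw [Finset.sum_eq_single i]
      · simp only [if_true]
        rw [← add_zero (∑ z, p i z * f i z ^ 2), ← hf i, ← Finset.sum_add_distrib]
        exact Finset.sum_congr rfl fun z _ => by ring
      · intro j _ hj
        simp [hj, hf]
      · simp
    rw [h3] at h1
    rw [← h1, ← sub_eq_zero, ← Finset.sum_sub_distrib, ← neg_eq_zero, ← Finset.sum_neg_distrib,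
      ← h0]
    exact Finset.sum_congr rfl fun z _ => by ring
  rw [← Finset.sum_congr rfl fun i _ => key i, Finset.sum_comm]
  refine Finset.sum_congr rfl fun z _ => ?_
  rw [← Finset.mul_sum, ← Finset.sum_mul, sq]

/-- The variance of a sum of functions of independent letters. -/
lemma sum_prod_mul_sub_sq_le {Z : Type*} [Fintype Z] {n : ℕ} (p f : Fin n → Z → ℝ)
    (hp : ∀ i, ∑ z, p i z = 1) {K : ℝ}
    (hK : ∀ i, ∑ z, p i z * (f i z - ∑ z, p i z * f i z) ^ 2 ≤ K) :
    ∑ z : Fin n → Z, (∏ i, p i (z i)) * (∑ i, f i (z i) - ∑ i, ∑ z, p i z * f i z) ^ 2 ≤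
      n * K := by
  have h := sum_prod_mul_sum_sq p (fun i z => f i z - ∑ z, p i z * f i z) hp fun i => by
    simp_rw [mul_sub]
    rw [Finset.sum_sub_distrib, ← Finset.sum_mul, hp, one_mul, sub_self]
  simp_rw [← Finset.sum_sub_distrib]
  rw [h]
  calc _ ≤ ∑ _i : Fin n, K := Finset.sum_le_sum fun i _ => hK i
    _ = n * K := by simp

end Variance

/-! ### Fidelities in real form and the effect of truncation. -/

section OneShotFidelity

variable {A : Type*} [Fintype A]

/-- The outer exponent `1/(1-α)` is negative, so the inequality turns around. -/
lemma le_fidelity_iff_of_one_lt {α t : ℝ} (h1 : 1 < α) {P Q : A → ℝ} (hP : ∀ a, 0 ≤ P a)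
    (hQ0 : ∀ a, 0 ≤ Q a) (hQ : ∀ a, 0 < P a → 0 < Q a) :
    ENNReal.ofReal (2 ^ (-t)) ≤ fidelity (ENNReal.ofReal α) P Q ↔
      ∑ a, P a ^ α * Q a ^ (1 - α) ≤ 2 ^ ((α - 1) * t) := by
  have h1' : 1 - α ≠ 0 := by linarith
  rw [fidelity_ofReal_eq (by linarith) h1.ne' hP hQ0 hQ]
  have e : ENNReal.ofReal (2 ^ (-t)) = ENNReal.ofReal (2 ^ ((α - 1) * t)) ^ (1 / (1 - α)) := by
    rw [ENNReal.ofReal_rpow_of_pos (by positivity), ← Real.rpow_mul two_pos.le]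
    congr 2
    field_simp
    ring
  rw [e, ← ENNReal.ofReal_le_ofReal_iff (by positivity)]
  constructor
  · intro h
    have h2 := rpow_antitone_of_nonpos (z := 1 - α) (by linarith) h
    simpa only [← ENNReal.rpow_mul, one_div_mul_cancel h1', ENNReal.rpow_one] using h2
  · exact fun h => rpow_antitone_of_nonpos (by rw [one_div, inv_nonpos]; linarith) h

lemma le_fidelity_iff_of_lt_one {α t : ℝ} (h0 : 0 < α) (h1 : α < 1) {P Q : A → ℝ}
    (hP : ∀ a, 0 ≤ P a) (hQ0 : ∀ a, 0 ≤ Q a) :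
    ENNReal.ofReal (2 ^ (-t)) ≤ fidelity (ENNReal.ofReal α) P Q ↔
      2 ^ (-((1 - α) * t)) ≤ ∑ a, P a ^ α * Q a ^ (1 - α) := by
  have h1' : 0 < 1 - α := by linarith
  have hs : ENNReal.ofReal (∑ a, P a ^ α * Q a ^ (1 - α)) =
      ∑ a, ENNReal.ofReal (P a) ^ α * ENNReal.ofReal (Q a) ^ (1 - α) := by
    rw [ENNReal.ofReal_sum_of_nonneg fun a _ =>
      mul_nonneg (Real.rpow_nonneg (hP a) _) (Real.rpow_nonneg (hQ0 a) _)]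
    refine Finset.sum_congr rfl fun a _ => ?_
    rw [ENNReal.ofReal_mul (Real.rpow_nonneg (hP a) _), ENNReal.ofReal_rpow_of_nonneg (hP a) h0.le,
      ENNReal.ofReal_rpow_of_nonneg (hQ0 a) h1'.le]
  have e : ENNReal.ofReal (2 ^ (-t)) = ENNReal.ofReal (2 ^ (-((1 - α) * t))) ^ (1 / (1 - α)) := by
    rw [ENNReal.ofReal_rpow_of_pos (by positivity), ← Real.rpow_mul two_pos.le]
    congr 2
    field_simp
  rw [fidelity_ofReal h0 h1.ne, ← hs, e, ENNReal.rpow_le_rpow_iff (by positivity),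
    ENNReal.ofReal_le_ofReal_iff
    (Finset.sum_nonneg fun a _ => mul_nonneg (Real.rpow_nonneg (hP a) _)
      (Real.rpow_nonneg (hQ0 a) _))]

/-- Truncation at `2 ^ c * Q` loses at most a constant when `α > 1`. -/
lemma le_fidelity_min_of_one_lt {α t c : ℝ} (h1 : 1 < α) {P Q : A → ℝ} (hP : ∀ a, 0 ≤ P a)
    (hP1 : ∑ a, P a = 1) (hQ : ∀ a, 0 < Q a)
    (h : ∑ a, P a ^ α * Q a ^ (1 - α) ≤ 2 ^ ((α - 1) * t)) :
    ENNReal.ofReal (2 ^ (-(max (t - c) 0 + 1 / (α - 1)))) ≤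
      fidelity (ENNReal.ofReal α) P fun a => min (P a) (2 ^ c * Q a) := by
  have hc : ∀ a, 0 < 2 ^ c * Q a := fun a => mul_pos (by positivity) (hQ a)
  rw [le_fidelity_iff_of_one_lt h1 hP (fun a => le_min (hP a) (hc a).le)
    fun a ha => lt_min ha (hc a)]
  have hα : 0 < α - 1 := by linarith
  -- Where the minimum is `P` the summand is `P`; elsewhere it is the summand for `Q` times
  -- `2^(-c(α-1))`. The sum of both bounds each case.
  calc ∑ a, P a ^ α * min (P a) (2 ^ c * Q a) ^ (1 - α)
      ≤ ∑ a, (P a + 2 ^ ((α - 1) * -c) * (P a ^ α * Q a ^ (1 - α))) := by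
        refine Finset.sum_le_sum fun a _ => ?_
        have hr : 0 ≤ 2 ^ ((α - 1) * -c) * (P a ^ α * Q a ^ (1 - α)) :=
          mul_nonneg (by positivity) (mul_nonneg (Real.rpow_nonneg (hP a) _)
            (Real.rpow_nonneg (hQ a).le _))
        rcases (hP a).eq_or_lt with h0 | h0
        · simp [← h0, show α ≠ 0 by linarith]
        rcases le_total (P a) (2 ^ c * Q a) with hle | hle
        · rw [min_eq_left hle, ← Real.rpow_add h0]
          simpa using hr
        · rw [min_eq_right hle, Real.mul_rpow (by positivity) (hQ a).le, ← Real.rpow_mul two_pos.le]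
          have : c * (1 - α) = (α - 1) * -c := by ring
          rw [this, mul_left_comm]
          linarith
    _ = 1 + 2 ^ ((α - 1) * -c) * ∑ a, P a ^ α * Q a ^ (1 - α) := by
        rw [Finset.sum_add_distrib, hP1, Finset.mul_sum]
    _ ≤ 1 + 2 ^ ((α - 1) * -c) * 2 ^ ((α - 1) * t) := by gcongr
    _ = 1 + 2 ^ ((α - 1) * (t - c)) := by
        rw [← Real.rpow_add two_pos]
        congr 2
        ring
    -- This doubling is what the extra `1/(α-1)` in the exponent pays for.
    _ ≤ 2 ^ ((α - 1) * max (t - c) 0) + 2 ^ ((α - 1) * max (t - c) 0) := by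
        refine add_le_add (Real.one_le_rpow one_le_two (mul_nonneg hα.le (le_max_right _ _)))
          (Real.rpow_le_rpow_of_exponent_le one_le_two
            (mul_le_mul_of_nonneg_left (le_max_left _ _) hα.le))
    _ = 2 ^ ((α - 1) * (max (t - c) 0 + 1 / (α - 1))) := by
        rw [mul_add, mul_one_div_cancel hα.ne', Real.rpow_add two_pos, Real.rpow_one]
        ring

/-- The divergence of order `1` after truncation at `2 ^ c * Q`. -/
lemma le_fidelity_one_min {c T : ℝ} {P Q : A → ℝ} (hP : ∀ a, 0 ≤ P a) (hQ : ∀ a, 0 < Q a)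
    (h : ∑ a, P a * max (Real.logb 2 (P a / Q a) - c) 0 ≤ T) :
    ENNReal.ofReal (2 ^ (-T)) ≤ fidelity 1 P fun a => min (P a) (2 ^ c * Q a) := by
  have hc : ∀ a, 0 < 2 ^ c * Q a := fun a => mul_pos (by positivity) (hQ a)
  rw [fidelity_one_eq_exp hP (fun a => le_min (hP a) (hc a).le) fun a ha => lt_min ha (hc a)]
  apply ENNReal.ofReal_le_ofReal
  have hlog : 0 < Real.log 2 := Real.log_pos one_lt_two
  rw [Real.rpow_def_of_pos two_pos, Real.exp_le_exp]
  calc Real.log 2 * -T ≤ Real.log 2 * -∑ a, P a * max (Real.logb 2 (P a / Q a) - c) 0 := by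
        gcongr
    _ = ∑ a, P a * Real.log (min (P a) (2 ^ c * Q a) / P a) := by
        rw [← Finset.sum_neg_distrib, Finset.mul_sum]
        refine Finset.sum_congr rfl fun a _ => ?_
        rcases (hP a).eq_or_lt with h0 | h0
        · simp [← h0]
        have e : Real.logb 2 (P a / Q a) - c = Real.logb 2 (P a / (2 ^ c * Q a)) := by
          rw [Real.logb_div h0.ne' (hQ a).ne', Real.logb_div h0.ne' (hc a).ne',
            Real.logb_mul (by positivity) (hQ a).ne', Real.logb_rpow two_pos (by norm_num)]
          ring
        rw [e]
        rcases le_total (P a) (2 ^ c * Q a) with hle | hle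
        · rw [min_eq_left hle, div_self h0.ne', Real.log_one, max_eq_right]
          · simp
          · exact Real.logb_nonpos one_lt_two (div_nonneg (hP a) (hc a).le)
              (div_le_one_of_le₀ hle (hc a).le)
        · rw [min_eq_right hle, max_eq_left]
          · rw [Real.logb, Real.log_div h0.ne' (hc a).ne', Real.log_div (hc a).ne' h0.ne']
            field_simp
            ring
          · exact Real.logb_nonneg one_lt_two ((one_le_div (hc a)).2 hle)

end OneShotFidelity

/-! ### Achievability for order `0` and orders at least `1`. -/

section Achievability

variable {X Y : Type*} [Fintype Y] [Fintype X]

/-- Only the mass on the support of `W^n` counts, so `ν` is `Q^n` restricted to it, scaled up as far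
as `2^c Q^n` and total mass one permit. -/
lemma optDiv_prodChannel_le_zero (W : Channel X Y) (Q : stdSimplex ℝ Y) {t : ℝ}
    (h : ∀ x, ENNReal.ofReal (2 ^ (-t)) ≤ fidelity 0 (transProb W x) Q.1) (n : ℕ) {c : ℝ}
    (hc : 0 ≤ c) : optDiv 0 (prodChannel W n) c ≤ ((max (n * t - c) 0 + 2 : ℝ) : EReal) := by
  classical
  set s : X → ℝ := fun x => ∑ y, if 0 < transProb W x y then Q.1 y else 0 with hs
  have hs' : ∀ x, 2 ^ (-t) ≤ s x := fun x => by
    have h1 := h x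
    rw [fidelity_zero] at h1
    have h2 : ENNReal.ofReal (s x) =
        ∑ y, if 0 < transProb W x y then ENNReal.ofReal (Q.1 y) else 0 := by
      rw [hs, ENNReal.ofReal_sum_of_nonneg fun y _ => by
        split_ifs
        exacts [Q.2.1 y, le_rfl]]
      refine Finset.sum_congr rfl fun y _ => ?_
      split_ifs <;> simp
    rw [← h2, ENNReal.ofReal_le_ofReal_iff'] at h1
    exact h1.resolve_right (not_le.2 (by positivity))
  set u : (Fin n → X) → (Fin n → Y) → ℝ := fun x y =>
    if 0 < transProb (prodChannel W n) x y then (prodDist Q n).1 y else 0 with hu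
  have hu0 : ∀ x y, 0 ≤ u x y := fun x y => by
    simp only [hu]
    split_ifs
    exacts [(prodDist Q n).2.1 y, le_rfl]
  have hsum : ∀ x, 2 ^ (-(n * t)) ≤ ∑ y, u x y := fun x => by
    have e : ∑ y, u x y = ∏ i, s (x i) := by
      simp only [hs]
      rw [Fintype.prod_sum (fun i y => if 0 < transProb W (x i) y then Q.1 y else 0)]
      refine Finset.sum_congr rfl fun y _ => ?_
      simp only [hu]
      by_cases hpos : ∀ i, 0 < transProb W (x i) (y i)
      · rw [if_pos (show 0 < transProb (prodChannel W n) x y by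
          rw [transProb_prodChannel]
          exact Finset.prod_pos fun i _ => hpos i)]
        change ∏ i, Q.1 (y i) = _
        exact Finset.prod_congr rfl fun i _ => (if_pos (hpos i)).symm
      · push Not at hpos
        obtain ⟨i, hi⟩ := hpos
        have h0 : transProb W (x i) (y i) = 0 := le_antisymm hi (transProb_nonneg _ _ _)
        rw [if_neg, Finset.prod_eq_zero (Finset.mem_univ i) (if_neg hi.not_gt)]
        rw [transProb_prodChannel, Finset.prod_eq_zero (Finset.mem_univ i) h0]
        exact lt_irrefl 0
    rw [e]
    calc (2 : ℝ) ^ (-(n * t)) = ∏ _i : Fin n, (2 : ℝ) ^ (-t) := by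
          rw [Finset.prod_const, Finset.card_univ, Fintype.card_fin, ← Real.rpow_natCast,
            ← Real.rpow_mul two_pos.le]
          congr 1
          ring
      _ ≤ _ := Finset.prod_le_prod (fun i _ => by positivity) fun i _ => hs' _
  have hsum0 : ∀ x, 0 < ∑ y, u x y := fun x => lt_of_lt_of_le (by positivity) (hsum x)
  refine optDiv_le hc (prodDist Q n) (fun x y => min (2 ^ c) (1 / ∑ y, u x y) * u x y)
    (fun x y => mul_nonneg (le_min (by positivity) (by have := hsum0 x; positivity)) (hu0 x y))
    (fun x y => ?_) (fun x => ?_) fun x => ?_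
  · calc min (2 ^ c) (1 / ∑ y, u x y) * u x y ≤ 2 ^ c * u x y :=
          mul_le_mul_of_nonneg_right (min_le_left _ _) (hu0 x y)
      _ ≤ _ := by
          gcongr
          simp only [hu]
          split_ifs
          exacts [le_rfl, (prodDist Q n).2.1 y]
  · rw [← Finset.mul_sum]
    calc _ ≤ 1 / (∑ y, u x y) * ∑ y, u x y :=
          mul_le_mul_of_nonneg_right (min_le_right _ _) (hsum0 x).le
      _ = 1 := one_div_mul_cancel (hsum0 x).ne'
  · have e : fidelity 0 (transProb (prodChannel W n) x)
        (fun y => min (2 ^ c) (1 / ∑ y, u x y) * u x y) =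
        ENNReal.ofReal (min (2 ^ c) (1 / ∑ y, u x y) * ∑ y, u x y) := by
      rw [fidelity_zero, Finset.mul_sum, ENNReal.ofReal_sum_of_nonneg fun y _ =>
        mul_nonneg (le_min (by positivity) (by have := hsum0 x; positivity)) (hu0 x y)]
      refine Finset.sum_congr rfl fun y _ => ?_
      simp only [hu]
      split_ifs <;> simp
    rw [e]
    apply ENNReal.ofReal_le_ofReal
    rw [min_mul_of_nonneg _ _ (hsum0 x).le, one_div_mul_cancel (hsum0 x).ne']
    refine le_min ?_ (Real.rpow_le_one_of_one_le_of_nonpos one_le_two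
      (neg_nonpos.2 (le_max_right _ _)))
    calc (2 : ℝ) ^ (-max (n * t - c) 0) ≤ 2 ^ (-(n * t - c)) :=
          Real.rpow_le_rpow_of_exponent_le one_le_two (neg_le_neg (le_max_left _ _))
      _ = 2 ^ c * 2 ^ (-(n * t)) := by
          rw [← Real.rpow_add two_pos]
          congr 1
          ring
      _ ≤ _ := by
          gcongr
          exact hsum x

/-- The hypothesis means `2^(-t) W ≤ Q`, which tensorizes; `W^n` is scaled down just enough to fit
below `2^c Q^n`. -/
lemma optDiv_prodChannel_le_top (W : Channel X Y) (Q : stdSimplex ℝ Y) {t : ℝ}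
    (h : ∀ x, ENNReal.ofReal (2 ^ (-t)) ≤ fidelity ∞ (transProb W x) Q.1) (n : ℕ) {c : ℝ}
    (hc : 0 ≤ c) : optDiv ∞ (prodChannel W n) c ≤ ((max (n * t - c) 0 + 2 : ℝ) : EReal) := by
  have hWQ : ∀ x y, 2 ^ (-t) * transProb W x y ≤ Q.1 y := by
    intro x y
    rcases (transProb_nonneg W x y).eq_or_lt with h0 | h0
    · rw [← h0, mul_zero]
      exact Q.2.1 y
    · have h1 := h x
      rw [fidelity_top] at h1
      have h2 := h1.trans (iInf_le _ ⟨y, h0⟩)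
      rw [← ENNReal.ofReal_div_of_pos h0, ENNReal.ofReal_le_ofReal_iff', le_div_iff₀ h0] at h2
      exact h2.resolve_right (not_le.2 (by positivity))
  refine optDiv_le hc (prodDist Q n)
    (fun x y => 2 ^ (-max (n * t - c) 0) * transProb (prodChannel W n) x y)
    (fun x y => mul_nonneg (by positivity) (transProb_nonneg _ _ _)) (fun x y => ?_) (fun x => ?_)
    fun x => ?_
  · calc 2 ^ (-max (n * t - c) 0) * transProb (prodChannel W n) x y
        ≤ 2 ^ (-(n * t - c)) * transProb (prodChannel W n) x y := by
          refine mul_le_mul_of_nonneg_right ?_ (transProb_nonneg _ _ _)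
          exact Real.rpow_le_rpow_of_exponent_le one_le_two (neg_le_neg (le_max_left _ _))
      _ = 2 ^ c * ∏ i, (2 ^ (-t) * transProb W (x i) (y i)) := by
          rw [Finset.prod_mul_distrib, Finset.prod_const, Finset.card_univ, Fintype.card_fin,
            ← Real.rpow_natCast, ← Real.rpow_mul two_pos.le, ← mul_assoc, ← Real.rpow_add two_pos,
            transProb_prodChannel]
          congr 2
          ring
      _ ≤ 2 ^ c * ∏ i, Q.1 (y i) := by
          gcongr with i
          · exact fun i _ => mul_nonneg (by positivity) (transProb_nonneg _ _ _)
          · exact hWQ _ _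
  · rw [← Finset.mul_sum, sum_transProb, mul_one]
    exact Real.rpow_le_one_of_one_le_of_nonpos one_le_two (neg_nonpos.2 (le_max_right _ _))
  · rw [fidelity_const_mul ∞ (transProb_nonneg _ _) (sum_transProb _ _) (by positivity)]
    exact le_mul_of_one_le_right zero_le (fidelity_self _ (transProb_nonneg _ _)
      (sum_transProb _ _))

lemma optDiv_prodChannel_le_of_one_lt {α : ℝ} (h1 : 1 < α) (W : Channel X Y)
    (Q : stdSimplex ℝ Y) (hQ : ∀ y, 0 < Q.1 y) {t : ℝ}
    (h : ∀ x, ENNReal.ofReal (2 ^ (-t)) ≤ fidelity (ENNReal.ofReal α) (transProb W x) Q.1) (n : ℕ)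
    {c : ℝ} (hc : 0 ≤ c) : optDiv (ENNReal.ofReal α) (prodChannel W n) c ≤
      ((max (n * t - c) 0 + (1 / (α - 1) + 2) : ℝ) : EReal) := by
  classical
  have hQn : ∀ y, 0 < (prodDist Q n).1 y := fun y => by
    change 0 < ∏ i, Q.1 (y i)
    exact Finset.prod_pos fun i _ => hQ _
  rw [← add_assoc]
  refine optDiv_le hc (prodDist Q n)
    (fun x y => min (transProb (prodChannel W n) x y) (2 ^ c * (prodDist Q n).1 y))
    (fun x y => le_min (transProb_nonneg _ _ _) (mul_nonneg (by positivity) (hQn y).le))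
    (fun x y => min_le_right _ _) (fun x => ?_) fun x => ?_
  · rw [← sum_transProb (prodChannel W n) x]
    exact Finset.sum_le_sum fun y _ => min_le_left _ _
  refine le_fidelity_min_of_one_lt h1 (transProb_nonneg _ _) (sum_transProb _ _) hQn ?_
  calc ∑ y, transProb (prodChannel W n) x y ^ α * (prodDist Q n).1 y ^ (1 - α)
      = ∏ i, ∑ y, transProb W (x i) y ^ α * Q.1 y ^ (1 - α) := by
        rw [Fintype.prod_sum (fun i y => transProb W (x i) y ^ α * Q.1 y ^ (1 - α))]
        refine Finset.sum_congr rfl fun y _ => ?_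
        rw [Finset.prod_mul_distrib, Real.finsetProd_rpow _ _ fun i _ => transProb_nonneg W _ _,
          Real.finsetProd_rpow _ _ fun i _ => (hQ _).le]
        rfl
    _ ≤ ∏ _i : Fin n, (2 : ℝ) ^ ((α - 1) * t) := by
        refine Finset.prod_le_prod (fun i _ => Finset.sum_nonneg fun y _ =>
          mul_nonneg (Real.rpow_nonneg (transProb_nonneg _ _ _) _) (Real.rpow_nonneg (hQ y).le _))
          fun i _ => ?_
        exact (le_fidelity_iff_of_one_lt h1 (transProb_nonneg W _) (fun y => (hQ y).le)
          fun y _ => hQ y).1 (h (x i))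
    _ = 2 ^ ((α - 1) * (n * t)) := by
        rw [Finset.prod_const, Finset.card_univ, Fintype.card_fin, ← Real.rpow_natCast,
          ← Real.rpow_mul two_pos.le]
        congr 1
        ring

lemma exists_forall_le_of_finite {ι : Type*} [Finite ι] (f : ι → ℝ) :
    ∃ K, 0 ≤ K ∧ ∀ i, f i ≤ K := by
  obtain ⟨K, hK⟩ := (Set.finite_range f).bddAbove
  exact ⟨max K 0, le_max_right _ _, fun i => (hK ⟨i, rfl⟩).trans (le_max_left _ _)⟩

/-- Truncation costs the expectation of `|L - c|^+`, where the log-likelihood ratio `L` is a sum of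
independent letters with mean at most `n t` and variance `O(n)`. Hence the positive part may be
taken outside the expectation up to `n ε` and a constant. -/
lemma optDiv_prodChannel_le_one (W : Channel X Y)
    (Q : stdSimplex ℝ Y) (hQ : ∀ y, 0 < Q.1 y) {t : ℝ}
    (h : ∀ x, ENNReal.ofReal (2 ^ (-t)) ≤ fidelity 1 (transProb W x) Q.1) {ε : ℝ} (hε : 0 < ε) :
    ∃ C : ℝ, ∀ (n : ℕ) (c : ℝ), 0 ≤ c → optDiv 1 (prodChannel W n) c ≤
      ((max (n * t - c) 0 + (n * ε + C) : ℝ) : EReal) := by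
  set f : X → Y → ℝ := fun x y => Real.logb 2 (transProb W x y / Q.1 y) with hf
  set m : X → ℝ := fun x => ∑ y, transProb W x y * f x y with hm
  have hlog : 0 < Real.log 2 := Real.log_pos one_lt_two
  have hmt : ∀ x, m x ≤ t := by
    intro x
    have h1 := h x
    rw [fidelity_one_eq_exp (transProb_nonneg W x) (fun y => (hQ y).le) fun y _ => hQ y,
      ENNReal.ofReal_le_ofReal_iff (Real.exp_nonneg _), Real.rpow_def_of_pos two_pos,
      Real.exp_le_exp] at h1
    have e : ∑ y, transProb W x y * Real.log (Q.1 y / transProb W x y) = -(Real.log 2 * m x) := by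
      rw [hm, Finset.mul_sum, ← Finset.sum_neg_distrib]
      refine Finset.sum_congr rfl fun y _ => ?_
      simp only [hf, Real.logb]
      rw [← inv_div (transProb W x y), Real.log_inv]
      field_simp
    rw [e, mul_neg, neg_le_neg_iff] at h1
    exact le_of_mul_le_mul_left h1 hlog
  obtain ⟨K, hK0, hK⟩ := exists_forall_le_of_finite
    fun x => ∑ y, transProb W x y * (f x y - m x) ^ 2
  -- The deviation `z` of `L` satisfies `z ≤ nε + z²/(4nε)`, and `z²` has mean at most `nK`; the `2`
  -- comes from rejection sampling.
  refine ⟨K / (4 * ε) + 2, fun n c hc => ?_⟩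
  rw [← add_assoc, ← add_assoc]
  have hQn : ∀ y, 0 < (prodDist Q n).1 y := fun y => by
    change 0 < ∏ i, Q.1 (y i)
    exact Finset.prod_pos fun i _ => hQ _
  refine optDiv_le hc (prodDist Q n)
    (fun x y => min (transProb (prodChannel W n) x y) (2 ^ c * (prodDist Q n).1 y))
    (fun x y => le_min (transProb_nonneg _ _ _) (mul_nonneg (by positivity) (hQn y).le))
    (fun x y => min_le_right _ _) (fun x => ?_) fun x => ?_
  · rw [← sum_transProb (prodChannel W n) x]
    exact Finset.sum_le_sum fun y _ => min_le_left _ _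
  refine le_fidelity_one_min (transProb_nonneg _ _) hQn ?_
  have hvar := sum_prod_mul_sub_sq_le (fun i => transProb W (x i)) (fun i => f (x i))
    (fun i => sum_transProb W _) fun i => hK (x i)
  have hmn : ∑ i, m (x i) ≤ n * t := by
    calc _ ≤ ∑ _i : Fin n, t := Finset.sum_le_sum fun i _ => hmt _
      _ = n * t := by simp
  -- The bound on `z` divides by `nε`, so the empty block is separate.
  rcases Nat.eq_zero_or_pos n with rfl | hn
  · have e : ∀ y, max (Real.logb 2 (transProb (prodChannel W 0) x y / (prodDist Q 0).1 y) - c) 0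
        = 0 := by
      intro y
      have : transProb (prodChannel W 0) x y / (prodDist Q 0).1 y = 1 := by
        simp [transProb_prodChannel, prodDist]
      rw [this, Real.logb_one]
      simpa using hc
    simp only [e, mul_zero, Finset.sum_const_zero]
    positivity
  have hn' : (0 : ℝ) < n := by exact_mod_cast hn
  calc ∑ y, transProb (prodChannel W n) x y *
        max (Real.logb 2 (transProb (prodChannel W n) x y / (prodDist Q n).1 y) - c) 0
      ≤ ∑ y, (transProb (prodChannel W n) x y * (max (n * t - c) 0 + n * ε) + 1 / (4 * (n * ε)) *
          ((∏ i, transProb W (x i) (y i)) * (∑ i, f (x i) (y i) - ∑ i, m (x i)) ^ 2)) := by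
        refine Finset.sum_le_sum fun y _ => ?_
        rw [mul_left_comm (1 / (4 * (n * ε))), ← transProb_prodChannel, ← mul_add]
        rcases (transProb_nonneg (prodChannel W n) x y).eq_or_lt with h0 | h0
        · simp [← h0]
        refine mul_le_mul_of_nonneg_left ?_ h0.le
        have e : Real.logb 2 (transProb (prodChannel W n) x y / (prodDist Q n).1 y) =
            ∑ i, f (x i) (y i) := by
          have hne : ∀ i, transProb W (x i) (y i) ≠ 0 := fun i hi => h0.ne' <| by
            rw [transProb_prodChannel]
            exact Finset.prod_eq_zero (Finset.mem_univ i) hi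
          rw [hf, ← Real.logb_prod _ _ fun i _ => div_ne_zero (hne i) (hQ _).ne',
            Finset.prod_div_distrib]
          rfl
        rw [e]
        set z := ∑ i, f (x i) (y i) - ∑ i, m (x i) with hz
        have hzε : z ≤ n * ε + 1 / (4 * (n * ε)) * z ^ 2 := by
          have hne : 0 < n * ε := by positivity
          have : n * ε + 1 / (4 * (n * ε)) * z ^ 2 - z = (z - 2 * (n * ε)) ^ 2 / (4 * (n * ε)) := by
            field_simp
            ring
          have h2 : 0 ≤ (z - 2 * (n * ε)) ^ 2 / (4 * (n * ε)) := by positivity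
          linarith
        have hpos : 0 ≤ n * ε + 1 / (4 * (n * ε)) * z ^ 2 := by positivity
        refine max_le ?_ ?_
        · have := le_max_left (n * t - c) 0
          linarith
        · have := le_max_right (n * t - c) 0
          linarith
    _ ≤ max (n * t - c) 0 + n * ε + 1 / (4 * (n * ε)) * (n * K) := by
        rw [Finset.sum_add_distrib, ← Finset.sum_mul, sum_transProb, one_mul, ← Finset.mul_sum]
        gcongr
    _ = max (n * t - c) 0 + n * ε + K / (4 * ε) := by
        field_simp

lemma exists_optDiv_prodChannel_le {α : ℝ≥0∞} (hα : α = 0 ∨ 1 ≤ α) (W : Channel X Y)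
    (Q : stdSimplex ℝ Y) (hQ : ∀ y, 0 < Q.1 y) {t : ℝ}
    (h : ∀ x, ENNReal.ofReal (2 ^ (-t)) ≤ fidelity α (transProb W x) Q.1) {ε : ℝ} (hε : 0 < ε) :
    ∃ C : ℝ, ∀ (n : ℕ) (c : ℝ), 0 ≤ c → optDiv α (prodChannel W n) c ≤
      ((max (n * t - c) 0 + (n * ε + C) : ℝ) : EReal) := by
  have weaken : ∀ C : ℝ, (∀ (n : ℕ) (c : ℝ), 0 ≤ c → optDiv α (prodChannel W n) c ≤
      ((max (n * t - c) 0 + C : ℝ) : EReal)) → ∀ (n : ℕ) (c : ℝ), 0 ≤ c →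
      optDiv α (prodChannel W n) c ≤ ((max (n * t - c) 0 + (n * ε + C) : ℝ) : EReal) := by
    intro C hC n c hc
    refine (hC n c hc).trans (EReal.coe_le_coe_iff.2 ?_)
    have : 0 ≤ n * ε := by positivity
    linarith
  rcases order_cases α with rfl | rfl | rfl | ⟨a, ha0, ha1, rfl⟩
  · exact ⟨2, weaken _ fun n c hc => optDiv_prodChannel_le_zero W Q h n hc⟩
  · exact optDiv_prodChannel_le_one W Q hQ h hε
  · exact ⟨2, weaken _ fun n c hc => optDiv_prodChannel_le_top W Q h n hc⟩
  · have h1 : 1 < a := by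
      refine lt_of_le_of_ne ?_ ha1.symm
      rcases hα with h' | h'
      · simp only [ENNReal.ofReal_eq_zero] at h'
        linarith
      · rwa [ENNReal.one_le_ofReal] at h'
    exact ⟨_, weaken _ fun n c hc => optDiv_prodChannel_le_of_one_lt h1 W Q hQ h n hc⟩

lemma exists_delta {η : ℝ} (hη : 0 < η) : ∃ δ : ℝ, 0 < δ ∧ δ < 1 ∧ (2 : ℝ) ^ (-η) < 1 - δ := by
  have h : (2 : ℝ) ^ (-η) < 1 := Real.rpow_lt_one_of_one_lt_of_neg one_lt_two (by linarith)
  have h' : (0 : ℝ) < 2 ^ (-η) := by positivity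
  exact ⟨(1 - 2 ^ (-η)) / 2, by linarith, by linarith, by linarith⟩

lemma strongConverseExponent_eq_max [Nonempty X] {α : ℝ≥0∞} (hα : α = 0 ∨ 1 ≤ α)
    (W : Channel X Y) {r : ℝ} (hr : 0 ≤ r) :
    strongConverseExponent α W r = max (renyiCapacity α W - (r : EReal)) 0 := by
  have hY : Nonempty Y := nonempty_of_stdSimplex (W (Classical.arbitrary X))
  obtain ⟨I, hI⟩ := exists_renyiCapacity_eq α W
  rw [hI]
  have hmax : max ((I : EReal) - (r : EReal)) 0 = ((max (I - r) 0 : ℝ) : EReal) := by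
    rw [EReal.coe_strictMono.monotone.map_max]
    rfl
  refine le_antisymm ?_ (max_le ?_ (strongConverseExponent_nonneg α W r))
  · rw [hmax]
    refine strongConverseExponent_le hr fun ε hε => ?_
    obtain ⟨δ, h0, h1, hδ⟩ := exists_delta (show 0 < ε / 3 by linarith)
    obtain ⟨Q, hQ, hF⟩ := exists_output_fidelity_ge hI.le h0 h1 hδ
    obtain ⟨C, hC⟩ := exists_optDiv_prodChannel_le hα W ⟨Q, hQ.1⟩ (lowerSimplex_pos h0 hQ) hF
      (show 0 < ε / 3 by linarith)
    obtain ⟨n₀, hn₀⟩ := exists_nat_ge (C / (ε / 3))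
    filter_upwards [Filter.eventually_ge_atTop n₀] with n hn
    refine (hC n (n * r) (by positivity)).trans (EReal.coe_le_coe_iff.2 ?_)
    have hCn : C ≤ n * (ε / 3) := by
      rw [← div_le_iff₀ (by linarith)]
      exact hn₀.trans (by exact_mod_cast hn)
    have hn0 : (0 : ℝ) ≤ n := n.cast_nonneg
    have h3 : max (n * (I + ε / 3) - n * r) 0 ≤ n * (max (I - r) 0 + ε / 3) := by
      refine max_le ?_ ?_
      · rw [← mul_sub]
        refine mul_le_mul_of_nonneg_left ?_ hn0
        linarith [le_max_left (I - r) 0]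
      · exact mul_nonneg hn0 (by linarith [le_max_right (I - r) 0])
    calc _ ≤ n * (max (I - r) 0 + ε / 3) + (n * (ε / 3) + n * (ε / 3)) := by gcongr
      _ = n * (max (I - r) 0 + ε) := by ring
  · refine le_of_forall_lt fun z hz => ?_
    obtain ⟨u, hu, huz⟩ := EReal.lt_iff_exists_real_btwn.1 hz
    refine hu.trans_le ?_
    have h1 : u < I - r := by exact_mod_cast huz
    have h2 := renyiCapacity_sub_le (α := α) (W := W) (r := r) (t := u + r) (by
      rw [hI]
      exact_mod_cast (by linarith))
    rwa [add_sub_cancel_right] at h2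

end Achievability

end RenyiSim

namespace RenyiSim

/-! ### The compact convex set of strategies `(V, Q)`. -/

section Strategies

variable {X Y : Type*} [Fintype Y]

/-- The strategies `(V, Q)` with `V` dominated by `W` and `Q` bounded below. -/
def strategySet (W : X → Y → ℝ) (δ : ℝ) : Set ((X → Y → ℝ) × (Y → ℝ)) :=
  {z | (∀ x, z.1 x ∈ stdSimplex ℝ Y) ∧ (∀ x y, W x y = 0 → z.1 x y = 0) ∧ z.2 ∈ lowerSimplex Y δ}

lemma convex_strategySet (W : X → Y → ℝ) (δ : ℝ) : Convex ℝ (strategySet W δ) := by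
  intro z hz z' hz' s t hs ht hst
  refine ⟨fun x => convex_stdSimplex ℝ Y (hz.1 x) (hz'.1 x) hs ht hst, fun x y hxy => ?_,
    convex_lowerSimplex δ hz.2.2 hz'.2.2 hs ht hst⟩
  simp [hz.2.1 x y hxy, hz'.2.1 x y hxy]

lemma isCompact_strategySet (W : X → Y → ℝ) (δ : ℝ) : IsCompact (strategySet W δ) := by
  have h1 : IsCompact ((Set.univ.pi fun _ : X => stdSimplex ℝ Y) ×ˢ lowerSimplex Y δ) :=
    (isCompact_univ_pi fun _ => isCompact_stdSimplex ℝ Y).prod (isCompact_lowerSimplex δ)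
  have h2 : IsClosed {z : (X → Y → ℝ) × (Y → ℝ) | ∀ x y, W x y = 0 → z.1 x y = 0} := by
    simp only [Set.ofPred_forall]
    refine isClosed_iInter fun x => isClosed_iInter fun y => isClosed_iInter fun _ => ?_
    exact isClosed_eq (by fun_prop) continuous_const
  convert h1.inter_right h2 using 1
  ext z
  simp only [strategySet, Set.mem_inter_iff, Set.mem_prod, Set.mem_univ_pi]
  exact ⟨fun h => ⟨⟨h.1, h.2.2⟩, h.2.1⟩, fun h => ⟨h.1.1, h.2, h.1.2⟩⟩

end Strategies

variable {X Y : Type*} [Fintype Y] [Fintype X]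

/-! ### Attainment of the maximum over the order `β`. -/

section Sibson

lemma renyiMutualInfo_eq_sibson {β : ℝ} (h0 : 0 < β) (h1 : β ≠ 1) (P : stdSimplex ℝ X)
    (W : Channel X Y) : renyiMutualInfo (ENNReal.ofReal β) (joint P W) =
      ((-(β / (1 - β) * Real.logb 2 (sibsonSum β P.1 W)) : ℝ) : EReal) := by
  have hS := sibsonSum_pos β P W
  have e : (2 : ℝ) ^ (-(-(β / (1 - β) * Real.logb 2 (sibsonSum β P.1 W)))) =
      sibsonSum β P.1 W ^ (β / (1 - β)) := by
    rw [neg_neg, mul_comm, Real.rpow_mul two_pos.le, Real.rpow_logb two_pos (by norm_num) hS]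
  rw [renyiMutualInfo_joint]
  refine le_antisymm ?_ (le_iInf fun Q => ?_)
  · obtain ⟨Q, hQ⟩ := exists_fidelity_joint_indep_eq h0 h1 P W
    refine (iInf_le _ Q).trans ?_
    rw [renyiDiv_le_iff, e, hQ]
  · rw [le_renyiDiv_iff, e]
    exact fidelity_joint_indep_le h0 h1 P W Q

lemma continuousOn_sibsonSum (W : Channel X Y) :
    ContinuousOn (fun z : ℝ × (X → ℝ) => sibsonSum z.1 z.2 W)
      (Set.Ioi 0 ×ˢ Set.univ) := by
  intro z hz
  have hz' : 0 < z.1 := hz.1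
  refine ContinuousAt.continuousWithinAt ?_
  simp only [sibsonSum]
  refine tendsto_finsetSum _ fun y _ => ?_
  have h1 : ContinuousAt (fun z : ℝ × (X → ℝ) => ∑ x, z.2 x * transProb W x y ^ z.1) z := by
    refine tendsto_finsetSum _ fun x _ => ?_
    refine ContinuousAt.mul (by fun_prop) ?_
    exact ContinuousAt.rpow continuousAt_const continuousAt_fst (Or.inr hz')
  exact ContinuousAt.rpow h1 (continuousAt_const.div continuousAt_fst hz'.ne')
    (Or.inr (one_div_pos.2 hz'))

/-- The exponent of the strong converse at the order `α < 1` is an attained maximum. -/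
lemma exists_max_exponent [Nonempty X] {α : ℝ} (h0 : 0 < α) (h1 : α < 1) (W : Channel X Y)
    (r : ℝ) : ∃ E : ℝ, 0 ≤ E ∧
      (∃ β ∈ Set.Icc α 1, ((α * (1 - β) / (β * (1 - α)) : ℝ) : EReal) *
        (renyiCapacity (ENNReal.ofReal β) W - (r : EReal)) = (E : EReal)) ∧
      ∀ β, α ≤ β → β < 1 → ∀ I : ℝ, renyiCapacity (ENNReal.ofReal β) W = (I : EReal) →
        α * (1 - β) / (β * (1 - α)) * (I - r) ≤ E := by
  classical
  have hY : Nonempty Y := nonempty_of_stdSimplex (W (Classical.arbitrary X))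
  set s : ℝ → ℝ := fun β => α * (1 - β) / (β * (1 - α)) with hs
  have hα : 0 < 1 - α := by linarith
  -- The prefactor times Sibson's `β/(1-β)` is the constant `α/(1-α)`. Multiplied out, the
  -- singularity at `β = 1` disappears, and `Φ` is continuous there with value `0`.
  set Φ : ℝ × (X → ℝ) → ℝ := fun z =>
    -(α / (1 - α) * Real.logb 2 (sibsonSum z.1 z.2 W)) - s z.1 * r with hΦ
  have hcont : ContinuousOn Φ (Set.Icc α 1 ×ˢ stdSimplex ℝ X) := by
    have hS : ContinuousOn (fun z : ℝ × (X → ℝ) => sibsonSum z.1 z.2 W)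
        (Set.Icc α 1 ×ˢ stdSimplex ℝ X) :=
      (continuousOn_sibsonSum W).mono
        (Set.prod_mono (fun β hβ => h0.trans_le hβ.1) (Set.subset_univ _))
    have hlog : ContinuousOn (fun z : ℝ × (X → ℝ) => Real.logb 2 (sibsonSum z.1 z.2 W))
        (Set.Icc α 1 ×ˢ stdSimplex ℝ X) :=
      (hS.log fun z hz => (sibsonSum_pos z.1 ⟨z.2, hz.2⟩ W).ne').div_const _
    refine (continuousOn_const.mul hlog).neg.sub (ContinuousOn.mul ?_ continuousOn_const)
    refine ContinuousOn.div (by fun_prop) (by fun_prop) fun z hz => ?_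
    exact (mul_pos (h0.trans_le hz.1.1) hα).ne'
  obtain ⟨P₀, hP₀⟩ : (stdSimplex ℝ X).Nonempty :=
    ⟨_, single_mem_stdSimplex ℝ (Classical.arbitrary X)⟩
  obtain ⟨⟨β, P⟩, ⟨hβ, hP⟩, hmax⟩ := (isCompact_Icc.prod (isCompact_stdSimplex ℝ X)).exists_isMaxOn
    ⟨(1, P₀), ⟨h1.le, le_rfl⟩, hP₀⟩ hcont
  have hval : ∀ γ, α ≤ γ → γ < 1 → ∀ P : X → ℝ,
      Φ (γ, P) = s γ * (-(γ / (1 - γ) * Real.logb 2 (sibsonSum γ P W)) - r) := by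
    intro γ hγ hγ1 P
    have h3 : 0 < γ := h0.trans_le hγ
    have h4 : 0 < 1 - γ := by linarith
    simp only [hΦ, hs]
    field_simp
  have hone : ∀ P ∈ stdSimplex ℝ X, Φ (1, P) = 0 := by
    intro P hP
    have : sibsonSum 1 P W = 1 := by
      simp only [sibsonSum, Real.rpow_one, div_one]
      rw [Finset.sum_comm]
      simp_rw [← Finset.mul_sum, sum_transProb, mul_one]
      exact hP.2
    simp [hΦ, hs, this]
  have hspos : ∀ γ, α ≤ γ → γ < 1 → 0 < s γ := fun γ hγ hγ1 =>
    div_pos (mul_pos h0 (by linarith)) (mul_pos (h0.trans_le hγ) hα)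
  have hupper : ∀ γ, α ≤ γ → γ < 1 → ∀ I : ℝ,
      renyiCapacity (ENNReal.ofReal γ) W = (I : EReal) → s γ * (I - r) ≤ Φ (β, P) := by
    intro γ hγ hγ1 I hI
    have hle : (I : EReal) ≤ ((Φ (β, P) / s γ + r : ℝ) : EReal) := by
      rw [← hI]
      refine iSup_le fun P' => ?_
      rw [renyiMutualInfo_eq_sibson (h0.trans_le hγ) hγ1.ne, EReal.coe_le_coe_iff,
        ← sub_le_iff_le_add, le_div_iff₀ (hspos γ hγ hγ1), mul_comm, ← hval γ hγ hγ1]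
      exact hmax (show (γ, P'.1) ∈ Set.Icc α 1 ×ˢ stdSimplex ℝ X from ⟨⟨hγ, hγ1.le⟩, P'.2⟩)
    have hle' : I ≤ Φ (β, P) / s γ + r := by exact_mod_cast hle
    rwa [← sub_le_iff_le_add, le_div_iff₀ (hspos γ hγ hγ1), mul_comm] at hle'
  refine ⟨Φ (β, P), ?_, ⟨β, hβ, ?_⟩, hupper⟩
  · rw [← hone P hP]
    exact hmax (show ((1 : ℝ), P) ∈ Set.Icc α 1 ×ˢ stdSimplex ℝ X from ⟨⟨h1.le, le_rfl⟩, hP⟩)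
  · obtain ⟨I, hI⟩ := exists_renyiCapacity_eq (ENNReal.ofReal β) W
    rw [hI]
    have hcoe : ((s β : ℝ) : EReal) * ((I : EReal) - (r : EReal)) =
        ((s β * (I - r) : ℝ) : EReal) := by
      push_cast
      rfl
    change ((s β : ℝ) : EReal) * ((I : EReal) - (r : EReal)) = _
    rw [hcoe, EReal.coe_eq_coe_iff]
    rcases hβ.2.eq_or_lt with hβ1 | hβ1
    · subst hβ1
      rw [hone P hP]
      simp [hs]
    · refine le_antisymm (hupper β hβ.1 hβ1 I hI) ?_
      rw [hval β hβ.1 hβ1]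
      refine mul_le_mul_of_nonneg_left (sub_le_sub_right ?_ r) (hspos β hβ.1 hβ1).le
      have h3 := le_iSup (fun P : stdSimplex ℝ X =>
        renyiMutualInfo (ENNReal.ofReal β) (joint P W)) ⟨P, hP⟩
      change _ ≤ renyiCapacity (ENNReal.ofReal β) W at h3
      rw [hI, renyiMutualInfo_eq_sibson (h0.trans_le hβ.1) hβ1.ne] at h3
      exact_mod_cast h3

end Sibson

/-! ### Relative entropy: convexity and the tilted distribution. -/

section RelativeEntropy

/-- Relative entropy in bits, with `0 log 0 = 0`; meaningful if `Q y = 0` implies `V y = 0`. -/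
noncomputable def relEnt (V Q : Y → ℝ) : ℝ :=
  ∑ y, (V y * Real.log (V y) - V y * Real.log (Q y)) / Real.log 2

lemma relEnt_eq {V Q : Y → ℝ} (h : ∀ y, Q y = 0 → V y = 0) :
    relEnt V Q = ∑ y, V y * Real.logb 2 (V y / Q y) := by
  refine Finset.sum_congr rfl fun y _ => ?_
  by_cases hV : V y = 0
  · simp [hV]
  · rw [Real.logb, Real.log_div hV fun h' => hV (h y h')]
    ring

lemma relEnt_self (V : Y → ℝ) : relEnt V V = 0 := by simp [relEnt]

/-- The left side is linear in `(v, w)` and supports `v log (v/w)` along the ray `v = k w`; joint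
convexity follows by using one `k` at both points. -/
lemma mul_log_tangent {v w k : ℝ} (hv : 0 ≤ v) (hw : 0 < w) (hk : 0 < k) :
    v * Real.log k + v - w * k ≤ v * Real.log v - v * Real.log w := by
  rcases hv.eq_or_lt with rfl | hv
  · simp [(mul_pos hw hk).le]
  have h := Real.log_le_sub_one_of_pos (div_pos (mul_pos hw hk) hv)
  rw [Real.log_div (mul_pos hw hk).ne' hv.ne', Real.log_mul hw.ne' hk.ne'] at h
  have h2 := mul_le_mul_of_nonneg_left h hv.le
  have h3 : v * (w * k / v - 1) = w * k - v := by field_simp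
  rw [h3] at h2
  linarith

/-- Joint convexity of `v log (v / w)`. -/
lemma mul_log_sub_mul_log_convex {v v' w w' s t : ℝ} (hv : 0 ≤ v) (hv' : 0 ≤ v') (hw : 0 < w)
    (hw' : 0 < w') (hs : 0 ≤ s) (ht : 0 ≤ t) (hst : s + t = 1) :
    (s * v + t * v') * Real.log (s * v + t * v') - (s * v + t * v') * Real.log (s * w + t * w') ≤
      s * (v * Real.log v - v * Real.log w) + t * (v' * Real.log v' - v' * Real.log w') := by
  have hW : 0 < s * w + t * w' := by
    rcases hs.eq_or_lt with rfl | hs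
    · have : t = 1 := by linarith
      simpa [this] using hw'
    · exact add_pos_of_pos_of_nonneg (mul_pos hs hw) (mul_nonneg ht hw'.le)
  rcases (add_nonneg (mul_nonneg hs hv) (mul_nonneg ht hv')).eq_or_lt with h0 | h0
  · have h1 : s * v = 0 := by
      have := mul_nonneg hs hv
      have := mul_nonneg ht hv'
      linarith
    have h2 : t * v' = 0 := by linarith
    rw [← h0, mul_sub, mul_sub, ← mul_assoc, ← mul_assoc, ← mul_assoc, ← mul_assoc, h1, h2]
    simp
  -- The slope for which the tangent bound is an equality at the mixture.
  set k := (s * v + t * v') / (s * w + t * w') with hk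
  have hkpos : 0 < k := div_pos h0 hW
  have e : (s * w + t * w') * k = s * v + t * v' := by
    rw [hk]
    field_simp
  have h1 := mul_le_mul_of_nonneg_left (mul_log_tangent hv hw hkpos) hs
  have h2 := mul_le_mul_of_nonneg_left (mul_log_tangent hv' hw' hkpos) ht
  have h3 : Real.log k = Real.log (s * v + t * v') - Real.log (s * w + t * w') :=
    Real.log_div h0.ne' hW.ne'
  rw [← mul_sub, ← h3]
  nlinarith

/-- For a fixed second argument the cross term is linear, so zeros are harmless; this matters
because the second argument will be `W x`. -/
lemma relEnt_convex_left {V V' : Y → ℝ} (Q : Y → ℝ) {s t : ℝ} (hV : ∀ y, 0 ≤ V y)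
    (hV' : ∀ y, 0 ≤ V' y) (hs : 0 ≤ s) (ht : 0 ≤ t) (hst : s + t = 1) :
    relEnt (s • V + t • V') Q ≤ s * relEnt V Q + t * relEnt V' Q := by
  simp only [relEnt]
  rw [Finset.mul_sum, Finset.mul_sum, ← Finset.sum_add_distrib]
  refine Finset.sum_le_sum fun y _ => ?_
  have h := Real.convexOn_mul_log.2 (hV y) (hV' y) hs ht hst
  simp only [smul_eq_mul] at h
  simp only [Pi.add_apply, Pi.smul_apply, smul_eq_mul]
  rw [mul_div_assoc', mul_div_assoc', ← add_div]
  have := Real.log_pos one_lt_two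
  gcongr
  linarith

lemma relEnt_convex {V V' Q Q' : Y → ℝ} {s t : ℝ} (hV : ∀ y, 0 ≤ V y)
    (hV' : ∀ y, 0 ≤ V' y) (hQ : ∀ y, 0 < Q y) (hQ' : ∀ y, 0 < Q' y)
    (hs : 0 ≤ s) (ht : 0 ≤ t) (hst : s + t = 1) :
    relEnt (s • V + t • V') (s • Q + t • Q') ≤ s * relEnt V Q + t * relEnt V' Q' := by
  simp only [relEnt]
  rw [Finset.mul_sum, Finset.mul_sum, ← Finset.sum_add_distrib]
  refine Finset.sum_le_sum fun y _ => ?_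
  simp only [Pi.add_apply, Pi.smul_apply, smul_eq_mul]
  rw [mul_div_assoc', mul_div_assoc', ← add_div]
  have := Real.log_pos one_lt_two
  gcongr
  exact mul_log_sub_mul_log_convex (hV y) (hV' y) (hQ y) (hQ' y) hs ht hst

/-- The tilted distribution attains the variational formula for the divergence of order `β`. -/
lemma exists_tilted {β : ℝ} (h0 : 0 < β) {P Q : Y → ℝ} (hP : ∀ y, 0 ≤ P y)
    (hQ : ∀ y, 0 < Q y) (hZ : 0 < ∑ y, P y ^ β * Q y ^ (1 - β)) :
    ∃ V ∈ stdSimplex ℝ Y, (∀ y, P y = 0 → V y = 0) ∧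
      β * relEnt V P + (1 - β) * relEnt V Q =
        -Real.logb 2 (∑ y, P y ^ β * Q y ^ (1 - β)) := by
  set Z := ∑ y, P y ^ β * Q y ^ (1 - β) with hZdef
  have hsum : ∑ y, P y ^ β * Q y ^ (1 - β) / Z = 1 := by
    rw [← Finset.sum_div, div_self hZ.ne']
  refine ⟨fun y => P y ^ β * Q y ^ (1 - β) / Z, ⟨fun y => ?_, hsum⟩, fun y hy => ?_, ?_⟩
  · exact div_nonneg (mul_nonneg (Real.rpow_nonneg (hP y) _) (Real.rpow_nonneg (hQ y).le _)) hZ.le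
  · simp [hy, h0.ne']
  · simp only [relEnt]
    have hlogZ : -Real.logb 2 Z = ∑ y, P y ^ β * Q y ^ (1 - β) / Z * -Real.logb 2 Z := by
      rw [← Finset.sum_mul, hsum, one_mul]
    rw [Finset.mul_sum, Finset.mul_sum, ← Finset.sum_add_distrib, hlogZ]
    refine Finset.sum_congr rfl fun y _ => ?_
    rcases (hP y).eq_or_lt with h | h
    · simp [← h, h0.ne']
    have e : Real.log (P y ^ β * Q y ^ (1 - β) / Z) =
        β * Real.log (P y) + (1 - β) * Real.log (Q y) - Real.log Z := by
      have h1 := Real.rpow_pos_of_pos h β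
      have h2 := Real.rpow_pos_of_pos (hQ y) (1 - β)
      rw [Real.log_div (mul_pos h1 h2).ne' hZ.ne', Real.log_mul h1.ne' h2.ne', Real.log_rpow h,
        Real.log_rpow (hQ y)]
    rw [e, Real.logb]
    ring

end RelativeEntropy

/-! ### The single-letter optimization below order `1`. -/

section SingleLetter

/-- The single-letter objective of a strategy `(V, Q)` for the input type `P`. -/
noncomputable def strategyCost (a r : ℝ) (W : X → Y → ℝ) (P : X → ℝ) (V : X → Y → ℝ) (Q : Y → ℝ) :
    ℝ :=
  a * ∑ x, P x * relEnt (V x) (W x) + max (∑ x, P x * relEnt (V x) Q - r) 0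

/-- The cost is the maximum of the convex functions `f` and `f + (g - r)`. Minimax provides a weight
`s` such that the optimal cost is at most `f + s (g - r)` at every strategy; the strategy tested is
the tilted one of the order `β` belonging to `s`. -/
lemma exists_strategy [Nonempty X] {α : ℝ} (h0 : 0 < α) (h1 : α < 1) (W : Channel X Y)
    {r E η δ : ℝ} (hE0 : 0 ≤ E)
    (hE : ∀ β, α ≤ β → β < 1 → ∀ I : ℝ, renyiCapacity (ENNReal.ofReal β) W = (I : EReal) →
        α * (1 - β) / (β * (1 - α)) * (I - r) ≤ E)
    (hη : 0 < η) (hδ0 : 0 < δ) (hδ1 : δ < 1) (hδ : (2 : ℝ) ^ (-η) < 1 - δ) (P : stdSimplex ℝ X) :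
    ∃ z ∈ strategySet (transProb W) δ,
      strategyCost (α / (1 - α)) r (transProb W) P.1 z.1 z.2 ≤ E + η := by
  classical
  have hY : Nonempty Y := nonempty_of_stdSimplex (W (Classical.arbitrary X))
  set a := α / (1 - α) with ha
  have hα : 0 < 1 - α := by linarith
  have ha0 : 0 < a := div_pos h0 hα
  set f : (X → Y → ℝ) × (Y → ℝ) → ℝ := fun z => a * ∑ x, P.1 x * relEnt (z.1 x) (transProb W x)
    with hf
  set g : (X → Y → ℝ) × (Y → ℝ) → ℝ := fun z => ∑ x, P.1 x * relEnt (z.1 x) z.2 with hg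
  have hfconv : ∀ z ∈ strategySet (transProb W) δ, ∀ z' ∈ strategySet (transProb W) δ,
      ∀ s t : ℝ, 0 ≤ s → 0 ≤ t → s + t = 1 → f (s • z + t • z') ≤ s * f z + t * f z' := by
    intro z hz z' hz' s t hs ht hst
    simp only [hf]
    rw [mul_left_comm s, mul_left_comm t, ← mul_add, Finset.mul_sum _ _ s, Finset.mul_sum _ _ t,
      ← Finset.sum_add_distrib]
    refine mul_le_mul_of_nonneg_left (Finset.sum_le_sum fun x _ => ?_) ha0.le
    rw [mul_left_comm s, mul_left_comm t, ← mul_add]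
    exact mul_le_mul_of_nonneg_left
      (relEnt_convex_left _ (hz.1 x).1 (hz'.1 x).1 hs ht hst) (P.2.1 x)
  have hgconv : ∀ z ∈ strategySet (transProb W) δ, ∀ z' ∈ strategySet (transProb W) δ,
      ∀ s t : ℝ, 0 ≤ s → 0 ≤ t → s + t = 1 → g (s • z + t • z') ≤ s * g z + t * g z' := by
    intro z hz z' hz' s t hs ht hst
    simp only [hg]
    rw [Finset.mul_sum, Finset.mul_sum, ← Finset.sum_add_distrib]
    refine Finset.sum_le_sum fun x _ => ?_
    rw [mul_left_comm s, mul_left_comm t, ← mul_add]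
    exact mul_le_mul_of_nonneg_left (relEnt_convex (hz.1 x).1 (hz'.1 x).1
      (lowerSimplex_pos hδ0 hz.2.2) (lowerSimplex_pos hδ0 hz'.2.2) hs ht hst) (P.2.1 x)
  have hvlog : ∀ x y, Continuous fun z : (X → Y → ℝ) × (Y → ℝ) =>
      z.1 x y * Real.log (z.1 x y) := fun x y =>
    Real.continuous_mul_log.comp (by fun_prop)
  have hfc : ContinuousOn f (strategySet (transProb W) δ) := by
    refine Continuous.continuousOn ?_
    refine continuous_const.mul (continuous_finsetSum _ fun x _ => continuous_const.mul ?_)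
    refine continuous_finsetSum _ fun y _ => ((hvlog x y).sub ?_).div_const _
    fun_prop
  have hgc : ContinuousOn g (strategySet (transProb W) δ) := by
    refine continuousOn_finsetSum _ fun x _ => continuousOn_const.mul ?_
    refine continuousOn_finsetSum _ fun y _ => ((hvlog x y).continuousOn.sub ?_).div_const _
    refine ContinuousOn.mul (Continuous.continuousOn (by fun_prop)) ?_
    exact ContinuousOn.log (Continuous.continuousOn (by fun_prop))
      fun z hz => (lowerSimplex_pos hδ0 hz.2.2 y).ne'
  obtain ⟨Q₀, hQ₀⟩ := lowerSimplex_nonempty (Y := Y) hδ0.le hδ1.le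
  have hWmem : ((transProb W, Q₀) : (X → Y → ℝ) × (Y → ℝ)) ∈ strategySet (transProb W) δ :=
    ⟨fun x => (W x).2, fun x y h => h, hQ₀⟩
  obtain ⟨z, hz, p, hp⟩ := exists_minimax (ι := Bool) ⟨_, hWmem⟩
    (convex_strategySet (transProb W) δ) (isCompact_strategySet (transProb W) δ)
    (fun i z => if i then f z + (g z - r) else f z)
    (by
      intro i
      refine ⟨convex_strategySet _ δ, fun z hz z' hz' s t hs ht hst => ?_⟩
      have h3 := hfconv z hz z' hz' s t hs ht hst
      have h4 := hgconv z hz z' hz' s t hs ht hst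
      cases i
      · simpa using h3
      · simp only [if_true, smul_eq_mul]
        have h5 : s * (f z + (g z - r)) + t * (f z' + (g z' - r)) =
            s * f z + t * f z' + (s * g z + t * g z') - (s + t) * r := by ring
        rw [h5, hst]
        linarith)
    (by
      intro i
      cases i
      · simpa using hfc
      · simp only [if_true]
        exact hfc.add (hgc.sub continuousOn_const))
  refine ⟨z, hz, ?_⟩
  set s := p.1 true with hs
  have hs0 : 0 ≤ s := p.2.1 true
  have hp1 : p.1 true + p.1 false = 1 := by
    have := p.2.2
    simpa using this
  have hs1 : s ≤ 1 := by linarith [p.2.1 false]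
  have hbound : ∀ z' ∈ strategySet (transProb W) δ,
      strategyCost a r (transProb W) P.1 z.1 z.2 ≤ f z' + s * (g z' - r) := by
    intro z' hz'
    have hsum : ∑ j, p.1 j * (if j then f z' + (g z' - r) else f z') =
        f z' + s * (g z' - r) := by
      have h6 : p.1 false = 1 - s := by linarith
      rw [Fintype.sum_bool, h6]
      simp only [if_true, Bool.false_eq_true, if_false]
      rw [← hs]
      ring
    have h3 := hp true z' hz'
    have h4 := hp false z' hz'
    rw [hsum] at h3 h4
    simp only [if_true, Bool.false_eq_true, if_false] at h3 h4
    change f z + max (g z - r) 0 ≤ _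
    rcases max_cases (g z - r) 0 with ⟨h5, -⟩ | ⟨h5, -⟩ <;> rw [h5] <;> linarith
  -- Weight `0` corresponds to `β = 1`: there `V = W` costs nothing and `E ≥ 0` suffices.
  rcases hs0.eq_or_lt with hs0 | hs0
  · refine (hbound _ hWmem).trans ?_
    rw [← hs0, zero_mul, add_zero]
    simp only [hf, relEnt_self, mul_zero, Finset.sum_const_zero]
    linarith
  -- The solution of `α(1-β)/(β(1-α)) = s`.
  set β := α / (α + s * (1 - α)) with hβ
  have hden : 0 < α + s * (1 - α) := by positivity
  have hβ0 : 0 < β := div_pos h0 hden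
  have hαβ : α ≤ β := by
    rw [hβ, le_div_iff₀ hden]
    exact mul_le_of_le_one_right h0.le (by nlinarith)
  have hβ1 : β < 1 := by
    rw [hβ, div_lt_one hden]
    nlinarith
  have hsβ : α * (1 - β) / (β * (1 - α)) = s := by
    rw [hβ]
    field_simp
    ring
  obtain ⟨I, hI⟩ := exists_renyiCapacity_eq (ENNReal.ofReal β) W
  obtain ⟨Q, hQ, hF⟩ := exists_output_fidelity_ge hI.le hδ0 hδ1 hδ
  have hQpos := lowerSimplex_pos hδ0 hQ
  have hZ : ∀ x, 2 ^ (-((1 - β) * (I + η))) ≤ ∑ y, transProb W x y ^ β * Q y ^ (1 - β) :=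
    fun x => (le_fidelity_iff_of_lt_one hβ0 hβ1 (transProb_nonneg W x) hQ.1.1).1 (hF x)
  have hZpos : ∀ x, 0 < ∑ y, transProb W x y ^ β * Q y ^ (1 - β) := fun x =>
    lt_of_lt_of_le (by positivity) (hZ x)
  choose V hV hVW hVeq using fun x => exists_tilted hβ0 (transProb_nonneg W x) hQpos (hZpos x)
  refine (hbound (V, Q) ⟨hV, hVW, hQ⟩).trans ?_
  have hb : 0 < 1 - β := by linarith
  have hle : ∀ x, a * relEnt (V x) (transProb W x) + s * relEnt (V x) Q ≤ s * (I + η) := by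
    intro x
    have h3 : -Real.logb 2 (∑ y, transProb W x y ^ β * Q y ^ (1 - β)) ≤ (1 - β) * (I + η) := by
      rw [neg_le, Real.le_logb_iff_rpow_le one_lt_two (hZpos x)]
      exact hZ x
    rw [← hVeq x] at h3
    have h4 := mul_le_mul_of_nonneg_left h3 (div_pos ha0 hβ0).le
    -- Scaling the variational formula by `a/β` gives the weights `a` and `s` of the objective.
    have h5 : s = a / β * (1 - β) := by
      rw [← hsβ, ha]
      field_simp
    have h6 : a / β * (β * relEnt (V x) (transProb W x) + (1 - β) * relEnt (V x) Q) =
        a * relEnt (V x) (transProb W x) + s * relEnt (V x) Q := by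
      rw [h5]
      field_simp
    rw [h6, ← mul_assoc, ← h5] at h4
    exact h4
  calc f (V, Q) + s * (g (V, Q) - r)
      = ∑ x, P.1 x * (a * relEnt (V x) (transProb W x) + s * relEnt (V x) Q) - s * r := by
        simp only [hf, hg]
        rw [mul_sub, Finset.mul_sum, Finset.mul_sum, ← add_sub_assoc, ← Finset.sum_add_distrib]
        congr 1
        exact Finset.sum_congr rfl fun x _ => by ring
    _ ≤ ∑ x, P.1 x * (s * (I + η)) - s * r := by
        gcongr with x
        · exact P.2.1 x
        · exact hle x
    _ = s * (I - r) + s * η := by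
        rw [← Finset.sum_mul, P.2.2]
        ring
    _ ≤ E + η := by
        have h3 := hE β hαβ hβ1 I hI
        rw [hsβ] at h3
        nlinarith

/-- Finitely many strategies serve all input types. -/
lemma exists_finite_strategies [Nonempty X] {α : ℝ} (h0 : 0 < α) (h1 : α < 1) (W : Channel X Y)
    {r E η δ : ℝ} (hE0 : 0 ≤ E)
    (hE : ∀ β, α ≤ β → β < 1 → ∀ I : ℝ, renyiCapacity (ENNReal.ofReal β) W = (I : EReal) →
        α * (1 - β) / (β * (1 - α)) * (I - r) ≤ E)
    (hη : 0 < η) (hδ0 : 0 < δ) (hδ1 : δ < 1) (hδ : (2 : ℝ) ^ (-η) < 1 - δ) :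
    ∃ S : Finset ((X → Y → ℝ) × (Y → ℝ)), (∀ z ∈ S, z ∈ strategySet (transProb W) δ) ∧
      ∀ P : stdSimplex ℝ X, ∃ z ∈ S,
        strategyCost (α / (1 - α)) r (transProb W) P.1 z.1 z.2 ≤ E + 2 * η := by
  classical
  choose z hz hzE using exists_strategy h0 h1 W hE0 hE hη hδ0 hδ1 hδ
  -- A fixed strategy has cost continuous in the type, so with one more `η` it serves a whole
  -- neighbourhood.
  have hopen : ∀ P, IsOpen {P' : X → ℝ |
      strategyCost (α / (1 - α)) r (transProb W) P' (z P).1 (z P).2 < E + 2 * η} := fun P =>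
    isOpen_lt (by unfold strategyCost; fun_prop) continuous_const
  obtain ⟨t, ht⟩ := (isCompact_stdSimplex ℝ X).elim_finite_subcover _ hopen fun P hP =>
    Set.mem_iUnion.2 ⟨⟨P, hP⟩, lt_of_le_of_lt (hzE ⟨P, hP⟩) (by linarith)⟩
  refine ⟨t.image z, fun w hw => ?_, fun P => ?_⟩
  · obtain ⟨P, -, rfl⟩ := Finset.mem_image.1 hw
    exact hz P
  · obtain ⟨P', hP', hlt⟩ := Set.mem_iUnion₂.1 (ht P.2)
    exact ⟨z P', Finset.mem_image_of_mem z hP', le_of_lt hlt⟩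

end SingleLetter

end RenyiSim

namespace RenyiSim

/-! ### Typical sets and Chebyshev's inequality. -/

section Typical

/-- On `S` one has `P^α ≥ 2^(-bα) V^α`, so the sum is at least `2^(-u(1-α) - bα)` times the mass of
`S`. The outer power `1/(1-α)` turns the mass `1/2` into the term `1/(1-α)`. -/
lemma le_fidelity_of_typical {A : Type*} [Fintype A] {α b u : ℝ} (h0 : 0 < α) (h1 : α < 1)
    {P V : A → ℝ} (hP : ∀ a, 0 ≤ P a) (hV : ∀ a, 0 ≤ V a) (S : Set A) [DecidablePred (· ∈ S)]
    (hS : ∀ a ∈ S, V a ≤ 2 ^ b * P a) (hmass : 1 / 2 ≤ ∑ a, if a ∈ S then V a else 0) :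
    ENNReal.ofReal (2 ^ (-(u + α / (1 - α) * b + 1 / (1 - α)))) ≤
      fidelity (ENNReal.ofReal α) P fun a => 2 ^ (-u) * if a ∈ S then V a else 0 := by
  have hα : 0 < 1 - α := by linarith
  have hite : ∀ a, 0 ≤ if a ∈ S then V a else 0 := fun a => by
    split_ifs
    exacts [hV a, le_rfl]
  rw [le_fidelity_iff_of_lt_one h0 h1 hP fun a => mul_nonneg (by positivity) (hite a)]
  calc (2 : ℝ) ^ (-((1 - α) * (u + α / (1 - α) * b + 1 / (1 - α))))
      = 2 ^ (-u * (1 - α)) * 2 ^ (-b * α) * (1 / 2) := by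
        rw [← Real.rpow_neg_one 2 |>.trans (one_div (2 : ℝ)).symm, ← Real.rpow_add two_pos,
          ← Real.rpow_add two_pos]
        congr 1
        field_simp
        ring
    _ ≤ 2 ^ (-u * (1 - α)) * 2 ^ (-b * α) * ∑ a, if a ∈ S then V a else 0 := by gcongr
    _ ≤ ∑ a, P a ^ α * (2 ^ (-u) * if a ∈ S then V a else 0) ^ (1 - α) := by
        rw [Finset.mul_sum]
        refine Finset.sum_le_sum fun a _ => ?_
        by_cases ha : a ∈ S
        · simp only [ha, if_true]
          rw [Real.mul_rpow (by positivity) (hV a), ← Real.rpow_mul two_pos.le, mul_assoc,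
            mul_left_comm (P a ^ α)]
          refine mul_le_mul_of_nonneg_left ?_ (by positivity)
          rcases (hV a).eq_or_lt with hv | hv
          · rw [← hv, mul_zero]
            exact mul_nonneg (Real.rpow_nonneg (hP a) _) (Real.rpow_nonneg le_rfl _)
          have h3 : 2 ^ (-b) * V a ≤ P a := by
            rw [Real.rpow_neg two_pos.le, inv_mul_le_iff₀ (by positivity)]
            exact hS a ha
          calc 2 ^ (-b * α) * V a = (2 ^ (-b) * V a) ^ α * V a ^ (1 - α) := by
                rw [Real.mul_rpow (by positivity) hv.le, ← Real.rpow_mul two_pos.le, mul_assoc,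
                  ← Real.rpow_add hv, add_sub_cancel, Real.rpow_one]
            _ ≤ P a ^ α * V a ^ (1 - α) := by
                gcongr
        · simp only [ha, if_false, mul_zero]
          exact mul_nonneg (Real.rpow_nonneg (hP a) _) (Real.rpow_nonneg le_rfl _)

/-- Chebyshev's inequality for sums of functions of independent letters. -/
lemma sum_ite_exceeds_le {Z : Type*} [Fintype Z] {n : ℕ} (hn : 0 < n) (p f : Fin n → Z → ℝ)
    (hp0 : ∀ i z, 0 ≤ p i z) (hp : ∀ i, ∑ z, p i z = 1) {K ε : ℝ} (hε : 0 < ε)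
    (hK : ∀ i, ∑ z, p i z * (f i z - ∑ z, p i z * f i z) ^ 2 ≤ K) :
    (∑ z : Fin n → Z, if (∑ i, ∑ z, p i z * f i z) + n * ε < ∑ i, f i (z i) then
      ∏ i, p i (z i) else 0) ≤ K / (n * ε ^ 2) := by
  have hn' : (0 : ℝ) < n := by exact_mod_cast hn
  have h := sum_prod_mul_sub_sq_le p f hp hK
  set m := ∑ i, ∑ z, p i z * f i z with hm
  rw [le_div_iff₀ (by positivity), Finset.sum_mul]
  have hle : ∑ z : Fin n → Z, (if m + n * ε < ∑ i, f i (z i) then ∏ i, p i (z i) else 0) *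
      (n * ε ^ 2) ≤ ∑ z : Fin n → Z, 1 / n *
        ((∏ i, p i (z i)) * (∑ i, f i (z i) - m) ^ 2) := by
    refine Finset.sum_le_sum fun z _ => ?_
    have hpz : 0 ≤ ∏ i, p i (z i) := Finset.prod_nonneg fun i _ => hp0 i _
    split_ifs with hlt
    · have h2 : (n * ε) ^ 2 ≤ (∑ i, f i (z i) - m) ^ 2 := by
        apply pow_le_pow_left₀ (by positivity)
        linarith
      calc (∏ i, p i (z i)) * (n * ε ^ 2) = 1 / n * ((∏ i, p i (z i)) * (n * ε) ^ 2) := by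
            field_simp
        _ ≤ _ := by gcongr
    · rw [zero_mul]
      positivity
  refine hle.trans ?_
  rw [← Finset.mul_sum]
  calc 1 / n * _ ≤ 1 / n * (n * K) := mul_le_mul_of_nonneg_left h (by positivity)
    _ = K := by field_simp

end Typical

variable {X Y : Type*} [Fintype Y] [Fintype X]

/-! ### Empirical types of input sequences. -/

section Types

/-- The empirical distribution of a sequence. -/
lemma exists_type {n : ℕ} (hn : 0 < n) (x : Fin n → X) :
    ∃ P : stdSimplex ℝ X, ∀ f : X → ℝ, ∑ i, f (x i) = n * ∑ a, P.1 a * f a := by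
  classical
  have hn' : (0 : ℝ) < n := by exact_mod_cast hn
  have key : ∀ f : X → ℝ, ∑ i, f (x i) =
      ∑ a, ((Finset.univ.filter fun i => x i = a).card : ℝ) * f a := by
    intro f
    rw [← Finset.sum_fiberwise Finset.univ x]
    refine Finset.sum_congr rfl fun a _ => ?_
    rw [Finset.sum_congr rfl (g := fun _ => f a) fun i hi => by rw [(Finset.mem_filter.1 hi).2]]
    simp
  refine ⟨⟨fun a => ((Finset.univ.filter fun i => x i = a).card : ℝ) / n,
    fun a => by positivity, ?_⟩, fun f => ?_⟩
  · have h := key fun _ => 1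
    simp only [Finset.sum_const, Finset.card_univ, Fintype.card_fin, nsmul_eq_mul, mul_one] at h
    rw [← Finset.sum_div, ← h, div_self hn'.ne']
  · rw [key, Finset.mul_sum]
    refine Finset.sum_congr rfl fun a _ => ?_
    field_simp

end Types

/-! ### Block achievability below order `1`, and the matching converse. -/

section NFold

lemma prod_le_rpow_mul_prod {n : ℕ} {v w : Fin n → ℝ} {b : ℝ} (hv : ∀ i, 0 ≤ v i)
    (hw : ∀ i, 0 ≤ w i) (hvw : ∀ i, w i = 0 → v i = 0)
    (h : ∑ i, Real.logb 2 (v i / w i) ≤ b) : ∏ i, v i ≤ 2 ^ b * ∏ i, w i := by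
  by_cases h0 : ∃ i, v i = 0
  · obtain ⟨i, hi⟩ := h0
    rw [Finset.prod_eq_zero (Finset.mem_univ i) hi]
    exact mul_nonneg (by positivity) (Finset.prod_nonneg fun i _ => hw i)
  push Not at h0
  have hv' : ∀ i, 0 < v i := fun i => lt_of_le_of_ne (hv i) (h0 i).symm
  have hw' : ∀ i, 0 < w i := fun i => lt_of_le_of_ne (hw i) fun h' => h0 i (hvw i h'.symm)
  have hwp : 0 < ∏ i, w i := Finset.prod_pos fun i _ => hw' i
  rw [← Real.logb_prod _ _ fun i _ => (div_pos (hv' i) (hw' i)).ne', Finset.prod_div_distrib,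
    Real.logb_le_iff_le_rpow one_lt_two (div_pos (Finset.prod_pos fun i _ => hv' i) hwp),
    div_le_iff₀ hwp] at h
  exact h

/-- The typical set of a strategy carries at least half of the mass for long sequences. -/
lemma exists_typical (W V : X → Y → ℝ) (Q : Y → ℝ) (hW : ∀ x y, 0 ≤ W x y)
    (hV : ∀ x, V x ∈ stdSimplex ℝ Y) (hVW : ∀ x y, W x y = 0 → V x y = 0) (hQ : ∀ y, 0 < Q y)
    {ε : ℝ} (hε : 0 < ε) :
    ∃ n₀ : ℕ, ∀ n, n₀ ≤ n → 0 < n → ∀ x : Fin n → X, ∃ S : Set (Fin n → Y),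
      (∀ y ∈ S, ∏ i, V (x i) (y i) ≤
        2 ^ ((∑ i, relEnt (V (x i)) (W (x i))) + n * ε) * ∏ i, W (x i) (y i)) ∧
      (∀ y ∈ S, ∏ i, V (x i) (y i) ≤
        2 ^ ((∑ i, relEnt (V (x i)) Q) + n * ε) * ∏ i, Q (y i)) ∧
      ∀ [DecidablePred (· ∈ S)], 1 / 2 ≤ ∑ y, if y ∈ S then ∏ i, V (x i) (y i) else 0 := by
  classical
  set f : X → Y → ℝ := fun x y => Real.logb 2 (V x y / W x y) with hf
  set g : X → Y → ℝ := fun x y => Real.logb 2 (V x y / Q y) with hg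
  have hfm : ∀ x, relEnt (V x) (W x) = ∑ y, V x y * f x y := fun x => relEnt_eq (hVW x)
  have hgm : ∀ x, relEnt (V x) Q = ∑ y, V x y * g x y := fun x =>
    relEnt_eq fun y h => absurd h (hQ y).ne'
  obtain ⟨K, hK0, hK⟩ := exists_forall_le_of_finite
    fun x => ∑ y, V x y * (f x y - ∑ y, V x y * f x y) ^ 2
  obtain ⟨L, hL0, hL⟩ := exists_forall_le_of_finite
    fun x => ∑ y, V x y * (g x y - ∑ y, V x y * g x y) ^ 2
  -- From here on the two Chebyshev failure probabilities add up to at most `1/2`; the variance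
  -- bounds are uniform in the input sequence.
  obtain ⟨n₀, hn₀⟩ := exists_nat_ge (2 * (K + L) / ε ^ 2)
  refine ⟨n₀, fun n hnn hn x => ⟨{y |
    ∑ i, f (x i) (y i) ≤ (∑ i, relEnt (V (x i)) (W (x i))) + n * ε ∧
    ∑ i, g (x i) (y i) ≤ (∑ i, relEnt (V (x i)) Q) + n * ε}, ?_, ?_, ?_⟩⟩
  · exact fun y hy => prod_le_rpow_mul_prod (fun i => (hV _).1 _) (fun i => hW _ _)
      (fun i => hVW _ _) hy.1
  · exact fun y hy => prod_le_rpow_mul_prod (fun i => (hV _).1 _) (fun i => (hQ _).le)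
      (fun i h => absurd h (hQ _).ne') hy.2
  · intro _
    have hn' : (0 : ℝ) < n := by exact_mod_cast hn
    have h1 := sum_ite_exceeds_le hn (fun i => V (x i)) (fun i => f (x i)) (fun i => (hV _).1)
      (fun i => (hV _).2) hε fun i => hK (x i)
    have h2 := sum_ite_exceeds_le hn (fun i => V (x i)) (fun i => g (x i)) (fun i => (hV _).1)
      (fun i => (hV _).2) hε fun i => hL (x i)
    have h3 := sum_prod_eq_one (fun i => V (x i)) fun i => (hV _).2
    have h4 : K / (n * ε ^ 2) + L / (n * ε ^ 2) ≤ 1 / 2 := by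
      have h5 : 2 * (K + L) ≤ n * ε ^ 2 := by
        rw [← div_le_iff₀ (by positivity)]
        exact hn₀.trans (by exact_mod_cast hnn)
      rw [← add_div, div_le_div_iff₀ (by positivity) two_pos]
      linarith
    have h5 : ∑ y : Fin n → Y, ∏ i, V (x i) (y i) ≤
        (∑ y : Fin n → Y, if (∑ i, ∑ z, V (x i) z * f (x i) z) + n * ε < ∑ i, f (x i) (y i) then
          ∏ i, V (x i) (y i) else 0) +
        (∑ y : Fin n → Y, if (∑ i, ∑ z, V (x i) z * g (x i) z) + n * ε < ∑ i, g (x i) (y i) then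
          ∏ i, V (x i) (y i) else 0) +
        ∑ y : Fin n → Y, if y ∈ {y : Fin n → Y |
          ∑ i, f (x i) (y i) ≤ (∑ i, relEnt (V (x i)) (W (x i))) + n * ε ∧
          ∑ i, g (x i) (y i) ≤ (∑ i, relEnt (V (x i)) Q) + n * ε} then
          ∏ i, V (x i) (y i) else 0 := by
      rw [← Finset.sum_add_distrib, ← Finset.sum_add_distrib]
      refine Finset.sum_le_sum fun y _ => ?_
      have hpos : 0 ≤ ∏ i, V (x i) (y i) := Finset.prod_nonneg fun i _ => (hV _).1 _
      simp only [Set.mem_ofPred_eq, hfm, hgm]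
      split_ifs with c1 c2 c3 c3 c2 c3 c3
      all_goals first
        | linarith
        | exact absurd ⟨not_lt.1 c1, not_lt.1 c2⟩ c3
    linarith

/-- For each input sequence, `ν` is the channel `V` of the strategy for its type, restricted to the
typical set and scaled by `2^(-u)`. Finiteness of `S` gives a common `n₀` and a common output law.
-/
lemma optDiv_prodChannel_le_of_lt_one [Nonempty X] {α : ℝ} (h0 : 0 < α) (h1 : α < 1)
    (W : Channel X Y) {r E δ : ℝ} (hr : 0 ≤ r) (hδ : 0 < δ)
    (S : Finset ((X → Y → ℝ) × (Y → ℝ)))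
    (hS : ∀ z ∈ S, z ∈ strategySet (transProb W) δ)
    (hE : ∀ P : stdSimplex ℝ X, ∃ z ∈ S,
        strategyCost (α / (1 - α)) r (transProb W) P.1 z.1 z.2 ≤ E) {ε : ℝ} (hε : 0 < ε) :
    ∃ C : ℝ, ∀ᶠ n : ℕ in Filter.atTop, optDiv (ENNReal.ofReal α) (prodChannel W n) (n * r) ≤
      ((n * (E + ε) + C : ℝ) : EReal) := by
  classical
  have hY : Nonempty Y := nonempty_of_stdSimplex (W (Classical.arbitrary X))
  set a := α / (1 - α) with ha
  have hα : 0 < 1 - α := by linarith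
  have ha0 : 0 < a := div_pos h0 hα
  have hSne : S.Nonempty := by
    obtain ⟨z, hz, -⟩ := hE ⟨_, single_mem_stdSimplex ℝ (Classical.arbitrary X)⟩
    exact ⟨z, hz⟩
  have hcard : (1 : ℝ) ≤ S.card := by exact_mod_cast hSne.card_pos
  have hcard0 : (0 : ℝ) < S.card := by linarith
  set ε' := ε / (1 + a) with hε'
  have hε'0 : 0 < ε' := by positivity
  have htyp := fun z : S => exists_typical (transProb W) z.1.1 z.1.2 (transProb_nonneg W)
    (hS z.1 z.2).1 (hS z.1 z.2).2.1 (lowerSimplex_pos hδ (hS z.1 z.2).2.2) hε'0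
  choose n₀ hn₀ using htyp
  set ℓ := Real.logb 2 S.card with hℓ
  have hℓ0 : 0 ≤ ℓ := Real.logb_nonneg one_lt_two hcard
  refine ⟨ℓ + 1 / (1 - α) + 2, ?_⟩
  filter_upwards [Filter.eventually_ge_atTop (Finset.univ.sup n₀), Filter.eventually_gt_atTop 0]
    with n hn hn0
  have hn0' : (0 : ℝ) < n := by exact_mod_cast hn0
  have hx : ∀ x : Fin n → X, ∃ z ∈ S, ∃ T : Set (Fin n → Y),
      (∀ y ∈ T, ∏ i, z.1 (x i) (y i) ≤
        2 ^ ((∑ i, relEnt (z.1 (x i)) (transProb W (x i))) + n * ε') *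
          ∏ i, transProb W (x i) (y i)) ∧
      (∀ y ∈ T, ∏ i, z.1 (x i) (y i) ≤
        2 ^ ((∑ i, relEnt (z.1 (x i)) z.2) + n * ε') * ∏ i, z.2 (y i)) ∧
      (1 / 2 ≤ ∑ y, if y ∈ T then ∏ i, z.1 (x i) (y i) else 0) ∧
      a * (∑ i, relEnt (z.1 (x i)) (transProb W (x i))) +
        max (∑ i, relEnt (z.1 (x i)) z.2 - n * r) 0 ≤ n * E := by
    intro x
    obtain ⟨P, hP⟩ := exists_type hn0 x
    obtain ⟨z, hz, hzE⟩ := hE P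
    obtain ⟨T, hT1, hT2, hT3⟩ := hn₀ ⟨z, hz⟩ n
      ((Finset.le_sup (Finset.mem_univ _)).trans hn) hn0 x
    refine ⟨z, hz, T, hT1, hT2, hT3, ?_⟩
    rw [hP fun b => relEnt (z.1 b) (transProb W b), hP fun b => relEnt (z.1 b) z.2, ← mul_sub]
    have h3 : max (n * (∑ b, P.1 b * relEnt (z.1 b) z.2 - r)) 0 =
        n * max (∑ b, P.1 b * relEnt (z.1 b) z.2 - r) 0 := by
      rw [mul_max_of_nonneg _ _ hn0'.le, mul_zero]
    rw [h3, mul_left_comm, ← mul_add]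
    exact mul_le_mul_of_nonneg_left hzE hn0'.le
  choose z hzS T hT1 hT2 hT3 hcost using hx
  have hV0 : ∀ x b y, 0 ≤ (z x).1 b y := fun x b => ((hS _ (hzS x)).1 b).1
  have hV1 : ∀ x b, ∑ y, (z x).1 b y = 1 := fun x b => ((hS _ (hzS x)).1 b).2
  have hQpos : ∀ w ∈ S, ∀ y, 0 < w.2 y := fun w hw => lowerSimplex_pos hδ (hS w hw).2.2
  -- One output law must serve all inputs: the average of the product laws dominates each of them up
  -- to `|S| = 2^ℓ`.
  let Q : stdSimplex ℝ (Fin n → Y) := ⟨fun y => (∑ w ∈ S, ∏ i, w.2 (y i)) / S.card,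
    fun y => div_nonneg (Finset.sum_nonneg fun w hw => Finset.prod_nonneg fun i _ =>
      (hQpos w hw _).le) hcard0.le, by
    rw [← Finset.sum_div, Finset.sum_comm, Finset.sum_congr rfl (g := fun _ => (1 : ℝ))
      fun w hw => sum_prod_eq_one (fun _ => w.2) fun _ => (hS w hw).2.2.1.2]
    simp [hcard0.ne']⟩
  -- The number of bits by which the typical part of `V` may exceed `2^(nr) Q`, truncated at zero so
  -- that the mass stays at most one.
  set u : (Fin n → X) → ℝ := fun x =>
    max ((∑ i, relEnt ((z x).1 (x i)) (z x).2) + n * ε' - n * r + ℓ) 0 with hu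
  set v : (Fin n → X) → (Fin n → Y) → ℝ := fun x y => ∏ i, (z x).1 (x i) (y i) with hv
  have hv0 : ∀ x y, 0 ≤ v x y := fun x y => Finset.prod_nonneg fun i _ => hV0 _ _ _
  have hite : ∀ x y, 0 ≤ if y ∈ T x then v x y else 0 := fun x y => by
    split_ifs
    exacts [hv0 x y, le_rfl]
  refine (optDiv_le (t := n * (E + ε) + ℓ + 1 / (1 - α)) (by positivity) Q
    (fun x y => 2 ^ (-u x) * if y ∈ T x then v x y else 0)
    (fun x y => mul_nonneg (by positivity) (hite x y)) (fun x y => ?_) (fun x => ?_)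
    fun x => ?_).trans_eq (by congr 1; ring)
  · split_ifs with hy
    swap
    · rw [mul_zero]
      exact mul_nonneg (by positivity) (Q.2.1 y)
    calc 2 ^ (-u x) * v x y
        ≤ 2 ^ (-((∑ i, relEnt ((z x).1 (x i)) (z x).2) + n * ε' - n * r + ℓ)) *
          (2 ^ ((∑ i, relEnt ((z x).1 (x i)) (z x).2) + n * ε') * ∏ i, (z x).2 (y i)) := by
          refine mul_le_mul ?_ (hT2 x y hy) (hv0 x y) (by positivity)
          exact Real.rpow_le_rpow_of_exponent_le one_le_two (neg_le_neg (le_max_left _ _))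
      _ = 2 ^ (n * r) * ((∏ i, (z x).2 (y i)) / S.card) := by
          rw [← mul_assoc, ← Real.rpow_add two_pos]
          have e : -((∑ i, relEnt ((z x).1 (x i)) (z x).2) + n * ε' - n * r + ℓ) +
              ((∑ i, relEnt ((z x).1 (x i)) (z x).2) + n * ε') = n * r - ℓ := by ring
          rw [e, Real.rpow_sub two_pos, hℓ, Real.rpow_logb two_pos (by norm_num) hcard0]
          ring
      _ ≤ 2 ^ (n * r) * Q.1 y := by
          change _ ≤ 2 ^ (n * r) * ((∑ w ∈ S, ∏ i, w.2 (y i)) / S.card)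
          gcongr
          exact Finset.single_le_sum (f := fun w : (X → Y → ℝ) × (Y → ℝ) => ∏ i, w.2 (y i))
            (fun w hw => Finset.prod_nonneg fun i _ => (hQpos w hw _).le) (hzS x)
  · rw [← Finset.mul_sum]
    refine mul_le_one₀ (Real.rpow_le_one_of_one_le_of_nonpos one_le_two
      (neg_nonpos.2 (le_max_right _ _))) (Finset.sum_nonneg fun y _ => hite x y) ?_
    rw [← sum_prod_eq_one (fun i => (z x).1 (x i)) fun i => hV1 x _]
    refine Finset.sum_le_sum fun y _ => ?_
    split_ifs
    exacts [le_rfl, hv0 x y]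
  · refine le_trans ?_ (le_fidelity_of_typical h0 h1 (transProb_nonneg (prodChannel W n) x)
      (hv0 x) (T x) (hT1 x) (hT3 x))
    apply ENNReal.ofReal_le_ofReal
    refine Real.rpow_le_rpow_of_exponent_le one_le_two (neg_le_neg ?_)
    have hu' : u x ≤ max (∑ i, relEnt ((z x).1 (x i)) (z x).2 - n * r) 0 + n * ε' + ℓ := by
      have hne : 0 ≤ n * ε' := by positivity
      refine max_le ?_ ?_
      · linarith [le_max_left (∑ i, relEnt ((z x).1 (x i)) (z x).2 - n * r) 0]
      · linarith [le_max_right (∑ i, relEnt ((z x).1 (x i)) (z x).2 - n * r) 0]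
    have hε'' : n * ε' + a * (n * ε') = n * ε := by
      rw [hε']
      field_simp
    have := hcost x
    rw [← ha, mul_add a]
    linarith

lemma strongConverseExponent_le_of_lt_one [Nonempty X] {α : ℝ} (h0 : 0 < α) (h1 : α < 1)
    (W : Channel X Y) {r E : ℝ} (hr : 0 ≤ r) (hE0 : 0 ≤ E)
    (hE : ∀ β, α ≤ β → β < 1 → ∀ I : ℝ, renyiCapacity (ENNReal.ofReal β) W = (I : EReal) →
        α * (1 - β) / (β * (1 - α)) * (I - r) ≤ E) :
    strongConverseExponent (ENNReal.ofReal α) W r ≤ (E : EReal) := by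
  refine strongConverseExponent_le hr fun ε hε => ?_
  obtain ⟨δ, hδ0, hδ1, hδ⟩ := exists_delta (show 0 < ε / 6 by linarith)
  obtain ⟨S, hS, hSE⟩ := exists_finite_strategies h0 h1 W hE0 hE (by linarith) hδ0 hδ1 hδ
  obtain ⟨C, hC⟩ := optDiv_prodChannel_le_of_lt_one h0 h1 W hr hδ0 S hS hSE
    (show 0 < ε / 3 by linarith)
  obtain ⟨n₀, hn₀⟩ := exists_nat_ge (C / (ε / 3))
  filter_upwards [hC, Filter.eventually_ge_atTop n₀] with n hn hnn
  refine hn.trans (EReal.coe_le_coe_iff.2 ?_)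
  have hCn : C ≤ n * (ε / 3) := by
    rw [← div_le_iff₀ (by linarith)]
    exact hn₀.trans (by exact_mod_cast hnn)
  calc _ ≤ n * (E + 2 * (ε / 6) + ε / 3) + n * (ε / 3) := by gcongr
    _ = n * (E + ε) := by ring

lemma le_strongConverseExponent_of_lt_one {α β : ℝ} (h0 : 0 < α) (hαβ : α ≤ β)
    (hβ : β < 1) {W : Channel X Y} {r I : ℝ}
    (hI : renyiCapacity (ENNReal.ofReal β) W = (I : EReal)) :
    ((α * (1 - β) / (β * (1 - α)) * (I - r) : ℝ) : EReal) ≤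
      strongConverseExponent (ENNReal.ofReal α) W r := by
  have hs : 0 < α * (1 - β) / (β * (1 - α)) :=
    div_pos (mul_pos h0 (by linarith)) (mul_pos (by linarith) (by linarith))
  set s := α * (1 - β) / (β * (1 - α)) with hsdef
  refine le_of_forall_lt fun z hz => ?_
  obtain ⟨u, hu, huz⟩ := EReal.lt_iff_exists_real_btwn.1 hz
  refine hu.trans_le ?_
  have h1 : u < s * (I - r) := by exact_mod_cast huz
  have h2 : u / s + r < I := by
    rw [← lt_sub_iff_add_lt, div_lt_iff₀ hs, mul_comm]
    exact h1
  have h3 := mul_renyiCapacity_sub_le (r := r) h0 hαβ hβ (W := W) (t := u / s + r) (by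
    rw [hI]
    exact_mod_cast h2)
  rwa [add_sub_cancel_right, ← hsdef, mul_div_cancel₀ _ hs.ne'] at h3

end NFold

end RenyiSim

/-! ### The theorem. -/

theorem theorem3 {X Y : Type*} [Fintype X] [Nonempty X] [Fintype Y]
    (W : RenyiSim.Channel X Y) (r : ℝ) (hr : 0 ≤ r) :
    (∀ α : ℝ, 0 < α → α < 1 →
      IsGreatest
        ((fun β : ℝ => ((α * (1 - β) / (β * (1 - α)) : ℝ) : EReal) *
            (RenyiSim.renyiCapacity (ENNReal.ofReal β) W - (r : EReal))) '' Set.Icc α 1)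
        (RenyiSim.strongConverseExponent (ENNReal.ofReal α) W r)) ∧
    (∀ α : ENNReal, α = 0 ∨ 1 ≤ α →
      RenyiSim.strongConverseExponent α W r =
        max (RenyiSim.renyiCapacity α W - (r : EReal)) 0) := by
  refine ⟨fun α h0 h1 => ?_, fun α hα => RenyiSim.strongConverseExponent_eq_max hα W hr⟩
  have hY : Nonempty Y := RenyiSim.nonempty_of_stdSimplex (W (Classical.arbitrary X))
  obtain ⟨E, hE0, ⟨β, hβ, hβE⟩, hE⟩ := RenyiSim.exists_max_exponent h0 h1 W r
  have hupper : ∀ γ ∈ Set.Icc α 1, ((α * (1 - γ) / (γ * (1 - α)) : ℝ) : EReal) *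
      (RenyiSim.renyiCapacity (ENNReal.ofReal γ) W - (r : EReal)) ≤
        RenyiSim.strongConverseExponent (ENNReal.ofReal α) W r := by
    intro γ hγ
    obtain ⟨I, hI⟩ := RenyiSim.exists_renyiCapacity_eq (ENNReal.ofReal γ) W
    -- At order `1` the prefactor vanishes and the bound is nonnegativity of the exponent.
    rcases hγ.2.eq_or_lt with rfl | hγ1
    · simpa using RenyiSim.strongConverseExponent_nonneg (ENNReal.ofReal α) W r
    · rw [hI]
      exact_mod_cast RenyiSim.le_strongConverseExponent_of_lt_one h0 hγ.1 hγ1 hI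
  refine ⟨⟨β, hβ, le_antisymm (hupper β hβ) ?_⟩, ?_⟩
  · exact (RenyiSim.strongConverseExponent_le_of_lt_one h0 h1 W hr hE0 hE).trans_eq hβE.symm
  · rintro _ ⟨γ, hγ, rfl⟩
    exact hupper γ hγ
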